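/- Let $N\ge 1$ and let $\mathcal D^N=\mathbb C[t,t^{-1}]\otimes\mathbb C[D]\otimes gl_N$ be the Lie algebra of $N\times N$-matrix differential operators on the circle, $D=t\frac{d}{dt}$, i.e. the commutator Lie algebra of the associative algebra with product $(t^if(D)A)\cdot(t^kg(D)B)=t^{i+k}f(D+k)g(D)AB$. Let $\widehat{\mathcal D^N}=\mathcal D^N\oplus\mathbb C\,C$ be its universal central extension: $C$ is central and, with $[D]_j=D(D-1)\cdots(D-j+1)$, $$[t^i[D]_jA,\,t^k[D]_lB]=(t^i[D]_jA)\cdot(t^k[D]_lB)-(t^k[D]_lB)\cdot(t^i[D]_jA)+\delta_{i,-k}(-1)^j\,j!\,l!\binom{i+j}{j+l+1}\operatorname{tr}(AB)\,C .$$ Its principal $\mathbb Z$-gradation is $(\widehat{\mathcal D^N})_d=\operatorname{span}\{t^kD^jE_{p,q}\mid kN+p-q=d\}\oplus\delta_{d,0}\mathbb C\,C$. A quasifinite module is a $\widehat{\mathcal D^N}$-module with a gradation $V=\bigoplus_{j\in\mathbb Z}V_j$ such that $(\widehat{\mathcal D^N})_iV_j\subset V_{i+j}$ and $\dim V_j<\infty$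 for all $i,j$. It is a module of the intermediate series if $\dim V_j\le 1$ for all $j$, and uniformly bounded if there is an integer $K>0$ with $\dim V_j\le K$ for all $j$. A highest (resp. lowest) weight vector is a nonzero homogeneous $v$ with $(\widehat{\mathcal D^N})_0v\subset\mathbb Cv$ and $(\widehat{\mathcal D^N})_dv=0$ for all $d>0$ (resp. all $d<0$); a highest (resp. lowest) weight module is one generated by such a vector. A module is trivial if $\widehat{\mathcal D^N}$ acts by zero, and indecomposable if it is nonzero and not the direct sum of two nonzero submodules. For $m\ge1$ and a linear transformation $\alpha$ of $\mathbb C^m$, let $V(m,\alpha)$ and $\overline V(m,\alpha)$ be the modules with underlying space $\bigoplus_{k\in\mathbb Z}\{v_k\mid v\in\mathbb C^N\otimes\mathbb C^m\}$ (where $v\mapsto v_k$ is linear and injective), on which $C$ acts by $0$ and, for $i,k\in\mathbb Z$, $j\ge0$, $A\in gl_N$, $$(t^iD^jA)v_k=\big((k+\alpha)^jAv\big)_{i+k}\quad\text{in }V(m,\alpha),\qquad (t^iD^jA)v_k=(-1)^{j+1}\big((i+k+\alpha)^jA^{\mathrm T}v\big)_{i+k}\quad\text{in }\overline V(m,\alpha);$$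 here $A$ acts on $\mathbb C^N$ and $\alpha$ on $\mathbb C^m$. For $\alpha\in\mathbb C$ write $V(\alpha)=V(1,\alpha)$ and $\overline V(\alpha)=\overline V(1,\alpha)$. A linear transformation of $\mathbb C^m$, $m\geq 1$, is indecomposable if $\mathbb C^m$ is not the direct sum of two nonzero invariant subspaces. **Theorem.** (i) Every irreducible quasifinite $\widehat{\mathcal D^N}$-module is a highest weight module, a lowest weight module, or a module of the intermediate series. Every nontrivial module of the intermediate series is isomorphic, as a $\widehat{\mathcal D^N}$-module, to $V(\alpha)$ or $\overline V(\alpha)$ for some $\alpha\in\mathbb C$. (ii) Every nontrivial indecomposable uniformly bounded $\widehat{\mathcal D^N}$-module is isomorphic, as a $\widehat{\mathcal D^N}$-module, to $V(m,\alpha)$ or $\overline V(m,\alpha)$ for some integer $m\ge1$ and some indecomposable linear transformation $\alpha$ of $\mathbb C^m$. -/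

import Mathlib

open Polynomial

namespace MatDiffOp

noncomputable section

/-! ### The associative algebra of matrix differential operators on the circle -/

/-- Matrix-valued polynomials `f(D)`, i.e. `ℂ[D] ⊗ gl_N`. -/
abbrev Coeff (N : ℕ) : Type := Matrix (Fin N) (Fin N) ℂ[X]

/-- The substitution `f(D) ↦ f(D + k)`. -/
def shift (N : ℕ) (k : ℤ) : Coeff N →ₐ[ℂ] Coeff N :=
  (Polynomial.taylorAlgHom (k : ℂ)).mapMatrix

/-- The value `f(k)`, a complex matrix, of a matrix-valued polynomial at an integer. -/
def evalAt (N : ℕ) (k : ℤ) : Coeff N →ₐ[ℂ] Matrix (Fin N) (Fin N) ℂ :=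
  (Polynomial.aeval (k : ℂ)).mapMatrix

/-- The anti-automorphism `f(D) ↦ f(-D - i)ᵀ`, as a linear map. -/
def reflect (N : ℕ) (i : ℤ) : Coeff N →ₗ[ℂ] Coeff N :=
  (Matrix.transposeLinearEquiv (Fin N) (Fin N) ℂ ℂ[X]).toLinearMap ∘ₗ
    ((Polynomial.aeval (-X - C (i : ℂ)) : ℂ[X] →ₐ[ℂ] ℂ[X]).mapMatrix).toLinearMap

lemma shift_apply {N : ℕ} (k : ℤ) (f : Coeff N) (p q : Fin N) :
    shift N k f p q = (f p q).comp (X + C (k : ℂ)) := by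
  simp [shift, taylor_apply]

lemma evalAt_apply {N : ℕ} (k : ℤ) (f : Coeff N) (p q : Fin N) :
    evalAt N k f p q = (f p q).eval (k : ℂ) := by
  simp [evalAt]

lemma reflect_apply {N : ℕ} (i : ℤ) (f : Coeff N) (p q : Fin N) :
    reflect N i f p q = (f q p).comp (-X - C (i : ℂ)) := by
  simp [reflect, Polynomial.aeval_def, Polynomial.comp]

lemma shift_shift {N : ℕ} (k l : ℤ) (f : Coeff N) :
    shift N l (shift N k f) = shift N (k + l) f := by
  ext1 p q
  simp [shift_apply, comp_assoc, add_assoc, add_comm]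

@[simp] lemma shift_zero {N : ℕ} (f : Coeff N) : shift N 0 f = f := by
  ext1 p q
  simp [shift_apply]

@[simp] lemma evalAt_shift {N : ℕ} (k m : ℤ) (f : Coeff N) :
    evalAt N m (shift N k f) = evalAt N (m + k) f := by
  ext p q
  simp [shift_apply, evalAt_apply]

lemma reflect_shift_mul {N : ℕ} (i k : ℤ) (f g : Coeff N) :
    reflect N (i + k) (shift N k f * g) = shift N i (reflect N k g) * reflect N i f := by
  ext1 p q
  simp only [reflect_apply, shift_apply, Matrix.mul_apply, Polynomial.sum_comp]
  refine Finset.sum_congr rfl fun r _ => ?_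
  simp only [mul_comp, comp_assoc, add_comp, sub_comp, neg_comp, X_comp, C_comp]
  rw [mul_comm]
  congr 2 <;> (push_cast; simp only [C_add]; ring)

/-- The space `ℂ[t, t⁻¹] ⊗ ℂ[D] ⊗ gl_N` of matrix differential operators on the circle, where
`D = t d/dt`: the finitely supported family `a` stands for the operator `∑ᵢ tⁱ (a i)(D)`. -/
def DiffOp (N : ℕ) : Type := ℤ →₀ Coeff N

namespace DiffOp

variable {N : ℕ}

instance : AddCommGroup (DiffOp N) := inferInstanceAs (AddCommGroup (ℤ →₀ Coeff N))
instance : Module ℂ (DiffOp N) := inferInstanceAs (Module ℂ (ℤ →₀ Coeff N))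

/-- The operator `tⁱ f(D)`, as a linear function of `f`. -/
def mono (i : ℤ) : Coeff N →ₗ[ℂ] DiffOp N := Finsupp.lsingle i

/-- The operator `tⁱ Dʲ A`. -/
def op (i : ℤ) (j : ℕ) (A : Matrix (Fin N) (Fin N) ℂ) : DiffOp N :=
  mono i (A.map fun a => C a * X ^ j)

lemma ind {P : DiffOp N → Prop} (a : DiffOp N) (hadd : ∀ a b, P a → P b → P (a + b))
    (hmono : ∀ i f, P (mono i f)) : P a := by
  refine Finsupp.induction_linear (motive := P) a ?_ hadd hmono
  have h := hmono 0 0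
  rwa [map_zero] at h

/-- The linear map on `DiffOp N` with prescribed values on the operators `tⁱ f(D)`. -/
def lift {M : Type*} [AddCommMonoid M] [Module ℂ M] (φ : ℤ → Coeff N →ₗ[ℂ] M) :
    DiffOp N →ₗ[ℂ] M :=
  Finsupp.lsum ℂ φ

/-- The bilinear map on `DiffOp N` with prescribed values on the operators `tⁱ f(D)`. -/
def lift₂ {M : Type*} [AddCommMonoid M] [Module ℂ M]
    (φ : ℤ → ℤ → Coeff N →ₗ[ℂ] Coeff N →ₗ[ℂ] M) : DiffOp N →ₗ[ℂ] DiffOp N →ₗ[ℂ] M :=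
  lift fun i => (lift fun k => (φ i k).flip).flip

@[simp] lemma lift_mono {M : Type*} [AddCommMonoid M] [Module ℂ M]
    (φ : ℤ → Coeff N →ₗ[ℂ] M) (i : ℤ) (f : Coeff N) : lift φ (mono i f) = φ i f :=
  Finsupp.lsum_single ℂ φ i f

@[simp] lemma lift₂_mono {M : Type*} [AddCommMonoid M] [Module ℂ M]
    (φ : ℤ → ℤ → Coeff N →ₗ[ℂ] Coeff N →ₗ[ℂ] M) (i k : ℤ) (f g : Coeff N) :
    lift₂ φ (mono i f) (mono k g) = φ i k f g := by
  simp [lift₂]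

/-- The product `tⁱ f(D) · tᵏ g(D) = tⁱ⁺ᵏ f(D + k) g(D)`, extended bilinearly. -/
def mulHom : DiffOp N →ₗ[ℂ] DiffOp N →ₗ[ℂ] DiffOp N :=
  lift₂ fun i k =>
    ((LinearMap.mul ℂ (Coeff N)).comp (shift N k).toLinearMap).compr₂ (mono (i + k))

instance : Mul (DiffOp N) := ⟨fun a b => mulHom a b⟩
instance : One (DiffOp N) := ⟨mono 0 1⟩

lemma one_def : (1 : DiffOp N) = mono 0 1 := rfl

lemma mul_def (a b : DiffOp N) : a * b = mulHom a b := rfl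

@[simp] lemma mono_mul_mono (i k : ℤ) (f g : Coeff N) :
    mono i f * mono k g = mono (i + k) (shift N k f * g) := by
  simp [mul_def, mulHom]

protected lemma add_mul' (a b c : DiffOp N) : (a + b) * c = a * c + b * c := by
  simp [mul_def]

protected lemma mul_add' (a b c : DiffOp N) : a * (b + c) = a * b + a * c := by
  simp [mul_def]

instance : Ring (DiffOp N) :=
  { (inferInstance : AddCommGroup (DiffOp N)) with
    left_distrib := DiffOp.mul_add'
    right_distrib := DiffOp.add_mul'
    zero_mul := fun a => by simp [mul_def]
    mul_zero := fun a => by simp [mul_def]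
    one_mul := fun a => by
      induction a using ind with
      | hadd a b ha hb => rw [DiffOp.mul_add', ha, hb]
      | hmono i f => simp [one_def]
    mul_one := fun a => by
      induction a using ind with
      | hadd a b ha hb => rw [DiffOp.add_mul', ha, hb]
      | hmono i f => simp [one_def]
    mul_assoc := fun a b c => by
      induction a using ind with
      | hadd a a' h h' => simp only [DiffOp.add_mul', h, h']
      | hmono i f =>
      induction b using ind with
      | hadd b b' h h' => simp only [DiffOp.add_mul', DiffOp.mul_add', h, h']
      | hmono k g =>
      induction c using ind with
      | hadd c c' h h' => simp only [DiffOp.mul_add', h, h']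
      | hmono l u => simp [shift_shift, add_assoc, mul_assoc] }

/-- The associative algebra of matrix differential operators on the circle. -/
instance : Algebra ℂ (DiffOp N) :=
  Algebra.ofModule (fun r a b => by simp [mul_def]) (fun r a b => by simp [mul_def])

/-! ### The two-cocycle -/

/-- The signed sum `∑_{a ≤ m < b} F m`, with `signedSum F a b = - signedSum F b a`. -/
def signedSum (F : ℤ → ℂ) (a b : ℤ) : ℂ :=
  ∑ m ∈ Finset.Ico a b, F m - ∑ m ∈ Finset.Ico b a, F m

lemma signedSum_swap (F : ℤ → ℂ) (a b : ℤ) : signedSum F b a = -signedSum F a b := by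
  simp [signedSum]

lemma signedSum_succ (F : ℤ → ℂ) (a b : ℤ) :
    signedSum F a (b + 1) = signedSum F a b + F b := by
  unfold signedSum
  rcases le_or_gt a b with h | h
  · rw [Finset.Ico_eq_empty (a := b + 1) (by omega), Finset.Ico_eq_empty (a := b) (by omega),
      show Finset.Ico a (b + 1) = insert b (Finset.Ico a b) by ext; simp; omega,
      Finset.sum_insert (by simp)]
    simp [add_comm]
  · rw [Finset.Ico_eq_empty (b := b + 1) (by omega), Finset.Ico_eq_empty (b := b) (by omega),
      show Finset.Ico b a = insert b (Finset.Ico (b + 1) a) by ext; simp; omega,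
      Finset.sum_insert (by simp)]
    simp

lemma signedSum_add (F : ℤ → ℂ) (a b c : ℤ) :
    signedSum F a b + signedSum F b c = signedSum F a c := by
  induction c using Int.inductionOn' (b := b) with
  | zero => simp [signedSum]
  | succ k _ h => rw [signedSum_succ, signedSum_succ, ← h]; ring
  | pred k _ h =>
    have h₁ := signedSum_succ F a (k - 1)
    have h₂ := signedSum_succ F b (k - 1)
    rw [sub_add_cancel] at h₁ h₂
    linear_combination h - h₂ + h₁

lemma signedSum_shift (F : ℤ → ℂ) (a b s : ℤ) :
    signedSum (fun m => F (m + s)) a b = signedSum F (a + s) (b + s) := by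
  simp only [signedSum, ← Finset.map_add_right_Ico, Finset.sum_map, addRightEmbedding_apply]

/-- The values of the cocycle on homogeneous operators: for `i + k = 0` and `i ≥ 0`,
`Ψ(tⁱ f(D), tᵏ g(D)) = ∑_{-i ≤ m ≤ -1} tr (f(m) g(m + i))`; it is antisymmetric and vanishes for
`i + k ≠ 0`. In terms of `[D]_j = D (D - 1) ⋯ (D - j + 1)`, its value on
`tⁱ [D]_j A, t⁻ⁱ [D]_l B` is `(-1)ʲ j! l! (i + j choose j + l + 1) tr (A B)`. -/
def cocycleAux (i k : ℤ) : Coeff N →ₗ[ℂ] Coeff N →ₗ[ℂ] ℂ :=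
  LinearMap.mk₂ ℂ
    (fun f g => if i + k = 0 then
      signedSum (fun m => (evalAt N m f * evalAt N (m + i) g).trace) (-i) 0 else 0)
    (fun f f' g => by
      split_ifs <;> simp [signedSum, add_mul, Finset.sum_add_distrib]; ring)
    (fun c f g => by
      split_ifs <;> simp [signedSum, ← Finset.mul_sum]; ring)
    (fun f g g' => by
      split_ifs <;> simp [signedSum, mul_add, Finset.sum_add_distrib]; ring)
    (fun c f g => by
      split_ifs <;> simp [signedSum, ← Finset.mul_sum]; ring)

/-- The two-cocycle `Ψ` on the Lie algebra of matrix differential operators on the circle. -/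
def cocycle : DiffOp N →ₗ[ℂ] DiffOp N →ₗ[ℂ] ℂ := lift₂ cocycleAux

lemma cocycle_mono (i k : ℤ) (f g : Coeff N) :
    cocycle (mono i f) (mono k g) = if i + k = 0 then
      signedSum (fun m => (evalAt N m f * evalAt N (m + i) g).trace) (-i) 0 else 0 := by
  simp [cocycle, cocycleAux]

lemma cocycle_skew (a b : DiffOp N) : cocycle a b = -cocycle b a := by
  induction a using ind with
  | hadd a a' h h' => simp only [map_add, LinearMap.add_apply, h, h']; ring
  | hmono i f =>
  induction b using ind with
  | hadd b b' h h' => simp only [map_add, LinearMap.add_apply, h, h']; ring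
  | hmono k g =>
  rw [cocycle_mono, cocycle_mono, add_comm k i]
  split_ifs with h
  · obtain rfl : k = -i := by omega
    have := signedSum_shift (fun m => (evalAt N m g * evalAt N (m + -i) f).trace) (-i) 0 i
    simp only [add_neg_cancel_right, neg_add_cancel, zero_add] at this
    rw [neg_neg, signedSum_swap _ 0 i, neg_neg, ← this]
    congr 1
    funext m
    rw [Matrix.trace_mul_comm]
  · simp

lemma cocycle_cyclic (a b c : DiffOp N) :
    cocycle (a * b) c + cocycle (b * c) a + cocycle (c * a) b = 0 := by
  induction a using ind with
  | hadd a a' h h' =>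
    simp only [map_add, LinearMap.add_apply, add_mul, mul_add]; linear_combination h + h'
  | hmono i f =>
  induction b using ind with
  | hadd b b' h h' =>
    simp only [map_add, LinearMap.add_apply, add_mul, mul_add]; linear_combination h + h'
  | hmono k g =>
  induction c using ind with
  | hadd c c' h h' =>
    simp only [map_add, LinearMap.add_apply, add_mul, mul_add]; linear_combination h + h'
  | hmono l u =>
  simp only [mono_mul_mono, cocycle_mono, map_mul, evalAt_shift]
  have h₁ : (k + l + i = 0) = (i + k + l = 0) := by congr 1; ring
  have h₂ : (l + i + k = 0) = (i + k + l = 0) := by congr 1; ring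
  simp only [h₁, h₂]
  split_ifs with h
  · obtain rfl : l = -i - k := by omega
    set F : ℤ → ℂ := fun m =>
      (evalAt N (m + k) f * evalAt N m g * evalAt N (m + (i + k)) u).trace with hF
    have e₂ := signedSum_shift F (-(k + (-i - k))) 0 (-i - k)
    have e₃ := signedSum_shift F (-(-i - k + i)) 0 (-k)
    have E₂ : (fun m => (evalAt N (m + (-i - k)) g * evalAt N m u *
        evalAt N (m + (k + (-i - k))) f).trace) = fun m => F (m + (-i - k)) := by
      funext m
      simp only [hF]
      rw [Matrix.trace_mul_cycle, show m + (-i - k) + k = m + (k + (-i - k)) by ring,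
        show m + (-i - k) + (i + k) = m by ring]
    have E₃ : (fun m => (evalAt N (m + i) u * evalAt N m f *
        evalAt N (m + (-i - k + i)) g).trace) = fun m => F (m + -k) := by
      funext m
      simp only [hF]
      rw [← Matrix.trace_mul_cycle, show m + -k + k = m by ring,
        show m + -k + (i + k) = m + i by ring, show m + (-i - k + i) = m + -k by ring]
    rw [E₂, E₃, e₂, e₃, show -(k + (-i - k)) + (-i - k) = -k by ring,
      show -(-i - k + i) + -k = 0 by ring, show -i - k = -(i + k) by ring, zero_add, zero_add]
    have a₁ := signedSum_add F (-k) (-(i + k)) 0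
    have a₂ := signedSum_add F 0 (-k) 0
    have a₃ : signedSum F 0 0 = 0 := by simp [signedSum]
    linear_combination a₁ + a₂ + a₃
  · simp

end DiffOp

/-! ### The central extension -/

/-- The universal central extension of the Lie algebra of matrix differential operators on the
circle. The pair `(a, c)` stands for `a + c C`, where `C` is the central element. -/
def HatD (N : ℕ) : Type := DiffOp N × ℂ

namespace HatD

variable {N : ℕ}

instance : AddCommGroup (HatD N) := inferInstanceAs (AddCommGroup (DiffOp N × ℂ))
instance : Module ℂ (HatD N) := inferInstanceAs (Module ℂ (DiffOp N × ℂ))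

/-- The operator part `a` of `a + c C`. -/
def toOp : HatD N →ₗ[ℂ] DiffOp N := LinearMap.fst ℂ (DiffOp N) ℂ

/-- The coefficient `c` of `a + c C`. -/
def coef : HatD N →ₗ[ℂ] ℂ := LinearMap.snd ℂ (DiffOp N) ℂ

/-- The linear inclusion `a ↦ a + 0 C`, which is not a Lie homomorphism. -/
def ofOp : DiffOp N →ₗ[ℂ] HatD N := LinearMap.inl ℂ (DiffOp N) ℂ

variable (N) in
/-- The central element `C`. -/
def central : HatD N := LinearMap.inr ℂ (DiffOp N) ℂ 1

@[ext] lemma ext {x y : HatD N} (h₁ : toOp x = toOp y) (h₂ : coef x = coef y) : x = y :=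
  Prod.ext h₁ h₂

@[simp] lemma toOp_ofOp (a : DiffOp N) : toOp (ofOp a) = a := rfl
@[simp] lemma coef_ofOp (a : DiffOp N) : coef (ofOp a) = 0 := rfl
@[simp] lemma toOp_central : toOp (central N) = 0 := rfl
@[simp] lemma coef_central : coef (central N) = 1 := rfl

/-- The bracket `[a + c C, b + d C] = (a · b - b · a) + Ψ(a, b) C`. -/
instance : Bracket (HatD N) (HatD N) :=
  ⟨fun x y => ofOp (toOp x * toOp y - toOp y * toOp x) +
    DiffOp.cocycle (toOp x) (toOp y) • central N⟩

lemma lie_def (x y : HatD N) : ⁅x, y⁆ = ofOp (toOp x * toOp y - toOp y * toOp x) +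
    DiffOp.cocycle (toOp x) (toOp y) • central N := rfl

@[simp] lemma toOp_lie (x y : HatD N) : toOp ⁅x, y⁆ = toOp x * toOp y - toOp y * toOp x := by
  simp [lie_def]

@[simp] lemma coef_lie (x y : HatD N) : coef ⁅x, y⁆ = DiffOp.cocycle (toOp x) (toOp y) := by
  simp [lie_def]

instance : LieRing (HatD N) where
  add_lie x y z := by
    ext1
    · simp only [toOp_lie, map_add]; noncomm_ring
    · simp
  lie_add x y z := by
    ext1
    · simp only [toOp_lie, map_add]; noncomm_ring
    · simp
  lie_self x := by
    ext1
    · simp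
    · have h := DiffOp.cocycle_skew (toOp x) (toOp x)
      simp only [coef_lie, map_zero]
      linear_combination h / 2
  leibniz_lie x y z := by
    ext1
    · simp only [toOp_lie, map_add]; noncomm_ring
    · simp only [coef_lie, toOp_lie, map_add, map_sub, LinearMap.sub_apply]
      have h₁ := DiffOp.cocycle_cyclic (toOp x) (toOp y) (toOp z)
      have h₂ := DiffOp.cocycle_cyclic (toOp x) (toOp z) (toOp y)
      rw [DiffOp.cocycle_skew (toOp x) (toOp y * toOp z),
        DiffOp.cocycle_skew (toOp x) (toOp z * toOp y),
        DiffOp.cocycle_skew (toOp y) (toOp x * toOp z),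
        DiffOp.cocycle_skew (toOp y) (toOp z * toOp x)]
      linear_combination h₂ - h₁

instance : LieAlgebra ℂ (HatD N) where
  lie_smul c x y := by
    ext1
    · simp [smul_sub]
    · simp

/-- The component of degree `d` of the principal `ℤ`-gradation: it is spanned by the
`tᵏ Dʲ E_{p,q}` with `k N + p - q = d` and, for `d = 0`, also by `C`. -/
def deg (N : ℕ) (d : ℤ) : Submodule ℂ (HatD N) :=
  Submodule.span ℂ
    ({x | ∃ (k : ℤ) (j : ℕ) (p q : Fin N), k * N + (p : ℤ) - (q : ℤ) = d ∧
        x = ofOp (DiffOp.op k j (Matrix.single p q 1))} ∪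
      {x | d = 0 ∧ x = central N})

end HatD

/-! ### Classes of modules -/

section Modules

variable (N : ℕ) {V : Type*} [AddCommGroup V] [Module ℂ V] [LieRingModule (HatD N) V]

/-- The family `𝒱` makes `V` a `ℤ`-graded module with finite-dimensional components. -/
structure IsQuasifinite (𝒱 : ℤ → Submodule ℂ V) : Prop where
  isInternal : DirectSum.IsInternal 𝒱
  lie_mem : ∀ i j : ℤ, ∀ x ∈ HatD.deg N i, ∀ v ∈ 𝒱 j, ⁅x, v⁆ ∈ 𝒱 (i + j)
  finite : ∀ j, FiniteDimensional ℂ (𝒱 j)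

/-- Modules of the intermediate series. -/
structure IsIntermediateSeries (𝒱 : ℤ → Submodule ℂ V) : Prop extends IsQuasifinite N 𝒱 where
  finrank_le_one : ∀ j, Module.finrank ℂ (𝒱 j) ≤ 1

/-- Uniformly bounded modules. -/
structure IsUniformlyBounded (𝒱 : ℤ → Submodule ℂ V) : Prop extends IsQuasifinite N 𝒱 where
  bounded : ∃ K : ℕ, 0 < K ∧ ∀ j, Module.finrank ℂ (𝒱 j) ≤ K

/-- Highest weight vectors: nonzero homogeneous vectors `v` with
`(HatD N)_0 v ⊆ ℂ v` and `(HatD N)_d v = 0` for `d > 0`. -/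
structure IsHighestWeightVector (𝒱 : ℤ → Submodule ℂ V) (v : V) : Prop where
  ne_zero : v ≠ 0
  homogeneous : ∃ j, v ∈ 𝒱 j
  lie_zero_mem : ∀ x ∈ HatD.deg N 0, ⁅x, v⁆ ∈ Submodule.span ℂ {v}
  lie_pos : ∀ d : ℤ, 0 < d → ∀ x ∈ HatD.deg N d, ⁅x, v⁆ = 0

/-- Lowest weight vectors: nonzero homogeneous vectors `v` with
`(HatD N)_0 v ⊆ ℂ v` and `(HatD N)_d v = 0` for `d < 0`. -/
structure IsLowestWeightVector (𝒱 : ℤ → Submodule ℂ V) (v : V) : Prop where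
  ne_zero : v ≠ 0
  homogeneous : ∃ j, v ∈ 𝒱 j
  lie_zero_mem : ∀ x ∈ HatD.deg N 0, ⁅x, v⁆ ∈ Submodule.span ℂ {v}
  lie_neg : ∀ d : ℤ, d < 0 → ∀ x ∈ HatD.deg N d, ⁅x, v⁆ = 0

/-- Highest weight modules: modules generated by a highest weight vector. -/
def IsHighestWeightModule (𝒱 : ℤ → Submodule ℂ V) : Prop :=
  ∃ v, IsHighestWeightVector N 𝒱 v ∧ LieSubmodule.lieSpan ℂ (HatD N) {v} = ⊤

/-- Lowest weight modules: modules generated by a lowest weight vector. -/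
def IsLowestWeightModule (𝒱 : ℤ → Submodule ℂ V) : Prop :=
  ∃ v, IsLowestWeightVector N 𝒱 v ∧ LieSubmodule.lieSpan ℂ (HatD N) {v} = ⊤

variable (V) in
/-- Indecomposable modules: nonzero modules that are not the direct sum of two nonzero
submodules. -/
def IsIndecomposable : Prop :=
  Nontrivial V ∧ ∀ W₁ W₂ : LieSubmodule ℂ (HatD N) V, IsCompl W₁ W₂ → W₁ = ⊥ ∨ W₂ = ⊥

end Modules

/-- Indecomposable linear transformations: the space is nonzero and is not the direct sum of two
nonzero invariant subspaces. -/
def IsIndecomposableEnd {W : Type*} [AddCommGroup W] [Module ℂ W] (α : Module.End ℂ W) : Prop :=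
  Nontrivial W ∧ ∀ p q : Submodule ℂ W, p ∈ α.invtSubmodule → q ∈ α.invtSubmodule →
    IsCompl p q → p = ⊥ ∨ q = ⊥

/-! ### The modules `V(m, α)` and their twists -/

section Tensor

variable {N : ℕ} {W : Type*} [AddCommGroup W] [Module ℂ W]

/-- The action `v ↦ f(k + α) v` of a matrix-valued polynomial on `ℂ^N ⊗ W = W^N`, where `α` is a
linear transformation of `W`. -/
def coeffAct (α : Module.End ℂ W) (k : ℤ) : Coeff N →ₐ[ℂ] Module.End ℂ (Fin N → W) :=
  (endVecAlgEquivMatrixEnd (Fin N) ℂ ℂ W).symm.toAlgHom.comp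
    (Polynomial.aeval (algebraMap ℂ (Module.End ℂ W) k + α)).mapMatrix

lemma coeffAct_apply (α : Module.End ℂ W) (k : ℤ) (f : Coeff N) (v : Fin N → W) (p : Fin N) :
    coeffAct α k f v p =
      ∑ q, Polynomial.aeval (algebraMap ℂ (Module.End ℂ W) k + α) (f p q) (v q) := rfl

lemma coeffAct_shift (α : Module.End ℂ W) (k l : ℤ) (f : Coeff N) :
    coeffAct α k (shift N l f) = coeffAct α (l + k) f := by
  refine LinearMap.ext fun v => ?_
  funext p
  simp only [coeffAct_apply, shift_apply, aeval_comp]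
  simp [add_assoc, add_comm]

variable (N) in
/-- The space `(ℂ^N ⊗ W)[t, t⁻¹] t^α`, where `ℂ^N ⊗ W = W^N` and `α` is a linear transformation
of `W`. It is the space of the module `V(m, α)` for `W = ℂ^m`, and of `V(α)` for `W = ℂ`. -/
def NatMod (_α : Module.End ℂ W) : Type _ := ℤ →₀ (Fin N → W)

variable (N) in
/-- The space of the twist of `NatMod N α`. -/
def TwistMod (α : Module.End ℂ W) : Type _ := NatMod N α

namespace NatMod

variable (α : Module.End ℂ W)

instance : AddCommGroup (NatMod N α) := inferInstanceAs (AddCommGroup (ℤ →₀ (Fin N → W)))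
instance : Module ℂ (NatMod N α) := inferInstanceAs (Module ℂ (ℤ →₀ (Fin N → W)))

/-- The vector `vₖ = tᵏ⁺ᵅ v`, as a linear function of `v`. -/
def vec (k : ℤ) : (Fin N → W) →ₗ[ℂ] NatMod N α := Finsupp.lsingle k

variable {α} in
lemma ind {P : NatMod N α → Prop} (w : NatMod N α) (hadd : ∀ v w, P v → P w → P (v + w))
    (hvec : ∀ k v, P (vec α k v)) : P w := by
  refine Finsupp.induction_linear (motive := P) w ?_ hadd hvec
  have h := hvec 0 0
  rwa [map_zero] at h

/-- The linear endomorphism with prescribed values on the vectors `vₖ`. -/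
def lift (φ : ℤ → (Fin N → W) →ₗ[ℂ] NatMod N α) : Module.End ℂ (NatMod N α) :=
  Finsupp.lsum ℂ φ

@[simp] lemma lift_vec (φ : ℤ → (Fin N → W) →ₗ[ℂ] NatMod N α) (k : ℤ) (v : Fin N → W) :
    lift α φ (vec α k v) = φ k v :=
  Finsupp.lsum_single ℂ φ k v

/-- The action of the operators: `tⁱ f(D)` sends `vₖ` to `(f(k + α) v)ᵢ₊ₖ`. -/
def act : DiffOp N →ₗ[ℂ] Module.End ℂ (NatMod N α) :=
  DiffOp.lift fun i =>
    { toFun := fun f => lift α fun k => vec α (i + k) ∘ₗ coeffAct α k f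
      map_add' := fun f g => by
        refine LinearMap.ext fun w => ?_
        induction w using NatMod.ind with
        | hadd v w h h' => rw [map_add, h, h', map_add]
        | hvec k v => simp
      map_smul' := fun c f => by
        refine LinearMap.ext fun w => ?_
        induction w using NatMod.ind with
        | hadd v w h h' => simp only [map_add, h, h']
        | hvec k v => simp }

@[simp] lemma act_mono_vec (i k : ℤ) (f : Coeff N) (v : Fin N → W) :
    act α (DiffOp.mono i f) (vec α k v) = vec α (i + k) (coeffAct α k f v) := by
  simp [act]

lemma act_mul (a b : DiffOp N) (w : NatMod N α) : act α (a * b) w = act α a (act α b w) := by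
  induction w using NatMod.ind with
  | hadd v w h h' => simp only [map_add, h, h']
  | hvec l v =>
  induction a using DiffOp.ind with
  | hadd a a' h h' => simp only [map_add, LinearMap.add_apply, add_mul, h, h']
  | hmono i f =>
  induction b using DiffOp.ind with
  | hadd b b' h h' => simp only [map_add, LinearMap.add_apply, mul_add, h, h']
  | hmono k g =>
  simp only [DiffOp.mono_mul_mono, act_mono_vec, map_mul, coeffAct_shift,
    Module.End.mul_apply, add_assoc]

/-- The central element acts by zero. -/
instance : LieRingModule (HatD N) (NatMod N α) where
  bracket x w := act α (HatD.toOp x) w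
  add_lie x y w := by simp only [map_add, LinearMap.add_apply]
  lie_add x v w := by simp only [map_add]
  leibniz_lie x y w := by
    simp only [HatD.toOp_lie, map_sub, LinearMap.sub_apply, act_mul, sub_add_cancel]

lemma lie_def (x : HatD N) (w : NatMod N α) : ⁅x, w⁆ = act α (HatD.toOp x) w := rfl

instance : LieModule ℂ (HatD N) (NatMod N α) where
  smul_lie c x w := by simp only [lie_def, map_smul, LinearMap.smul_apply]
  lie_smul c x w := by simp only [lie_def, map_smul]

/-- `(tⁱ Dʲ A) vₖ = ((k + α)ʲ A v)ᵢ₊ₖ`. -/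
lemma lie_vec (i k : ℤ) (j : ℕ) (A : Matrix (Fin N) (Fin N) ℂ) (v : Fin N → W) :
    ⁅HatD.ofOp (DiffOp.op i j A), vec α k v⁆ =
      vec α (i + k) fun p => ((algebraMap ℂ (Module.End ℂ W) k + α) ^ j) (∑ q, A p q • v q) := by
  rw [lie_def, HatD.toOp_ofOp, DiffOp.op, act_mono_vec]
  congr 1
  funext p
  rw [coeffAct_apply, map_sum]
  refine Finset.sum_congr rfl fun q _ => ?_
  simp [← Algebra.smul_def]

end NatMod

/-- The automorphism `σ` of the Lie algebra of matrix differential operators on the circle,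
`σ(tⁱ f(D)) = -tⁱ f(-D - i)ᵀ`, that is, `σ(tⁱ Dʲ A) = (-1)ʲ⁺¹ tⁱ (D + i)ʲ Aᵀ`. -/
def sigma (N : ℕ) : DiffOp N →ₗ[ℂ] DiffOp N :=
  DiffOp.lift fun i => -(DiffOp.mono i ∘ₗ reflect N i)

lemma sigma_mul (a b : DiffOp N) : sigma N (a * b) = -(sigma N b * sigma N a) := by
  induction a using DiffOp.ind with
  | hadd a a' h h' => simp only [map_add, add_mul, mul_add, h, h']; abel
  | hmono i f =>
  induction b using DiffOp.ind with
  | hadd b b' h h' => simp only [map_add, add_mul, mul_add, h, h']; abel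
  | hmono k g => simp [sigma, reflect_shift_mul, add_comm]

namespace TwistMod

variable (α : Module.End ℂ W)

instance : AddCommGroup (TwistMod N α) := inferInstanceAs (AddCommGroup (NatMod N α))
instance : Module ℂ (TwistMod N α) := inferInstanceAs (Module ℂ (NatMod N α))

/-- The identification of the space of the twisted module with that of the module. -/
def of : NatMod N α ≃ₗ[ℂ] TwistMod N α := LinearEquiv.refl ℂ (NatMod N α)

/-- The action of `x` on the twisted module is the action of `σ(x)` on the module; the central
element acts by zero. -/
instance : LieRingModule (HatD N) (TwistMod N α) where
  bracket x w := of α (NatMod.act α (sigma N (HatD.toOp x)) ((of α).symm w))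
  add_lie x y w := by simp only [map_add, LinearMap.add_apply]
  lie_add x v w := by simp only [map_add]
  leibniz_lie x y w := by
    simp only [HatD.toOp_lie, map_sub, LinearMap.sub_apply, sigma_mul, map_neg,
      LinearMap.neg_apply, NatMod.act_mul, LinearEquiv.symm_apply_apply]
    abel

lemma lie_def (x : HatD N) (w : TwistMod N α) :
    ⁅x, w⁆ = of α (NatMod.act α (sigma N (HatD.toOp x)) ((of α).symm w)) := rfl

instance : LieModule ℂ (HatD N) (TwistMod N α) where
  smul_lie c x w := by simp only [lie_def, map_smul, LinearMap.smul_apply]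
  lie_smul c x w := by simp only [lie_def, map_smul]

/-- `(tⁱ Dʲ A) vₖ = (-1)ʲ⁺¹ ((i + k + α)ʲ Aᵀ v)ᵢ₊ₖ`. -/
lemma lie_vec (i k : ℤ) (j : ℕ) (A : Matrix (Fin N) (Fin N) ℂ) (v : Fin N → W) :
    ⁅HatD.ofOp (DiffOp.op i j A), of α (NatMod.vec α k v)⁆ =
      (-1 : ℂ) ^ (j + 1) • of α (NatMod.vec α (i + k) fun p =>
        ((algebraMap ℂ (Module.End ℂ W) ((i + k : ℤ) : ℂ) + α) ^ j) (∑ q, A q p • v q)) := by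
  rw [lie_def, HatD.toOp_ofOp, DiffOp.op, LinearEquiv.symm_apply_apply, sigma, DiffOp.lift_mono,
    LinearMap.neg_apply, LinearMap.comp_apply, map_neg, LinearMap.neg_apply, map_neg,
    NatMod.act_mono_vec, pow_succ, mul_neg_one, neg_smul, ← map_smul, ← map_smul]
  congr 3
  funext p
  rw [Pi.smul_apply, coeffAct_apply, map_sum, Finset.smul_sum]
  refine Finset.sum_congr rfl fun q _ => ?_
  have e : -(algebraMap ℂ (Module.End ℂ W) k + α) - algebraMap ℂ (Module.End ℂ W) i =
      (-1 : ℂ) • (algebraMap ℂ (Module.End ℂ W) ((i + k : ℤ) : ℂ) + α) := by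
    rw [Int.cast_add, map_add, neg_one_smul]; abel
  simp only [reflect_apply, Matrix.map_apply, aeval_comp, map_mul, map_pow, aeval_C, aeval_X,
    map_sub, map_neg]
  rw [e, _root_.smul_pow, ← Algebra.smul_def]
  simp [smul_comm (A q p)]

end TwistMod

end Tensor

end

end MatDiffOp

/-!
The proof compares a module with the associative algebra of matrix differential operators.

*Scalar operators on bounded graded spaces.* For fixed `p` the operators `tᵏ f(D) E_{p,p}` act on
a uniformly bounded module as scalar differential operators (`ScalarAction`). A common eigenvector
of the `f(D) E_{p,p}` has a weight, a linear functional on `ℂ[x]`, and its brackets are governed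
by the functionals `bracketFun`. If such a functional has a point `b` in its support, one can move
the eigenvector to another one whose weight differs by evaluations at `b` and at a translate of `b`
(`exists_move`). As the functionals form a cocycle in `k`, a nonzero one provides infinitely many
moves (`exists_forall_mem_supp`, `exists_infinite_moves`), and so more distinct weights in one
degree than the dimension permits, unless the central charge vanishes and the weight is `0` or
`±` the evaluation at a point (`weight_eq`). Looking at generalized eigenspaces one
concludes that `E_{p,p}` is diagonalizable with eigenvalues `0`, `1`, `-1`, that the operators
`tᵏ f(D) E_{p,p}` multiply associatively on the eigenspace `1` and vanish on the eigenspace `0`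
(`structure_of_isBoundedGrading`); the eigenvalue `-1` reduces to `1` by a twist.

*Matrix operators on bounded modules.* Distinct `E_{p,p}`, `E_{q,q}` have orthogonal
supports: on a common eigenspace with eigenvalues `±1` the operator `t E_{p,p} · t⁻¹ E_{q,q}` would
be an invertible `S` with `T S - S T = S` for `T = D E_{p,p}`, which the trace excludes
(`finrank_eq_zero_of_comm`).
Hence the identity `1` acts with eigenvalues `0`, `1`, `-1`; the associative algebra
acts on the eigenspace `1`, it acts after the twist by `σ` on the eigenspace `-1`, and the action
on the eigenspace `0` is zero (`IsColumnLike`). These eigenspaces are submodules, so an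
indecomposable nontrivial module is one of the first two. A unital graded module over the
associative algebra is `V(W, α)`, where `W` is any component and `α` the action of `D` on it
(`natModMap_bijective`), because a matrix unit times a power of `t` maps any component to any other.

*Irreducible modules.* The vectors annihilated by the `tᵐ f(D) A` of bounded degree in `D` for all
large `m` (or for all large `-m`) form a submodule (`tailSubmodule`). If both these submodules are
zero, finitely many operators embed every component into finitely many copies of one
finite-dimensional space, because annihilation by the operators of degree at most `2` in `D`
propagates (`exists_forall_degreeLT_le_annih`), so the module is uniformly bounded. If one of them
is the whole module, there is a highest or lowest weight vector
(`IsQuasifinite.exists_extremal_vector`).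
-/

namespace MatDiffOp

noncomputable section

/-! ### Commuting operators on finite-dimensional invariant subspaces -/

section LinearAlgebra

variable {V : Type*} [AddCommGroup V] [Module ℂ V]

lemma eigenvalue_eq_of_mem_maxGenEigenspace {T : Module.End ℂ V} {μ c : ℂ} {v : V}
    (hv : v ∈ T.maxGenEigenspace μ) (h0 : v ≠ 0) (hc : T v = c • v) : c = μ := by
  rw [Module.End.mem_maxGenEigenspace] at hv
  obtain ⟨k, hk⟩ := hv
  have h : ∀ n : ℕ, ((T - μ • 1) ^ n) v = (c - μ) ^ n • v := by
    intro n
    induction n with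
    | zero => simp
    | succ n ih =>
      rw [pow_succ', Module.End.mul_apply, ih, map_smul, LinearMap.sub_apply, hc, pow_succ,
        mul_smul]
      simp [sub_smul]
  rw [h, smul_eq_zero] at hk
  rcases hk with hk | hk
  · exact sub_eq_zero.mp ((pow_eq_zero_iff (by rintro rfl; simp at hk)).mp hk)
  · exact absurd hk h0

lemma exists_eigenvector_of_invariant (T : Module.End ℂ V) (U : Submodule ℂ V)
    [FiniteDimensional ℂ U] (hU : U ≠ ⊥) (hinv : ∀ u ∈ U, T u ∈ U) :
    ∃ μ : ℂ, ∃ v ∈ U, v ≠ 0 ∧ T v = μ • v := by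
  have : Nontrivial U := Submodule.nontrivial_iff_ne_bot.mpr hU
  obtain ⟨μ, hμ⟩ := Module.End.exists_eigenvalue (T.restrict hinv)
  obtain ⟨v, hv⟩ := hμ.exists_hasEigenvector
  refine ⟨μ, v, v.2, fun h => hv.2 (Subtype.ext h), ?_⟩
  have := congrArg Subtype.val hv.apply_eq_smul
  simpa using this

theorem exists_common_eigenvector {ι : Type*} (T : ι → Module.End ℂ V)
    (hT : ∀ i j v, T i (T j v) = T j (T i v)) (U : Submodule ℂ V) [FiniteDimensional ℂ U]
    (hU : U ≠ ⊥) (hinv : ∀ i, ∀ u ∈ U, T i u ∈ U) :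
    ∃ v ∈ U, v ≠ 0 ∧ ∀ i, ∃ c : ℂ, T i v = c • v := by
  induction hn : Module.finrank ℂ U using Nat.strong_induction_on generalizing U with
  | _ n ih =>
  by_cases hs : ∀ i, ∃ c : ℂ, ∀ u ∈ U, T i u = c • u
  · obtain ⟨v, hv, h0⟩ := Submodule.exists_mem_ne_zero_of_ne_bot hU
    exact ⟨v, hv, h0, fun i => (hs i).imp fun c hc => hc v hv⟩
  · push Not at hs
    obtain ⟨i, hi⟩ := hs
    obtain ⟨μ, v, hv, h0, hμ⟩ := exists_eigenvector_of_invariant (T i) U hU (hinv i)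
    obtain ⟨u, hu, hne⟩ := hi μ
    set U' : Submodule ℂ V := U ⊓ (T i).eigenspace μ with hU'
    have hlt : U' < U := lt_of_le_of_ne inf_le_left fun h =>
      hne (Module.End.mem_eigenspace_iff.mp ((hU' ▸ h ▸ hu : u ∈ U ⊓ (T i).eigenspace μ).2))
    have : FiniteDimensional ℂ U' := Submodule.finiteDimensional_inf_left _ _
    obtain ⟨w, hw, h⟩ := ih _ (hn ▸ Submodule.finrank_lt_finrank_of_lt hlt) U'
      (fun h => h0 ((Submodule.mem_bot ℂ).mp (h ▸ ⟨hv, Module.End.mem_eigenspace_iff.mpr hμ⟩)))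
      (fun j u hu => ⟨hinv j u hu.1, Module.End.mem_eigenspace_iff.mpr (by
        rw [hT, Module.End.mem_eigenspace_iff.mp hu.2, map_smul])⟩) rfl
    exact ⟨w, hw.1, h⟩

lemma le_iSup_inf_maxGenEigenspace (T : Module.End ℂ V) (U : Submodule ℂ V)
    [FiniteDimensional ℂ U] (hinv : ∀ u ∈ U, T u ∈ U) :
    U ≤ ⨆ μ, U ⊓ T.maxGenEigenspace μ := by
  set S : Module.End ℂ U := T.restrict hinv with hS
  have h := Module.End.iSup_maxGenEigenspace_eq_top S
  have key : ∀ w : U, w ∈ ⨆ μ, S.maxGenEigenspace μ →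
      (w : V) ∈ ⨆ μ, U ⊓ T.maxGenEigenspace μ := by
    intro w hw
    induction hw using Submodule.iSup_induction' with
    | mem μ x hx =>
      refine Submodule.mem_iSup_of_mem μ ⟨x.2, ?_⟩
      rw [Module.End.maxGenEigenspace, hS, Module.End.genEigenspace_restrict] at hx
      exact hx
    | zero => exact Submodule.zero_mem _
    | add x y _ _ hx hy => exact Submodule.add_mem _ hx hy
  exact fun u hu => key ⟨u, hu⟩ (h ▸ Submodule.mem_top)

lemma le_maxGenEigenspace_of_forall (T : Module.End ℂ V) (U : Submodule ℂ V)
    [FiniteDimensional ℂ U] (hinv : ∀ u ∈ U, T u ∈ U) (γ : ℂ)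
    (h : ∀ μ : ℂ, U ⊓ T.maxGenEigenspace μ ≠ ⊥ → μ = γ) : U ≤ T.maxGenEigenspace γ := by
  refine (le_iSup_inf_maxGenEigenspace T U hinv).trans (iSup_le fun μ => ?_)
  by_cases hb : U ⊓ T.maxGenEigenspace μ = ⊥
  · rw [hb]; exact bot_le
  · rw [← h μ hb]
    exact inf_le_right

lemma apply_mem_maxGenEigenspace_add {T S : Module.End ℂ V} {c : ℂ}
    (h : ∀ v, T (S v) = S (T v) + c • S v) {β : ℂ} {v : V} (hv : v ∈ T.maxGenEigenspace β) :
    S v ∈ T.maxGenEigenspace (β + c) := by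
  rw [Module.End.mem_maxGenEigenspace] at hv ⊢
  obtain ⟨n, hn⟩ := hv
  refine ⟨n, ?_⟩
  have key : ∀ m : ℕ, ((T - (β + c) • 1) ^ m) (S v) = S (((T - β • 1) ^ m) v) := by
    intro m
    induction m with
    | zero => simp
    | succ m ih =>
      rw [pow_succ', Module.End.mul_apply, ih, pow_succ', Module.End.mul_apply]
      simp only [LinearMap.sub_apply, h, LinearMap.smul_apply, Module.End.one_apply, map_sub,
        map_smul]
      module
  rw [key, hn, map_zero]

lemma exists_pow_eq_zero_of_le_maxGenEigenspace (T : Module.End ℂ V) (U : Submodule ℂ V)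
    [FiniteDimensional ℂ U] (γ : ℂ) (h : U ≤ T.maxGenEigenspace γ) :
    ∃ n : ℕ, ∀ u ∈ U, ∀ m ≥ n, ((T - γ • 1) ^ m) u = 0 := by
  obtain ⟨s, hs⟩ := (Submodule.fg_iff_finiteDimensional U).mpr inferInstance
  have h1 : ∀ u ∈ s, ∃ n : ℕ, ((T - γ • 1) ^ n) u = 0 := fun u hu =>
    (Module.End.mem_maxGenEigenspace _ _ _).mp (h (hs ▸ Submodule.subset_span hu))
  choose! n hn using h1
  refine ⟨s.sup n, fun u hu m hm => ?_⟩
  rw [← hs] at hu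
  induction hu using Submodule.span_induction with
  | mem x hx =>
    obtain ⟨k, rfl⟩ := Nat.exists_eq_add_of_le' ((Finset.le_sup (f := n) hx).trans hm)
    rw [pow_add, Module.End.mul_apply, hn x hx, map_zero]
  | zero => simp
  | add x y _ _ hx hy => rw [map_add, hx, hy, add_zero]
  | smul c x _ hx => rw [map_smul, hx, smul_zero]

end LinearAlgebra

/-! ### Shifts of polynomials and supports of linear functionals -/

/-- The substitution `h(x) ↦ h(x + k)` on polynomials. -/
def tau (k : ℤ) : ℂ[X] →ₐ[ℂ] ℂ[X] := taylorAlgHom (k : ℂ)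

lemma tau_apply (k : ℤ) (h : ℂ[X]) : tau k h = h.comp (X + C (k : ℂ)) := by
  simp [tau, taylor_apply]

@[simp] lemma eval_tau (k : ℤ) (h : ℂ[X]) (a : ℂ) : (tau k h).eval a = h.eval (a + k) := by
  simp [tau_apply]

@[simp] lemma tau_zero (h : ℂ[X]) : tau 0 h = h := by simp [tau_apply]

@[simp] lemma tau_tau (k l : ℤ) (h : ℂ[X]) : tau k (tau l h) = tau (k + l) h := by
  simp [tau_apply, comp_assoc, add_assoc]

@[simp] lemma tau_X (k : ℤ) : tau k X = X + C (k : ℂ) := by simp [tau_apply]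

@[simp] lemma tau_C (k : ℤ) (c : ℂ) : tau k (C c) = C c := by simp [tau_apply]

lemma tau_ne_zero {k : ℤ} {q : ℂ[X]} (hq : q ≠ 0) : tau k q ≠ 0 := fun h => hq (by
  have := congrArg (tau (-k)) h
  simpa using this)

lemma exists_sub_tau_eq {k : ℤ} (hk : k ≠ 0) (p : ℂ[X]) : ∃ h : ℂ[X], h - tau k h = p := by
  have key : ∀ n : ℕ, ∀ p : ℂ[X], p.degree < n → ∃ h : ℂ[X], h - tau k h = p := by
    intro n
    induction n with
    | zero =>
      intro p hp
      have : p = 0 := by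
        rw [← degree_eq_bot]
        exact Nat.WithBot.lt_zero_iff.mp (by simpa using hp)
      exact ⟨0, by simp [this]⟩
    | succ n ih =>
      intro p hp
      have hn : ((n + 1 : ℕ) : ℂ) * k ≠ 0 :=
        mul_ne_zero (Nat.cast_ne_zero.mpr (Nat.succ_ne_zero n)) (Int.cast_ne_zero.mpr hk)
      set a : ℂ := p.coeff n / (((n + 1 : ℕ) : ℂ) * k) with ha
      set g : ℂ[X] := C a * X ^ (n + 1) with hg
      obtain ⟨h, hh⟩ := ih (p + (g - tau k g)) (by
        rw [degree_lt_iff_coeff_zero]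
        intro m hm
        have hc : (g - tau k g).coeff m =
            a * ((if m = n + 1 then 1 else 0) -
              (k : ℂ) ^ (n + 1 - m) * ((n + 1).choose m : ℂ)) := by
          rw [hg, map_mul, map_pow, tau_C, tau_X, ← mul_sub, coeff_C_mul, coeff_sub, coeff_X_pow,
            coeff_X_add_C_pow]
        rw [coeff_add, hc]
        rcases Nat.eq_or_lt_of_le hm with rfl | hm
        · have : (n + 1).choose n = n + 1 := by simp
          rw [this, if_neg (by omega), show n + 1 - n = 1 by omega, pow_one, ha]
          field_simp
          ring
        · rw [(degree_lt_iff_coeff_zero p (n + 1)).mp hp m hm]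
          rcases Nat.eq_or_lt_of_le hm with rfl | hm
          · simp
          · rw [Nat.choose_eq_zero_of_lt (by omega), if_neg (by omega)]
            simp)
      exact ⟨h - g, by rw [map_sub]; linear_combination hh⟩
  exact key (p.natDegree + 1) p
    (degree_le_natDegree.trans_lt (by exact_mod_cast Nat.lt_succ_self _))

/-- The polynomial `q` annihilates the functional `φ`, i.e. `φ` vanishes on the ideal `(q)`. -/
def Kills (q : ℂ[X]) (φ : ℂ[X] →ₗ[ℂ] ℂ) : Prop := ∀ h, φ (q * h) = 0

/-- The support of a linear functional on polynomials: the common zeros of the polynomials that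
annihilate it. -/
def supp (φ : ℂ[X] →ₗ[ℂ] ℂ) : Set ℂ := {b | ∀ q, Kills q φ → q.eval b = 0}

/-- A functional is torsion if a nonzero polynomial annihilates it, i.e. if it is a finite linear
combination of derivatives of evaluations at points. -/
def IsTorsionFunctional (φ : ℂ[X] →ₗ[ℂ] ℂ) : Prop := ∃ q, q ≠ 0 ∧ Kills q φ

lemma Kills.mul_left {q : ℂ[X]} {φ : ℂ[X] →ₗ[ℂ] ℂ} (h : Kills q φ) (r : ℂ[X]) :
    Kills (r * q) φ := fun g => by rw [mul_assoc, mul_left_comm]; exact h _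

lemma Kills.mul_right {q : ℂ[X]} {φ : ℂ[X] →ₗ[ℂ] ℂ} (h : Kills q φ) (r : ℂ[X]) :
    Kills (q * r) φ := mul_comm r q ▸ h.mul_left r

lemma Kills.add {q : ℂ[X]} {φ ψ : ℂ[X] →ₗ[ℂ] ℂ} (h : Kills q φ) (h' : Kills q ψ) :
    Kills q (φ + ψ) := fun g => by rw [LinearMap.add_apply, h, h', add_zero]

lemma exists_mem_supp {φ : ℂ[X] →ₗ[ℂ] ℂ} (h : IsTorsionFunctional φ) (h0 : φ ≠ 0) :
    ∃ b, b ∈ supp φ := by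
  let I : Ideal ℂ[X] :=
    { carrier := {q | Kills q φ}
      zero_mem' := fun g => by simp
      add_mem' := fun {a b} ha hb g => by rw [add_mul, map_add, ha g, hb g, add_zero]
      smul_mem' := fun c q hq => hq.mul_left c }
  obtain ⟨q, hq, hk⟩ := h
  set g := Submodule.IsPrincipal.generator I with hg
  have hmem : ∀ r, Kills r φ → g ∣ r := fun r hr =>
    (Submodule.IsPrincipal.mem_iff_generator_dvd I).mp hr
  have hgI : Kills g φ := Submodule.IsPrincipal.generator_mem I
  have hg0 : g ≠ 0 := fun h => hq (zero_dvd_iff.mp (h ▸ hmem q hk))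
  have hdeg : g.degree ≠ 0 := fun h => by
    obtain ⟨u, hu⟩ := isUnit_iff_degree_eq_zero.mpr h
    refine h0 (LinearMap.ext fun p => ?_)
    have := hgI ((↑u⁻¹ : ℂ[X]) * p)
    rw [← mul_assoc, ← hu, Units.mul_inv, one_mul] at this
    simpa using this
  obtain ⟨b, hb⟩ := IsAlgClosed.exists_root g hdeg
  exact ⟨b, fun r hr => eval_eq_zero_of_dvd_of_eval_eq_zero (hmem r hr) hb⟩

lemma mem_supp_add {φ ψ : ℂ[X] →ₗ[ℂ] ℂ} {b : ℂ} (hb : b ∈ supp φ) {q : ℂ[X]} (hq : Kills q ψ)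
    (h0 : q.eval b ≠ 0) : b ∈ supp (φ + ψ) := by
  intro r hr
  have h : (r * q).eval b = 0 := hb _ fun g => by
    have h1 := hr.mul_right q g
    rw [LinearMap.add_apply, hq.mul_left r g, add_zero] at h1
    exact h1
  rw [eval_mul] at h
  exact (mul_eq_zero.mp h).resolve_right h0

/-- Let `D` satisfy the cocycle relation `D (k + l) = D k + D l ∘ τₖ`, let `D 1` be torsion and
`D k ≠ 0` for `k ≠ 0`. Since `D k` is a sum of the translates of `D 1` by `0, …, k - 1`, a point
of its support either is far from the right end of this interval, and then it remains in the
support when `k` grows, or it is far from the left end, and then the same holds for the negative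
direction. -/
theorem exists_forall_mem_supp (D : ℤ → ℂ[X] →ₗ[ℂ] ℂ)
    (hD : ∀ k l h, D (k + l) h = D k h + D l (tau k h)) (h1 : IsTorsionFunctional (D 1))
    (hne : ∀ k, k ≠ 0 → D k ≠ 0) :
    ∃ (b : ℂ) (σ : ℤ) (k₀ : ℕ), (σ = 1 ∨ σ = -1) ∧ 0 < k₀ ∧
      ∀ k : ℕ, k₀ ≤ k → b ∈ supp (D (σ * k)) := by
  obtain ⟨q, hq, hk⟩ := h1
  have hD0 : D 0 = 0 := by
    refine LinearMap.ext fun h => ?_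
    have := hD 0 0 h
    simpa using this
  -- the translate of `D 1` by `k` is annihilated by the translate of `q`
  have hkill : ∀ k : ℤ, Kills (tau (-k) q) ((D 1).comp (tau k).toLinearMap) := by
    intro k h
    have := hk (tau k h)
    simpa using this
  have hsucc : ∀ k : ℤ, D (k + 1) = D k + (D 1).comp (tau k).toLinearMap := fun k =>
    LinearMap.ext fun h => hD k 1 h
  have hprod : ∀ n : ℕ, Kills (∏ i ∈ Finset.range n, tau (-(i : ℤ)) q) (D n) := by
    intro n
    induction n with
    | zero => intro h; simp [hD0]
    | succ n ih =>
      rw [Finset.prod_range_succ, Nat.cast_succ, hsucc]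
      exact (ih.mul_right _).add ((hkill n).mul_left _)
  have hprod0 : ∀ n : ℕ, ∏ i ∈ Finset.range n, tau (-(i : ℤ)) q ≠ 0 := fun n =>
    Finset.prod_ne_zero_iff.mpr fun i _ => tau_ne_zero hq
  -- a bound for the integer differences of roots of `q`
  obtain ⟨r, hr⟩ : ∃ r : ℕ, ∀ a b : ℂ, q.eval a = 0 → q.eval b = 0 → ∀ n : ℤ,
      a - b = n → n ≤ r := by
    obtain ⟨r, hr⟩ := exists_nat_ge (2 * ∑ a ∈ q.roots.toFinset, ‖a‖)
    refine ⟨r, fun a b ha hb n hn => ?_⟩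
    have hle : ∀ a, q.eval a = 0 → ‖a‖ ≤ ∑ a ∈ q.roots.toFinset, ‖a‖ := fun a ha =>
      Finset.single_le_sum (f := fun a : ℂ => ‖a‖) (fun _ _ => norm_nonneg _)
        (by simpa [hq] using ha)
    have h2 : ‖(n : ℂ)‖ ≤ r := by
      rw [← hn]
      linarith [norm_sub_le a b, hle a ha, hle b hb]
    rw [Complex.norm_intCast] at h2
    exact_mod_cast (le_abs_self _).trans h2
  set k₁ : ℕ := 2 * r + 2 with hk₁
  obtain ⟨b, hb⟩ := exists_mem_supp ⟨_, hprod0 k₁, hprod k₁⟩ (hne k₁ (by omega))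
  obtain ⟨i, hi, hbi⟩ : ∃ i : ℕ, i < k₁ ∧ q.eval (b - i) = 0 := by
    have := hb _ (hprod k₁)
    rw [eval_prod, Finset.prod_eq_zero_iff] at this
    obtain ⟨i, hi, h⟩ := this
    exact ⟨i, Finset.mem_range.mp hi, by simpa [sub_eq_add_neg] using h⟩
  rcases le_or_gt i r with hir | hir
  · refine ⟨b, 1, k₁, Or.inl rfl, by omega, fun k hk => ?_⟩
    rw [one_mul]
    induction k, hk using Nat.le_induction with
    | base => exact hb
    | succ k hk ih =>
      rw [Nat.cast_succ, hsucc]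
      refine mem_supp_add ih (hkill k) fun h => ?_
      have := hr _ _ hbi (by simpa using h) (k - i) (by push_cast; ring)
      omega
  · refine ⟨b - k₁, -1, k₁, Or.inr rfl, by omega, fun k hk => ?_⟩
    rw [neg_one_mul]
    induction k, hk using Nat.le_induction with
    | base =>
      intro p hp
      have h := hb (tau (-(k₁ : ℤ)) p) fun h => by
        have e := hD (-(k₁ : ℤ)) k₁ (tau k₁ (tau (-(k₁ : ℤ)) p * h))
        have e' := hp (tau k₁ h)
        simp only [map_mul, tau_tau, neg_add_cancel, add_neg_cancel, hD0, tau_zero] at e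
        simpa [e'] using e.symm
      simpa [sub_eq_add_neg] using h
    | succ k hk ih =>
      have e : D (-((k + 1 : ℕ) : ℤ)) =
          D (-(k : ℤ)) + -(D 1).comp (tau (-((k + 1 : ℕ) : ℤ))).toLinearMap := by
        have := hsucc (-((k + 1 : ℕ) : ℤ))
        rw [show -((k + 1 : ℕ) : ℤ) + 1 = -(k : ℤ) by push_cast; ring] at this
        rw [this]; abel
      rw [e]
      refine mem_supp_add (q := tau (k + 1 : ℕ) q) ih (fun h => ?_) fun h => ?_
      · have := hkill (-((k + 1 : ℕ) : ℤ)) h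
        rw [neg_neg] at this
        rw [LinearMap.neg_apply, this, neg_zero]
      · have := hr _ _ (by simpa using h) hbi (k + 1 - k₁ + i) (by push_cast; ring)
        omega

section Scalar

/-! ### Scalar differential operators acting on a graded space -/

/-- The functional `h ↦ ∑_{s ≤ m < s + k} h(m)` (with a sign if `k < 0`). -/
def intervalSum (s k : ℤ) : ℂ[X] →ₗ[ℂ] ℂ where
  toFun h := DiffOp.signedSum (fun m => h.eval (m : ℂ)) s (s + k)
  map_add' f g := by simp [DiffOp.signedSum, Finset.sum_add_distrib]; ring
  map_smul' c f := by simp [DiffOp.signedSum, ← Finset.mul_sum]; ring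

lemma intervalSum_apply (s k : ℤ) (h : ℂ[X]) :
    intervalSum s k h = DiffOp.signedSum (fun m => h.eval (m : ℂ)) s (s + k) := rfl

lemma intervalSum_add (s k l : ℤ) (h : ℂ[X]) :
    intervalSum s (k + l) h = intervalSum s k h + intervalSum s l (tau k h) := by
  have := DiffOp.signedSum_shift (fun m => h.eval (m : ℂ)) s (s + l) k
  simp only [intervalSum_apply, eval_tau]
  push_cast at this
  rw [this, show s + l + k = s + (k + l) by ring, DiffOp.signedSum_add]

lemma intervalSum_one (s k : ℤ) : intervalSum s k 1 = k := by
  have h : ((k.toNat : ℤ) - ((-k).toNat : ℤ) : ℤ) = k := by omega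
  rw [intervalSum_apply, DiffOp.signedSum]
  simp only [eval_one, Finset.sum_const, Int.card_Ico, nsmul_eq_mul, mul_one,
    add_sub_cancel_left, sub_add_cancel_left]
  exact_mod_cast congrArg (Int.cast : ℤ → ℂ) h

variable {V : Type*} [AddCommGroup V] [Module ℂ V]

variable (V) in
/-- A representation on `V` of a central extension of the Lie algebra `ℂ[t, t⁻¹] ⊗ ℂ[D]` of
scalar differential operators on the circle: `act k f` is the action of `tᵏ f(D)` and `cen` is
the action of the central element. The integer `s` selects one of the cohomologous cocycles
`∑_{s - k ≤ m < s} f(m) g(m + k)`; `DiffOp.cocycle` has `s = 0`, and the twist by the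
anti-automorphism `tᵏ f(D) ↦ tᵏ f(-D - k)` turns `s` into `1 - s`. -/
structure ScalarAction where
  /-- The action of `tᵏ f(D)`. -/
  act : ℤ → ℂ[X] →ₗ[ℂ] Module.End ℂ V
  /-- The action of the central element. -/
  cen : Module.End ℂ V
  /-- The parameter of the cocycle. -/
  s : ℤ
  cen_act : ∀ k f v, cen (act k f v) = act k f (cen v)
  lie_act : ∀ k l f g v, k + l ≠ 0 →
    act k f (act l g v) - act l g (act k f v) = act (k + l) (tau l f * g - tau k g * f) v
  lie_act_neg : ∀ k f g v,
    act k f (act (-k) g v) - act (-k) g (act k f v) =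
      act 0 (tau (-k) f * g - tau k g * f) v + intervalSum s k (tau (-k) f * g) • cen v

namespace ScalarAction

variable (A : ScalarAction V)

lemma act_zero_act (l : ℤ) (h g : ℂ[X]) (v : V) :
    A.act 0 h (A.act l g v) = A.act l g (A.act 0 h v) + A.act l ((tau l h - h) * g) v := by
  rcases eq_or_ne l 0 with rfl | hl
  · have := A.lie_act_neg 0 h g v
    simp only [neg_zero, tau_zero, mul_comm g h, sub_self, map_zero, LinearMap.zero_apply,
      intervalSum_apply, add_zero, DiffOp.signedSum, Finset.Ico_self, Finset.sum_empty,
      zero_smul] at this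
    simp [sub_eq_zero.mp this]
  · have := A.lie_act 0 l h g v (by simpa using hl)
    simp only [zero_add, tau_zero] at this
    rw [sub_mul, mul_comm h g, ← this, add_sub_cancel]

lemma act_zero_comm (h g : ℂ[X]) (v : V) :
    A.act 0 h (A.act 0 g v) = A.act 0 g (A.act 0 h v) := by
  simpa using A.act_zero_act 0 h g v

lemma act_zero_one_act (l : ℤ) (g : ℂ[X]) (v : V) :
    A.act 0 1 (A.act l g v) = A.act l g (A.act 0 1 v) := by
  simpa using A.act_zero_act l 1 g v

/-- A grading of (part of) `V` by finite-dimensional subspaces of dimension at most `K`. -/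
structure IsBoundedGrading (𝒲 : ℤ → Submodule ℂ V) (K : ℕ) : Prop where
  act_mem : ∀ k j f, ∀ v ∈ 𝒲 j, A.act k f v ∈ 𝒲 (k + j)
  cen_mem : ∀ j, ∀ v ∈ 𝒲 j, A.cen v ∈ 𝒲 j
  finite : ∀ j, FiniteDimensional ℂ (𝒲 j)
  finrank_le : ∀ j, Module.finrank ℂ (𝒲 j) ≤ K

/-- Common eigenvectors of the operators of degree zero, of weight `wt` and central charge `c`. -/
structure IsWeightVector (W : Submodule ℂ V) (wt : ℂ[X] →ₗ[ℂ] ℂ) (c : ℂ) (v : V) : Prop where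
  mem : v ∈ W
  ne_zero : v ≠ 0
  act_zero : ∀ h, A.act 0 h v = wt h • v
  cen : A.cen v = c • v

/-- The functional `h ↦ wt (h - τₖ h) + c ∑_{s ≤ m < s + k} h(m)` by which the brackets of
`tᵏ f(D)` with `t⁻ᵏ g(D)`, where `h = f(D - k) g(D)`, act on a vector of weight `wt` and central
charge `c`. -/
def bracketFun (s : ℤ) (wt : ℂ[X] →ₗ[ℂ] ℂ) (c : ℂ) (k : ℤ) : ℂ[X] →ₗ[ℂ] ℂ :=
  wt - wt.comp (tau k).toLinearMap + c • intervalSum s k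

lemma bracketFun_apply (s : ℤ) (wt : ℂ[X] →ₗ[ℂ] ℂ) (c : ℂ) (k : ℤ) (h : ℂ[X]) :
    bracketFun s wt c k h = wt (h - tau k h) + c * intervalSum s k h := by
  simp [bracketFun]

lemma bracketFun_add (s : ℤ) (wt : ℂ[X] →ₗ[ℂ] ℂ) (c : ℂ) (k l : ℤ) (h : ℂ[X]) :
    bracketFun s wt c (k + l) h = bracketFun s wt c k h + bracketFun s wt c l (tau k h) := by
  simp only [bracketFun_apply, intervalSum_add, tau_tau, map_sub, add_comm l k]
  ring

lemma bracketFun_ne_zero (s : ℤ) {wt : ℂ[X] →ₗ[ℂ] ℂ} {c : ℂ} (h : ¬(wt = 0 ∧ c = 0)) (k : ℤ)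
    (hk : k ≠ 0) : bracketFun s wt c k ≠ 0 := by
  intro h0
  have hc : c = 0 := by
    have := bracketFun_apply s wt c k 1
    rw [h0, intervalSum_one] at this
    simpa [hk] using this
  refine h ⟨LinearMap.ext fun p => ?_, hc⟩
  obtain ⟨g, rfl⟩ := exists_sub_tau_eq hk p
  have := bracketFun_apply s wt c k g
  rw [h0, hc] at this
  simpa using this.symm

lemma bracketFun_add_leval (s : ℤ) (wt : ℂ[X] →ₗ[ℂ] ℂ) (c : ℂ) (k : ℤ) (ε a : ℂ) :
    bracketFun s (wt + ε • leval a) c k =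
      bracketFun s wt c k + ε • (leval a - leval (a + k)) := by
  refine LinearMap.ext fun h => ?_
  simp [bracketFun]
  ring

lemma kills_leval_sub (ε a a' : ℂ) :
    Kills ((X - C a) * (X - C a')) (ε • (leval a - leval a')) := fun h => by simp

variable {A} {𝒲 : ℤ → Submodule ℂ V} {K : ℕ}

/-- For a weight vector `v`, the polynomials `g` such that `tˡ g(D)` kills `v` form an ideal of
finite codimension; every zero of it yields a weight vector of degree shifted by `l`. -/
lemma exists_annihilator (hW : A.IsBoundedGrading 𝒲 K) {j : ℤ} {wt : ℂ[X] →ₗ[ℂ] ℂ} {c : ℂ} {v : V}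
    (hv : A.IsWeightVector (𝒲 j) wt c v) {l : ℤ} (hl : l ≠ 0) :
    ∃ q : ℂ[X], q ≠ 0 ∧ (∀ h, A.act l (q * h) v = 0) ∧ ∀ a, q.eval a = 0 →
      ∃ v', A.IsWeightVector (𝒲 (j + l)) (wt - leval a + leval (a + l)) c v' := by
  have hact : ∀ h g, A.act 0 h (A.act l g v) = wt h • A.act l g v + A.act l ((tau l h - h) * g) v :=
    fun h g => by rw [act_zero_act, hv.act_zero, map_smul]
  let I : Ideal ℂ[X] :=
    { carrier := {g | A.act l g v = 0}
      zero_mem' := by simp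
      add_mem' := fun {f g} hf hg => by
        simp only [Set.mem_ofPred_eq] at hf hg ⊢
        rw [map_add, LinearMap.add_apply, hf, hg, add_zero]
      smul_mem' := fun f g hg => by
        simp only [Set.mem_ofPred_eq, smul_eq_mul] at hg ⊢
        obtain ⟨h, hh⟩ := exists_sub_tau_eq hl (-f)
        have := hact h g
        rw [hg, map_zero, smul_zero, zero_add,
          show tau l h - h = f by linear_combination -hh] at this
        exact this.symm }
  have hI : ∀ g, g ∈ I ↔ A.act l g v = 0 := fun g => Iff.rfl
  obtain ⟨g₀, hg₀, hg₀'⟩ : ∃ g₀ ∈ I, g₀ ≠ 0 := by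
    by_contra! h
    let φ : ℂ[X] →ₗ[ℂ] 𝒲 (l + j) :=
      LinearMap.codRestrict _ ((LinearMap.applyₗ v).comp (A.act l))
        fun g => hW.act_mem l j g v hv.mem
    have hinj : Function.Injective φ := by
      rw [← LinearMap.ker_eq_bot, LinearMap.ker_eq_bot']
      exact fun g hg => h g (congrArg Subtype.val hg)
    have := hW.finite (l + j)
    have h1 := FiniteDimensional.of_injective φ hinj
    exact Polynomial.not_finite (R := ℂ) h1
  set q := Submodule.IsPrincipal.generator I with hq
  have hqI : q ∈ I := Submodule.IsPrincipal.generator_mem I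
  have hdvd : ∀ r ∈ I, q ∣ r := fun r hr =>
    (Submodule.IsPrincipal.mem_iff_generator_dvd I).mp hr
  have hq0 : q ≠ 0 := fun h => hg₀' (zero_dvd_iff.mp (h ▸ hdvd g₀ hg₀))
  have hqh : ∀ h, A.act l (q * h) v = 0 := fun h => (hI _).mp (I.mul_mem_right h hqI)
  refine ⟨q, hq0, hqh, fun a ha => ?_⟩
  obtain ⟨g, hg⟩ := dvd_iff_isRoot.mpr ha
  refine ⟨A.act l g v, ?_, fun h => ?_, fun h => ?_, ?_⟩
  · rw [add_comm]; exact hW.act_mem l j g v hv.mem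
  · have hg0 : g ≠ 0 := by rintro rfl; exact hq0 (by rw [hg, mul_zero])
    have h1 := degree_le_of_dvd (hdvd g h) hg0
    rw [hg, degree_mul, degree_X_sub_C, degree_eq_natDegree hg0] at h1
    norm_cast at h1
    omega
  · obtain ⟨u, hu⟩ := dvd_iff_isRoot.mpr
      (show (tau l h - h - C (h.eval (a + l) - h.eval a)).IsRoot a by simp)
    have e : (tau l h - h) * g = (h.eval (a + l) - h.eval a) • g + q * u := by
      rw [smul_eq_C_mul, hg]; linear_combination g * hu
    rw [hact, e, map_add, LinearMap.add_apply, hqh, add_zero, map_smul, LinearMap.smul_apply,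
      ← add_smul]
    congr 1
    simp
    ring
  · rw [A.cen_act, hv.cen, map_smul]

/-- Every point `b` of the support of the `k`-th bracket functional of a weight vector allows one of
two moves, which carry a unit of weight from `b` to `b - k` or from `b - k` to `b`. -/
lemma exists_move (hW : A.IsBoundedGrading 𝒲 K) {j : ℤ} {wt : ℂ[X] →ₗ[ℂ] ℂ} {c : ℂ} {v : V}
    (hv : A.IsWeightVector (𝒲 j) wt c v) {k : ℤ} (hk : k ≠ 0) :
    IsTorsionFunctional (bracketFun A.s wt c k) ∧ ∀ b ∈ supp (bracketFun A.s wt c k),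
    ∃ ε : ℤ, (ε = 1 ∨ ε = -1) ∧ ∃ v', A.IsWeightVector (𝒲 (j - ε * k))
      (wt + (ε : ℂ) • (leval (b - k) - leval b)) c v' := by
  obtain ⟨q, hq0, hq, hqv⟩ := exists_annihilator hW hv hk
  obtain ⟨r, hr0, hr, hrv⟩ := exists_annihilator hW hv (neg_ne_zero.mpr hk)
  have hkill : Kills (tau (-k) q * r) (bracketFun A.s wt c k) := by
    intro h
    have e := A.lie_act_neg k q (r * h) v
    rw [hr, ← mul_one q, hq, map_zero, map_zero, sub_zero, mul_one, hv.act_zero, hv.cen, smul_smul,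
      ← add_smul] at e
    have := (smul_eq_zero.mp e.symm).resolve_right hv.ne_zero
    have e2 : tau k (tau (-k) q * (r * h)) = tau k (r * h) * q := by simp [mul_comm]
    rw [mul_assoc, bracketFun_apply, e2, mul_comm c]
    exact this
  refine ⟨⟨_, mul_ne_zero (tau_ne_zero hq0) hr0, hkill⟩, fun b hb => ?_⟩
  have h := hb _ hkill
  rw [eval_mul, eval_tau, mul_eq_zero] at h
  rcases h with h | h
  · obtain ⟨v', hv'⟩ := hqv _ h
    refine ⟨-1, Or.inr rfl, v', ?_⟩
    have e : wt + ((-1 : ℤ) : ℂ) • (leval (b - k) - leval b) =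
        wt - leval (b + (-k : ℤ)) + leval (b + (-k : ℤ) + k) := by
      push_cast
      rw [neg_add_cancel_right, neg_one_smul, ← sub_eq_add_neg]; module
    rw [e, show j - -1 * k = j + k by ring]
    exact hv'
  · obtain ⟨v', hv'⟩ := hrv _ h
    refine ⟨1, Or.inl rfl, v', ?_⟩
    have e : wt + ((1 : ℤ) : ℂ) • (leval (b - k) - leval b) =
        wt - leval b + leval (b + (-k : ℤ)) := by
      push_cast
      rw [one_smul, ← sub_eq_add_neg]; module
    rw [e, show j - 1 * k = j + -k by ring]
    exact hv'

/-- Weight vectors of pairwise distinct weights in one degree are linearly independent. -/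
lemma card_weights_le (hW : A.IsBoundedGrading 𝒲 K) {ι : Type*} [Fintype ι] {j : ℤ}
    (wt : ι → ℂ[X] →ₗ[ℂ] ℂ) (c : ι → ℂ) (v : ι → V)
    (hv : ∀ i, A.IsWeightVector (𝒲 j) (wt i) (c i) (v i)) (hinj : Function.Injective wt) :
    Fintype.card ι ≤ K := by
  have h1 := Module.End.independent_iInf_maxGenEigenspace_of_forall_mapsTo
    (fun h : ℂ[X] => A.act 0 h) (fun h g μ => Module.End.mapsTo_maxGenEigenspace_of_comm
      (LinearMap.ext fun v => A.act_zero_comm _ _ v) μ)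
  have h2 := h1.comp (f := fun i : ι => fun h => wt i h) (fun i i' h =>
    hinj (LinearMap.ext fun p => congrFun h p))
  have h3 : LinearIndependent ℂ v := h2.linearIndependent _ (fun i => by
    simp only [Function.comp, Submodule.mem_iInf]
    intro h
    rw [Module.End.mem_maxGenEigenspace]
    exact ⟨1, by simp [(hv i).act_zero h]⟩) (fun i => (hv i).ne_zero)
  have := hW.finite j
  have h4 : LinearIndependent ℂ (fun i => (⟨v i, (hv i).mem⟩ : 𝒲 j)) :=
    LinearIndependent.of_comp (𝒲 j).subtype h3
  exact h4.fintype_card_le_finrank.trans (hW.finrank_le j)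

end ScalarAction

end Scalar

namespace ScalarAction

variable {V : Type*} [AddCommGroup V] [Module ℂ V] {A : ScalarAction V} {𝒲 : ℤ → Submodule ℂ V}
  {K : ℕ}

/-- If `(wt, c) ≠ (0, 0)`, then there are a sign `ε` and a point `b` such that a unit of weight can
be moved from `b` to `b + l` (for `ε = 1`) or from `b + l` to `b` (for `ε = -1`), for infinitely
many `l`. -/
lemma exists_infinite_moves (hW : A.IsBoundedGrading 𝒲 K) {j : ℤ} {wt : ℂ[X] →ₗ[ℂ] ℂ} {c : ℂ}
    {v : V} (hv : A.IsWeightVector (𝒲 j) wt c v) (h0 : ¬(wt = 0 ∧ c = 0)) :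
    ∃ (b : ℂ) (ε : ℤ), (ε = 1 ∨ ε = -1) ∧
      {l : ℤ | ∃ v', A.IsWeightVector (𝒲 (j + ε * l))
        (wt - (ε : ℂ) • leval b + (ε : ℂ) • leval (b + l)) c v'}.Infinite := by
  obtain ⟨b, σ, k₀, hσ, hk₀, hb⟩ := exists_forall_mem_supp (bracketFun A.s wt c)
    (bracketFun_add A.s wt c) (exists_move hW hv one_ne_zero).1 (bracketFun_ne_zero A.s h0)
  have hσ0 : σ ≠ 0 := by rcases hσ with rfl | rfl <;> decide
  set S : ℤ → Set ℤ := fun ε => {l : ℤ | ∃ v', A.IsWeightVector (𝒲 (j + ε * l))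
        (wt - (ε : ℂ) • leval b + (ε : ℂ) • leval (b + l)) c v'} with hS
  have hinf : (S 1 ∪ S (-1)).Infinite := by
    refine Set.infinite_of_injective_forall_mem (f := fun n : ℕ => -(σ * (k₀ + n : ℕ)))
      (fun m n h => ?_) fun n => ?_
    · have := mul_left_cancel₀ hσ0 (neg_injective h)
      omega
    · have hne : σ * (k₀ + n : ℕ) ≠ 0 := mul_ne_zero hσ0 (by omega)
      obtain ⟨ε, hε, v', hv'⟩ := (exists_move hW hv hne).2 b (hb (k₀ + n) (by omega))
      have : -(σ * ((k₀ + n : ℕ) : ℤ)) ∈ S ε := by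
        refine ⟨v', ?_⟩
        have e : wt - (ε : ℂ) • leval b + (ε : ℂ) • leval (b + (-(σ * ((k₀ + n : ℕ) : ℤ)) : ℤ)) =
            wt + (ε : ℂ) • (leval (b - (σ * ((k₀ + n : ℕ) : ℤ) : ℤ)) - leval b) := by
          rw [smul_sub, Int.cast_neg, ← sub_eq_add_neg]
          abel
        rw [e, mul_neg, ← sub_eq_add_neg]
        exact hv'
      rcases hε with rfl | rfl
      · exact Or.inl this
      · exact Or.inr this
  rcases Set.infinite_union.mp hinf with h | h
  · exact ⟨b, 1, Or.inl rfl, h⟩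
  · exact ⟨b, -1, Or.inr rfl, h⟩

/-- In a module with components of bounded dimension the weights are `0` and `± (h ↦ h(b))`, and
the central charge vanishes. Otherwise there would be two independent infinite families of moves,
and since the numbers of pairs of moves in a large box grow faster than those of the degrees that
these pairs reach, there would be more than `K` weights in a single degree. -/
theorem weight_eq (hW : A.IsBoundedGrading 𝒲 K) {j : ℤ} {wt : ℂ[X] →ₗ[ℂ] ℂ} {c : ℂ}
    {v : V} (hv : A.IsWeightVector (𝒲 j) wt c v) :
    c = 0 ∧ (wt = 0 ∨ ∃ b, wt = leval b ∨ wt = -leval b) := by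
  by_cases h0 : wt = 0 ∧ c = 0
  · exact ⟨h0.2, Or.inl h0.1⟩
  obtain ⟨b, ε, hε, hinf⟩ := exists_infinite_moves hW hv h0
  set κ : ℂ[X] →ₗ[ℂ] ℂ := wt - (ε : ℂ) • leval b with hκ
  by_cases h1 : κ = 0 ∧ c = 0
  · refine ⟨h1.2, Or.inr ⟨b, ?_⟩⟩
    rw [hκ, sub_eq_zero] at h1
    rcases hε with rfl | rfl
    · left; simpa using h1.1
    · right; simpa using h1.1
  exfalso
  have htors : IsTorsionFunctional (bracketFun A.s κ c 1) := by
    obtain ⟨l, v', hv'⟩ := hinf.nonempty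
    obtain ⟨q, hq, hk⟩ := (exists_move hW hv' one_ne_zero).1
    rw [bracketFun_add_leval] at hk
    set p : ℂ[X] := (X - C (b + l)) * (X - C (b + l + (1 : ℤ))) with hp
    have hp0 : p ≠ 0 := mul_ne_zero (X_sub_C_ne_zero _) (X_sub_C_ne_zero _)
    refine ⟨q * p, mul_ne_zero hq hp0, ?_⟩
    have h2 := (hk.mul_right p).add
      ((kills_leval_sub (-(ε : ℂ)) (b + l) (b + l + (1 : ℤ))).mul_left q)
    convert h2 using 1
    rw [add_assoc, ← add_smul, add_neg_cancel, zero_smul, add_zero]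
  obtain ⟨b', σ, k₀, hσ, hk₀, hb'⟩ := exists_forall_mem_supp (bracketFun A.s κ c)
    (bracketFun_add A.s κ c) htors (bracketFun_ne_zero A.s h1)
  have hσ0 : σ ≠ 0 := by rcases hσ with rfl | rfl <;> decide
  have hε0 : (ε : ℂ) ≠ 0 := by rcases hε with rfl | rfl <;> norm_num
  have hinf' := hinf.sdiff (Set.Finite.preimage (f := fun l : ℤ => b + (l : ℂ))
    (fun x _ y _ h => by simpa using h) (Set.finite_singleton b'))
  obtain ⟨L, hL, hcard⟩ := hinf'.exists_subset_card_eq (4 * K + 1)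
  obtain ⟨R, hR⟩ : ∃ R : ℕ, ∀ l ∈ L, |l| ≤ R := by
    refine ⟨L.sup Int.natAbs, fun l hl => ?_⟩
    rw [Int.abs_eq_natAbs]
    exact_mod_cast Finset.le_sup (f := Int.natAbs) hl
  -- beyond `x`, the points `b' - σ k` are different from the points `b + l`
  obtain ⟨x, hx0, hx⟩ : ∃ x : ℕ, k₀ ≤ x ∧ ∀ k : ℕ, x ≤ k → ∀ l ∈ L, b + l ≠ b' - (σ * k : ℤ) := by
    obtain ⟨y, hy⟩ := exists_nat_gt (‖b' - b‖ + R)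
    refine ⟨max k₀ y, le_max_left _ _, fun k hk l hl h => ?_⟩
    have h2 : ((σ * k : ℤ) : ℂ) = (b' - b) - (l : ℤ) := by linear_combination h
    have h3 : ‖((σ * k : ℤ) : ℂ)‖ = k := by
      rw [Complex.norm_intCast]
      rcases hσ with rfl | rfl <;> simp
    have h4 : ‖((l : ℤ) : ℂ)‖ ≤ R := by
      rw [Complex.norm_intCast]
      exact_mod_cast hR l hl
    have h5 := norm_sub_le (b' - b) (l : ℂ)
    rw [← h2, h3] at h5
    have h6 : (y : ℝ) ≤ k := by exact_mod_cast (le_max_right _ _).trans hk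
    linarith
  have hmove : ∀ l ∈ L, ∀ t : ℕ, ∃ ε' : ℤ, (ε' = 1 ∨ ε' = -1) ∧ ∃ v',
      A.IsWeightVector (𝒲 (j + ε * l - ε' * (σ * (x + t : ℕ))))
        (κ + (ε : ℂ) • leval (b + l) +
          (ε' : ℂ) • (leval (b' - (σ * (x + t : ℕ) : ℤ)) - leval b')) c v' := by
    intro l hl t
    obtain ⟨⟨w, hw⟩, hlb⟩ := hL hl
    have hne : σ * ((x + t : ℕ) : ℤ) ≠ 0 := mul_ne_zero hσ0 (by omega)
    refine (exists_move hW hw hne).2 b' ?_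
    rw [bracketFun_add_leval]
    refine mem_supp_add (hb' (x + t) (by omega)) (kills_leval_sub _ _ _) ?_
    have h2 := hx (x + t) (by omega) l hl
    simp only [eval_mul, eval_sub, eval_X, eval_C, ne_eq, mul_eq_zero, sub_eq_zero, not_or]
    refine ⟨fun h => hlb (by simpa using h.symm), fun h => h2 ?_⟩
    rw [h]; ring
  choose! ε' hε' w hw using hmove
  -- a box of pairs of moves, in which the pairs outnumber the degrees
  set m : ℕ := 4 * K * R + 2 * K + 1 with hm
  set T : Finset (ℤ × ℤ) := ({1, -1} : Finset ℤ) ×ˢ Finset.Icc (-(R + m : ℤ)) (R + m) with hT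
  have hTcard : T.card ≤ 2 * (2 * (R + m) + 1) := by
    rw [hT, Finset.card_product, Int.card_Icc]
    refine Nat.mul_le_mul (Finset.card_le_two) (by omega)
  clear_value T
  obtain ⟨⟨e, d⟩, -, hfib⟩ := Finset.exists_lt_card_fiber_of_mul_lt_card_of_maps_to
    (s := L ×ˢ Finset.range m) (t := T) (n := K)
    (f := fun p : ℤ × ℕ => (ε' p.1 p.2, ε * p.1 - ε' p.1 p.2 * (σ * p.2))) (by
      rintro ⟨l, t⟩ hp
      obtain ⟨hl, ht⟩ := Finset.mem_product.mp hp
      have h2 := abs_le.mp (hR l hl)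
      have h3 : t < m := Finset.mem_range.mp ht
      simp only [hT, Finset.mem_product, Finset.mem_insert, Finset.mem_singleton, Finset.mem_Icc]
      refine ⟨hε' l hl t, ?_⟩
      rcases hε' l hl t with h | h <;> rw [h] <;> rcases hε with rfl | rfl <;>
        rcases hσ with rfl | rfl <;> constructor <;> linarith [h2.1, h2.2]) (by
      rw [Finset.card_product L, hcard, Finset.card_range]
      calc T.card * K ≤ 2 * (2 * (R + m) + 1) * K := Nat.mul_le_mul_right _ hTcard
        _ < (4 * K + 1) * m := by rw [hm]; ring_nf; omega)
  set F := {p ∈ L ×ˢ Finset.range m |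
    (ε' p.1 p.2, ε * p.1 - ε' p.1 p.2 * (σ * (p.2 : ℤ))) = (e, d)} with hF
  have hFmem : ∀ p : F, p.1.1 ∈ L ∧ ε' p.1.1 p.1.2 = e ∧
      ε * p.1.1 - e * (σ * (p.1.2 : ℤ)) = d := by
    rintro ⟨⟨l, t⟩, hp⟩
    rw [hF, Finset.mem_filter, Finset.mem_product, Prod.mk.injEq] at hp
    exact ⟨hp.1.1, hp.2.1, by rw [← hp.2.1]; exact hp.2.2⟩
  have he0 : ∀ p : F, e ≠ 0 := fun p => by
    have := hε' p.1.1 (hFmem p).1 p.1.2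
    rw [(hFmem p).2.1] at this
    rcases this with rfl | rfl <;> decide
  have := card_weights_le hW (ι := F) (j := j + d - e * (σ * x)) (fun p => κ +
    (ε : ℂ) • leval (b + p.1.1) +
      (e : ℂ) • (leval (b' - (σ * (x + p.1.2 : ℕ) : ℤ)) - leval b')) (fun _ => c)
    (fun p => w p.1.1 p.1.2) (fun p => by
      have h2 := hw p.1.1 (hFmem p).1 p.1.2
      rw [(hFmem p).2.1] at h2
      convert h2 using 2
      rw [← (hFmem p).2.2]
      push_cast
      ring) (fun p p' h => by
      have hl : p.1.1 = p'.1.1 := by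
        by_contra hne
        set u : ℂ := b' - (σ * (x + p.1.2 : ℕ) : ℤ) with hu
        set u' : ℂ := b' - (σ * (x + p'.1.2 : ℕ) : ℤ) with hu'
        have h2 := LinearMap.congr_fun h ((X - C (b + p'.1.1)) * (X - C u) * (X - C u'))
        simp only [LinearMap.add_apply, LinearMap.smul_apply, LinearMap.sub_apply, leval_apply,
          eval_mul, eval_sub, eval_X, eval_C, sub_self, mul_zero, zero_mul, smul_eq_mul,
          add_zero] at h2
        have h3 : (ε : ℂ) *
            ((b + p.1.1 - (b + p'.1.1)) * (b + p.1.1 - u) * (b + p.1.1 - u')) = 0 := by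
          linear_combination h2
        simp only [mul_eq_zero, hε0, false_or, sub_eq_zero, add_right_inj, Int.cast_inj, hne] at h3
        rcases h3 with h3 | h3
        · exact hx _ (by omega) _ (hFmem p).1 h3
        · exact hx _ (by omega) _ (hFmem p).1 h3
      have ht : p.1.2 = p'.1.2 := by
        have h2 := (hFmem p).2.2
        rw [hl, ← (hFmem p').2.2] at h2
        have h3 := mul_left_cancel₀ hσ0 (mul_left_cancel₀ (he0 p) (sub_right_injective h2))
        exact_mod_cast h3
      exact Subtype.ext (Prod.ext hl ht))
  rw [Fintype.card_coe] at this
  omega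

end ScalarAction

/-! ### The structure of bounded modules over scalar differential operators -/

namespace ScalarAction

variable {V : Type*} [AddCommGroup V] [Module ℂ V] {A : ScalarAction V} {𝒲 : ℤ → Submodule ℂ V}
  {K : ℕ}

variable (A) in
/-- Subspaces invariant under the operators of degree zero. -/
def ZeroInvariant (U : Submodule ℂ V) : Prop :=
  (∀ h, ∀ u ∈ U, A.act 0 h u ∈ U) ∧ ∀ u ∈ U, A.cen u ∈ U

lemma IsBoundedGrading.zeroInvariant (hW : A.IsBoundedGrading 𝒲 K) (j : ℤ) :
    A.ZeroInvariant (𝒲 j) :=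
  ⟨fun h u hu => by simpa using hW.act_mem 0 j h u hu, fun u hu => hW.cen_mem j u hu⟩

lemma ZeroInvariant.inf_maxGenEigenspace {U : Submodule ℂ V} (hU : A.ZeroInvariant U) (h : ℂ[X])
    (μ : ℂ) : A.ZeroInvariant (U ⊓ (A.act 0 h).maxGenEigenspace μ) :=
  ⟨fun g u hu => ⟨hU.1 g u hu.1, Module.End.mapsTo_maxGenEigenspace_of_comm
    (LinearMap.ext fun v => A.act_zero_comm h g v) μ hu.2⟩,
  fun u hu => ⟨hU.2 u hu.1, Module.End.mapsTo_maxGenEigenspace_of_comm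
    (LinearMap.ext fun v => (A.cen_act 0 h v).symm) μ hu.2⟩⟩

lemma exists_weightVector (hW : A.IsBoundedGrading 𝒲 K) {j : ℤ} {U : Submodule ℂ V}
    (hUW : U ≤ 𝒲 j) (hU : A.ZeroInvariant U) (hb : U ≠ ⊥) :
    ∃ v ∈ U, ∃ wt c, A.IsWeightVector (𝒲 j) wt c v := by
  have := hW.finite j
  have : FiniteDimensional ℂ U := Submodule.finiteDimensional_of_le hUW
  obtain ⟨v, hv, h0, h⟩ := exists_common_eigenvector
    (fun i : Option ℂ[X] => i.elim A.cen (A.act 0)) (by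
      rintro (_ | g) (_ | h) v
      · rfl
      · exact A.cen_act 0 h v
      · exact (A.cen_act 0 g v).symm
      · exact A.act_zero_comm g h v) U hb (by
      rintro (_ | g) u hu
      · exact hU.2 u hu
      · exact hU.1 g u hu)
  choose f hf using fun g : ℂ[X] => h (some g)
  obtain ⟨c, hc⟩ := h none
  have hf' : ∀ g, A.act 0 g v = f g • v := hf
  refine ⟨v, hv, ⟨⟨f, fun g h => ?_⟩, fun a g => ?_⟩, c, hUW hv, h0, hf, hc⟩
  · refine smul_left_injective ℂ h0 ?_
    simp only [← hf', add_smul, map_add, LinearMap.add_apply]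
  · refine smul_left_injective ℂ h0 ?_
    simp only [← hf', smul_eq_mul, mul_smul, map_smul, LinearMap.smul_apply, RingHom.id_apply]

/-- Generalized eigenvalues of the central operator `1` and of the operators `D` and `D²` that
occur together. -/
lemma eigenvalues_eq (hW : A.IsBoundedGrading 𝒲 K) {j : ℤ} {χ β γ : ℂ}
    (hb : 𝒲 j ⊓ (A.act 0 1).maxGenEigenspace χ ⊓ (A.act 0 X).maxGenEigenspace β ⊓
      (A.act 0 (X ^ 2)).maxGenEigenspace γ ≠ ⊥) :
    χ = 0 ∧ β = 0 ∨ χ = 1 ∧ γ = β ^ 2 ∨ χ = -1 := by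
  obtain ⟨v, hv, wt, c, h⟩ := exists_weightVector hW
    (inf_le_left.trans (inf_le_left.trans inf_le_left))
    ((((hW.zeroInvariant j).inf_maxGenEigenspace 1 χ).inf_maxGenEigenspace X β).inf_maxGenEigenspace
      (X ^ 2) γ) hb
  have h1 := eigenvalue_eq_of_mem_maxGenEigenspace hv.1.1.2 h.ne_zero (h.act_zero 1)
  have h2 := eigenvalue_eq_of_mem_maxGenEigenspace hv.1.2 h.ne_zero (h.act_zero X)
  have h3 := eigenvalue_eq_of_mem_maxGenEigenspace hv.2 h.ne_zero (h.act_zero (X ^ 2))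
  rw [← h1, ← h2, ← h3]
  obtain ⟨-, rfl | ⟨b, rfl | rfl⟩⟩ := weight_eq hW h
  · left; simp
  · right; left; simp
  · right; right; simp

lemma mem_inf_of_act (hW : A.IsBoundedGrading 𝒲 K) {j : ℤ} {χ : ℂ} {v : V}
    (hv : v ∈ 𝒲 j ⊓ (A.act 0 1).maxGenEigenspace χ) (l : ℤ) (g : ℂ[X]) :
    A.act l g v ∈ 𝒲 (l + j) ⊓ (A.act 0 1).maxGenEigenspace χ :=
  ⟨hW.act_mem l j g v hv.1, Module.End.mapsTo_maxGenEigenspace_of_comm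
    (LinearMap.ext fun v => A.act_zero_one_act l g v) χ hv.2⟩

lemma act_mem_maxGenEigenspace_X {β : ℂ} {v : V} (hv : v ∈ (A.act 0 X).maxGenEigenspace β)
    (l : ℤ) (g : ℂ[X]) : A.act l g v ∈ (A.act 0 X).maxGenEigenspace (β + l) :=
  apply_mem_maxGenEigenspace_add (fun v => by
    rw [act_zero_act, tau_X, add_sub_cancel_left, ← smul_eq_C_mul, map_smul,
      LinearMap.smul_apply]) hv

lemma inf_le_maxGenEigenspace_X_sq (hW : A.IsBoundedGrading 𝒲 K) (j : ℤ) (b : ℂ) :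
    𝒲 j ⊓ (A.act 0 1).maxGenEigenspace 1 ⊓ (A.act 0 X).maxGenEigenspace b ≤
      (A.act 0 (X ^ 2)).maxGenEigenspace (b ^ 2) := by
  have := hW.finite j
  have : FiniteDimensional ℂ ↥(𝒲 j ⊓ (A.act 0 1).maxGenEigenspace 1 ⊓
    (A.act 0 X).maxGenEigenspace b) :=
    Submodule.finiteDimensional_of_le (inf_le_left.trans inf_le_left : _ ≤ 𝒲 j)
  refine le_maxGenEigenspace_of_forall _ _
    ((((hW.zeroInvariant j).inf_maxGenEigenspace 1 1).inf_maxGenEigenspace X b).1 _) _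
    fun μ hμ => ?_
  rcases eigenvalues_eq hW hμ with h | h | h
  · exact absurd h.1 one_ne_zero
  · exact h.2
  · norm_num at h

/-- On the generalized weight space of the weight `h ↦ h(b)`, the functions `g ↦ tˡ g(D)` factor
through the quotients by powers of the ideal of `b`. The reason is that `D²` acts by `b²` plus a
nilpotent operator there, and by `(b + l)²` plus a nilpotent operator on the target, and the
commutator of `D²` with `tˡ g(D)` is `2 l tˡ (D + l / 2) g(D)`. -/
lemma exists_act_sub_pow_eq_zero (hW : A.IsBoundedGrading 𝒲 K) {j : ℤ} {b : ℂ} {v : V}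
    (hv : v ∈ 𝒲 j ⊓ (A.act 0 1).maxGenEigenspace 1 ⊓ (A.act 0 X).maxGenEigenspace b)
    {l : ℤ} (hl : l ≠ 0) :
    ∃ n : ℕ, ∀ m ≥ n, ∀ g, A.act l ((X - C b) ^ m * g) v = 0 := by
  set U := 𝒲 j ⊓ (A.act 0 1).maxGenEigenspace 1 ⊓ (A.act 0 X).maxGenEigenspace b with hU
  set U' := 𝒲 (l + j) ⊓ (A.act 0 1).maxGenEigenspace 1 ⊓
    (A.act 0 X).maxGenEigenspace (b + l) with hU'
  have := hW.finite (l + j)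
  have : FiniteDimensional ℂ U' :=
    Submodule.finiteDimensional_of_le (inf_le_left.trans inf_le_left : U' ≤ 𝒲 (l + j))
  have hUinv : A.ZeroInvariant U :=
    ((hW.zeroInvariant j).inf_maxGenEigenspace 1 1).inf_maxGenEigenspace X b
  obtain ⟨n₀, hn₀⟩ := exists_pow_eq_zero_of_le_maxGenEigenspace (A.act 0 (X ^ 2)) U' _
    (inf_le_maxGenEigenspace_X_sq hW (l + j) (b + l))
  obtain ⟨m₀, hm₀⟩ := (Module.End.mem_maxGenEigenspace _ _ _).mp
    (inf_le_maxGenEigenspace_X_sq hW j b hv)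
  set S := A.act 0 (X ^ 2) - (b ^ 2) • 1 with hS
  set S' := A.act 0 (X ^ 2) - ((b + l) ^ 2) • 1 with hS'
  have hmem : ∀ g, ∀ u ∈ U, A.act l g u ∈ U' := fun g u hu =>
    ⟨mem_inf_of_act hW hu.1 l g, act_mem_maxGenEigenspace_X hu.2 l g⟩
  have hcomm : ∀ g u, (2 * l : ℂ) • A.act l ((X - C b) * g) u =
      S' (A.act l g u) - A.act l g (S u) := by
    intro g u
    have e : (tau l (X ^ 2) - X ^ 2) * g =
        (2 * l : ℂ) • ((X - C b) * g) + ((b + l) ^ 2 - b ^ 2 : ℂ) • g := by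
      simp only [map_pow, tau_X, smul_eq_C_mul, C_mul, C_add, C_sub]
      rw [show (C (2 : ℂ)) = 2 from rfl]
      ring
    simp only [hS, hS', LinearMap.sub_apply, act_zero_act, e, map_add, map_sub, map_smul,
      LinearMap.smul_apply, LinearMap.add_apply, Module.End.one_apply]
    module
  have hl2 : (2 * l : ℂ) ≠ 0 := mul_ne_zero two_ne_zero (Int.cast_ne_zero.mpr hl)
  have key : ∀ (s m r : ℕ) (u : V) (g : ℂ[X]), u ∈ U → (S ^ m) u = 0 → n₀ + m ≤ r + s →
      (S' ^ r) (A.act l ((X - C b) ^ s * g) u) = 0 := by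
    intro s
    induction s with
    | zero =>
      intro m r u g hu _ hle
      exact hn₀ _ (hmem _ u hu) r (by omega)
    | succ s ih =>
      intro m r u g hu hm hle
      rcases m with _ | m
      · have : u = 0 := by simpa using hm
        simp [this]
      have h1 := hcomm ((X - C b) ^ s * g) u
      rw [← mul_assoc, ← pow_succ'] at h1
      refine (smul_eq_zero.mp ?_).resolve_left hl2
      rw [← map_smul, h1, map_sub, ← Module.End.mul_apply, ← pow_succ,
        ih (m + 1) (r + 1) u g hu hm (by omega), zero_sub, neg_eq_zero]
      refine ih m r (S u) g (U.sub_mem (hUinv.1 _ u hu) (U.smul_mem _ hu)) ?_ (by omega)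
      rwa [← Module.End.mul_apply, ← pow_succ]
  refine ⟨n₀ + m₀, fun m hm g => ?_⟩
  simpa using key m m₀ 0 v g hv hm₀ (by omega)

/-- Since `tᵏ f(D) · tˡ g(D)` and `tˡ g(D) · tᵏ f(D)` are supported at different values of the
argument of `f`, the commutation relation splits into two associative relations. -/
lemma act_act_of_ne_zero (hW : A.IsBoundedGrading 𝒲 K) {j : ℤ} {v : V}
    (hv : v ∈ 𝒲 j ⊓ (A.act 0 1).maxGenEigenspace 1) {k l : ℤ} (hk : k ≠ 0) (hl : l ≠ 0)
    (hkl : k + l ≠ 0) (f g : ℂ[X]) :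
    A.act k f (A.act l g v) = A.act (k + l) (tau l f * g) v := by
  have hW' := hW.finite j
  have : FiniteDimensional ℂ ↥(𝒲 j ⊓ (A.act 0 1).maxGenEigenspace 1) :=
    Submodule.finiteDimensional_of_le (inf_le_left : _ ≤ 𝒲 j)
  have hv' := le_iSup_inf_maxGenEigenspace (A.act 0 X) _
    (((hW.zeroInvariant j).inf_maxGenEigenspace 1 1).1 X) hv
  clear hv hW'
  induction hv' using Submodule.iSup_induction' with
  | zero => simp
  | add x y _ _ hx hy => simp only [map_add, hx, hy]
  | mem b v hv =>
    obtain ⟨n₁, h₁⟩ := exists_act_sub_pow_eq_zero hW (j := l + j) (b := b + l) (v := A.act l g v)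
      ⟨mem_inf_of_act hW hv.1 l g, act_mem_maxGenEigenspace_X hv.2 l g⟩ hk
    obtain ⟨n₂, h₂⟩ := exists_act_sub_pow_eq_zero hW hv hkl
    obtain ⟨n₃, h₃⟩ := exists_act_sub_pow_eq_zero hW hv hk
    set m := max n₁ (max n₂ n₃) with hm
    have hcop : IsCoprime ((X - C (b + l)) ^ m) ((X - C b) ^ m) :=
      (isCoprime_X_sub_C_of_isUnit_sub (by simpa using hl)).pow
    obtain ⟨p, q, hpq⟩ := hcop
    have ha : ∀ f, A.act k ((X - C (b + l)) ^ m * f) (A.act l g v) =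
        A.act (k + l) (tau l ((X - C (b + l)) ^ m * f) * g) v := by
      intro f
      have e : tau l ((X - C (b + l)) ^ m * f) * g = (X - C b) ^ m * (tau l f * g) := by
        simp only [map_mul, map_pow, map_sub, tau_X, tau_C]
        rw [C_add]
        ring
      rw [h₁ m (by omega), e, h₂ m (by omega)]
    have hb : ∀ f, A.act k ((X - C b) ^ m * f) (A.act l g v) =
        A.act (k + l) (tau l ((X - C b) ^ m * f) * g) v := by
      intro f
      have e := A.lie_act k l ((X - C b) ^ m * f) g v hkl
      rw [h₃ m (by omega), map_zero, sub_zero] at e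
      rw [e, map_sub, LinearMap.sub_apply,
        show tau k g * ((X - C b) ^ m * f) = (X - C b) ^ m * (tau k g * f) by ring,
        h₂ m (by omega), sub_zero]
    have e : f = (X - C (b + l)) ^ m * (p * f) + (X - C b) ^ m * (q * f) := by
      linear_combination (-f) * hpq
    rw [e, map_add (tau l), (A.act k).map_add, LinearMap.add_apply, add_mul,
      (A.act (k + l)).map_add, LinearMap.add_apply, ha, hb]

/-- On the generalized eigenspace of the central operator `1` with eigenvalue `1`, the operators
`tᵏ f(D)` act associatively, the operator `1` is the identity, and the central charge vanishes. -/
lemma act_act_of_mem_maxGenEigenspace_one (hW : A.IsBoundedGrading 𝒲 K) {j : ℤ} {v : V}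
    (hv : v ∈ 𝒲 j ⊓ (A.act 0 1).maxGenEigenspace 1) :
    (∀ k l f g, A.act k f (A.act l g v) = A.act (k + l) (tau l f * g) v) ∧
      A.cen v = 0 ∧ A.act 0 1 v = v := by
  -- the products of operators of opposite degrees only depend on the product of the symbols
  have hR : ∀ j, ∀ v ∈ 𝒲 j ⊓ (A.act 0 1).maxGenEigenspace 1, ∀ k l : ℤ, k ≠ 0 → l ≠ 0 → ∀ f g,
      A.act k f (A.act (-k) g v) = A.act l 1 (A.act (-l) (tau (-k) f * g) v) := by
    have step : ∀ j, ∀ v ∈ 𝒲 j ⊓ (A.act 0 1).maxGenEigenspace 1, ∀ k l : ℤ, k ≠ 0 → l ≠ 0 →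
        k ≠ l → ∀ f g,
        A.act k f (A.act (-k) g v) = A.act l 1 (A.act (-l) (tau (-k) f * g) v) := by
      intro j v hv k l hk hl hkl f g
      have e := act_act_of_ne_zero hW (mem_inf_of_act hW hv (-k) g) hl (sub_ne_zero.mpr hkl)
        (by simpa using hk) 1 f
      rw [add_sub_cancel, map_one (tau _), one_mul] at e
      rw [← e, act_act_of_ne_zero hW hv (sub_ne_zero.mpr hkl) (neg_ne_zero.mpr hk)
        (by omega), show k - l + -k = -l by ring]
    intro j v hv k l hk hl f g
    rcases eq_or_ne k l with rfl | hkl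
    · rw [step j v hv k (2 * k) hk (by omega) (by omega) f g,
        step j v hv (2 * k) k (by omega) hk (by omega) 1, map_one (tau _), one_mul]
    · exact step j v hv k l hk hl hkl f g
  have hC0 : ∀ j, ∀ v ∈ 𝒲 j ⊓ (A.act 0 1).maxGenEigenspace 1, A.cen v = 0 ∧
      ∀ h, ∀ l : ℤ, l ≠ 0 → A.act 0 h v = A.act l 1 (A.act (-l) h v) := by
    intro j v hv
    have key : ∀ l : ℤ, l ≠ 0 → ∀ h, A.act l 1 (A.act (-l) (h - tau l h) v) =
        A.act 0 (h - tau l h) v + intervalSum A.s l h • A.cen v := by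
      intro l hl h
      have e := A.lie_act_neg l 1 h v
      have e2 := hR j v hv (-l) l (neg_ne_zero.mpr hl) hl h 1
      rw [neg_neg, mul_one] at e2
      simp only [map_one, one_mul, mul_one] at e
      rw [e2, ← LinearMap.map_sub, ← LinearMap.sub_apply, ← map_sub] at e
      exact e
    have hc : A.cen v = 0 := by
      have := key 1 one_ne_zero 1
      simpa [intervalSum_one] using this.symm
    refine ⟨hc, fun h l hl => ?_⟩
    obtain ⟨p, rfl⟩ := exists_sub_tau_eq hl h
    rw [key l hl p, hc, smul_zero, add_zero]
  have hmem := fun {j : ℤ} {v : V} => mem_inf_of_act (χ := 1) (j := j) (v := v) hW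
  have h0l : ∀ j, ∀ v ∈ 𝒲 j ⊓ (A.act 0 1).maxGenEigenspace 1, ∀ l : ℤ, l ≠ 0 → ∀ f g,
      A.act 0 f (A.act l g v) = A.act l (tau l f * g) v := by
    intro j v hv l hl f g
    rw [(hC0 _ _ (hmem hv l g)).2 f (2 * l) (by omega),
      act_act_of_ne_zero hW hv (by omega) hl (by omega),
      act_act_of_ne_zero hW hv (by omega) (by omega) (by omega), map_one (tau _), one_mul,
      show 2 * l + (-(2 * l) + l) = l by ring]
  have hassoc : ∀ j, ∀ v ∈ 𝒲 j ⊓ (A.act 0 1).maxGenEigenspace 1, ∀ k l f g,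
      A.act k f (A.act l g v) = A.act (k + l) (tau l f * g) v := by
    intro j v hv k l f g
    rcases eq_or_ne l 0 with rfl | hl
    · rw [tau_zero, add_zero]
      rcases eq_or_ne k 0 with rfl | hk
      · rw [(hC0 j v hv).2 g 1 one_ne_zero, (hC0 j v hv).2 _ 1 one_ne_zero,
          h0l _ _ (hmem hv (-1) g) 1 one_ne_zero, mul_one,
          hR j v hv 1 1 one_ne_zero one_ne_zero, tau_tau, neg_add_cancel, tau_zero]
      · rw [(hC0 j v hv).2 g k hk, act_act_of_ne_zero hW (hmem hv (-k) g) hk hk (by omega),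
          act_act_of_ne_zero hW hv (by omega) (by omega) (by omega), mul_one, tau_tau,
          neg_add_cancel, tau_zero, add_neg_cancel_right]
    · rcases eq_or_ne k 0 with rfl | hk
      · rw [h0l j v hv l hl, zero_add]
      · by_cases hkl : k + l = 0
        · obtain rfl : l = -k := by omega
          rw [add_neg_cancel, (hC0 j v hv).2 _ k hk, hR j v hv k k hk hk]
        · exact act_act_of_ne_zero hW hv hk hl hkl f g
  refine ⟨hassoc j v hv, (hC0 j v hv).1, ?_⟩
  -- `1` acts by an idempotent whose only generalized eigenvalue is one
  obtain ⟨n, hn⟩ := (Module.End.mem_maxGenEigenspace _ _ _).mp hv.2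
  have hid : A.act 0 1 (A.act 0 1 v) = A.act 0 1 v := by
    simpa using hassoc j v hv 0 0 1 1
  have h1 : ∀ n : ℕ, ((A.act 0 1 - (1 : ℂ) • 1) ^ (n + 1)) v =
      (-1 : ℂ) ^ n • (A.act 0 1 v - v) := by
    intro n
    induction n with
    | zero => simp
    | succ n ih =>
      rw [pow_succ', Module.End.mul_apply, ih, map_smul, LinearMap.sub_apply, map_sub, hid,
        pow_succ, mul_smul]
      simp
  rcases n with _ | n
  · have : v = 0 := by simpa using hn
    simp [this]
  · rw [h1, smul_eq_zero] at hn
    exact sub_eq_zero.mp (hn.resolve_left (by simp))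

/-- The generalized eigenspace of the central operator `1` with eigenvalue `0` is a trivial
module. -/
lemma act_eq_zero_of_mem_maxGenEigenspace_zero (hW : A.IsBoundedGrading 𝒲 K) {j : ℤ} {v : V}
    (hv : v ∈ 𝒲 j ⊓ (A.act 0 1).maxGenEigenspace 0) :
    (∀ k f, A.act k f v = 0) ∧ A.cen v = 0 := by
  have hle : ∀ j, 𝒲 j ⊓ (A.act 0 1).maxGenEigenspace 0 ≤ (A.act 0 X).maxGenEigenspace 0 := by
    intro j
    have := hW.finite j
    have : FiniteDimensional ℂ ↥(𝒲 j ⊓ (A.act 0 1).maxGenEigenspace 0) :=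
      Submodule.finiteDimensional_of_le (inf_le_left : _ ≤ 𝒲 j)
    refine le_maxGenEigenspace_of_forall _ _
      (((hW.zeroInvariant j).inf_maxGenEigenspace 1 0).1 X) _ fun β hβ => ?_
    obtain ⟨v, hv, wt, c, h⟩ := exists_weightVector hW (inf_le_left.trans inf_le_left)
      (((hW.zeroInvariant j).inf_maxGenEigenspace 1 0).inf_maxGenEigenspace X β) hβ
    have h1 := eigenvalue_eq_of_mem_maxGenEigenspace hv.1.2 h.ne_zero (h.act_zero 1)
    have h2 := eigenvalue_eq_of_mem_maxGenEigenspace hv.2 h.ne_zero (h.act_zero X)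
    obtain ⟨-, rfl | ⟨b, rfl | rfl⟩⟩ := weight_eq hW h
    · simpa using h2.symm
    · simp at h1
    · simp at h1
  have hne : ∀ k, k ≠ 0 → ∀ f, A.act k f v = 0 := by
    intro k hk f
    have h1 := hle _ (mem_inf_of_act hW hv k f)
    have h2 := act_mem_maxGenEigenspace_X (hle _ hv) k f
    rw [zero_add] at h2
    exact Submodule.disjoint_def.mp (Module.End.disjoint_genEigenspace (A.act 0 X)
      (Int.cast_ne_zero.mpr hk).symm ⊤ ⊤) _ h1 h2
  have key : ∀ h, A.act 0 (h - tau 1 h) v + intervalSum A.s 1 h • A.cen v = 0 := by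
    intro h
    have e := A.lie_act_neg 1 1 h v
    rw [hne _ (by norm_num), hne _ (by norm_num), map_zero, map_zero, sub_zero] at e
    simpa using e.symm
  have hc : A.cen v = 0 := by
    have := key 1
    simpa [intervalSum_one] using this
  refine ⟨fun k f => ?_, hc⟩
  rcases eq_or_ne k 0 with rfl | hk
  · obtain ⟨h, rfl⟩ := exists_sub_tau_eq one_ne_zero f
    simpa [hc] using key h
  · exact hne k hk f

end ScalarAction

lemma signedSum_reflect (F : ℤ → ℂ) (a x y : ℤ) :
    DiffOp.signedSum (fun m => F (a - m)) x y = DiffOp.signedSum F (a + 1 - y) (a + 1 - x) := by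
  have h0 : ∀ (F : ℤ → ℂ) (x : ℤ), DiffOp.signedSum F x x = 0 := fun F x => by
    simp [DiffOp.signedSum]
  have step : ∀ y, DiffOp.signedSum F (a + 1 - (y + 1)) (a + 1 - x) =
      F (a - y) + DiffOp.signedSum F (a + 1 - y) (a + 1 - x) := by
    intro y
    rw [← DiffOp.signedSum_add F _ (a + 1 - y),
      show a + 1 - y = (a + 1 - (y + 1)) + 1 by ring, DiffOp.signedSum_succ, h0, zero_add]
    congr 2; ring
  induction y using Int.inductionOn' (b := x) with
  | zero => rw [h0, h0]
  | succ y _ ih => rw [DiffOp.signedSum_succ, ih, step]; ring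
  | pred y _ ih =>
    have h₁ := DiffOp.signedSum_succ (fun m => F (a - m)) x (y - 1)
    have h₂ := step (y - 1)
    rw [sub_add_cancel] at h₁ h₂
    linear_combination ih - h₁ + h₂

namespace ScalarAction

variable {V : Type*} [AddCommGroup V] [Module ℂ V]

/-- The substitution `f(x) ↦ f(-x - k)`. -/
def flip (k : ℤ) : ℂ[X] →ₐ[ℂ] ℂ[X] := aeval (-X - C (k : ℂ))

lemma flip_apply (k : ℤ) (f : ℂ[X]) : flip k f = f.comp (-X - C (k : ℂ)) := by
  simp [flip, aeval_def, comp]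

lemma eval_flip (k : ℤ) (f : ℂ[X]) (a : ℂ) : (flip k f).eval a = f.eval (-a - k) := by
  simp [flip_apply]

lemma flip_tau (k l : ℤ) (f : ℂ[X]) : flip k (tau l f) = flip (k - l) f := by
  simp only [flip_apply, tau_apply, comp_assoc]
  congr 1
  simp only [add_comp, X_comp, C_comp]
  push_cast
  rw [C_sub]; ring

lemma tau_flip (k l : ℤ) (f : ℂ[X]) : tau l (flip k f) = flip (k + l) f := by
  simp only [flip_apply, tau_apply, comp_assoc]
  congr 1
  simp only [sub_comp, neg_comp, X_comp, C_comp]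
  push_cast
  rw [C_add]; ring

lemma intervalSum_flip (s k : ℤ) (h : ℂ[X]) :
    intervalSum s k (flip (-k) h) = intervalSum (1 - s) k h := by
  have := signedSum_reflect (fun m => h.eval (m : ℂ)) k s (s + k)
  simp only [intervalSum_apply, eval_flip]
  convert this using 2
  · funext m
    push_cast
    congr 1
    ring
  · ring
  · ring

/-- The twist of an action by `tᵏ f(D) ↦ -tᵏ f(-D - k)`. -/
def twist (A : ScalarAction V) : ScalarAction V where
  act k := -(A.act k ∘ₗ (flip k).toLinearMap)
  cen := A.cen
  s := 1 - A.s
  cen_act k f v := by simp [A.cen_act]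
  lie_act k l f g v hkl := by
    have tw : ∀ k f v, (-(A.act k ∘ₗ (flip k).toLinearMap)) f v = -(A.act k (flip k f) v) :=
      fun _ _ _ => rfl
    have := A.lie_act k l (flip k f) (flip l g) v hkl
    simp only [tau_flip] at this
    simp only [tw, map_neg, neg_neg, this]
    rw [← LinearMap.map_neg₂]
    congr 2
    simp only [map_sub, map_mul, flip_tau, add_sub_cancel_left, add_sub_cancel_right]
    rw [add_comm l k]; ring
  lie_act_neg k f g v := by
    have tw : ∀ k f v, (-(A.act k ∘ₗ (flip k).toLinearMap)) f v = -(A.act k (flip k f) v) :=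
      fun _ _ _ => rfl
    have := A.lie_act_neg k (flip k f) (flip (-k) g) v
    simp only [tau_flip, add_neg_cancel, neg_add_cancel] at this
    have e : flip 0 f * flip (-k) g = flip (-k) (tau (-k) f * g) := by
      rw [map_mul, flip_tau]; simp
    simp only [tw, map_neg, neg_neg, this]
    rw [e, intervalSum_flip, ← e, ← LinearMap.map_neg₂]
    congr 3
    simp only [map_sub, map_mul, flip_tau, sub_neg_eq_add, zero_add, zero_sub]
    ring

lemma twist_act (A : ScalarAction V) (k : ℤ) (f : ℂ[X]) (v : V) :
    A.twist.act k f v = -A.act k (flip k f) v := rfl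

variable {A : ScalarAction V} {𝒲 : ℤ → Submodule ℂ V} {K : ℕ}

lemma IsBoundedGrading.twist (hW : A.IsBoundedGrading 𝒲 K) : A.twist.IsBoundedGrading 𝒲 K where
  act_mem k j _ v hv := (𝒲 (k + j)).neg_mem (hW.act_mem k j _ v hv)
  cen_mem := hW.cen_mem
  finite := hW.finite
  finrank_le := hW.finrank_le

lemma mem_maxGenEigenspace_twist {χ : ℂ} {v : V} (hv : v ∈ (A.act 0 1).maxGenEigenspace χ) :
    v ∈ (A.twist.act 0 1).maxGenEigenspace (-χ) := by
  rw [Module.End.mem_maxGenEigenspace] at hv ⊢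
  obtain ⟨n, hn⟩ := hv
  have e : A.twist.act 0 1 - (-χ) • 1 = -(A.act 0 1 - χ • 1) := by
    refine LinearMap.ext fun w => ?_
    simp only [LinearMap.sub_apply, twist_act, map_one, LinearMap.neg_apply, LinearMap.smul_apply,
      Module.End.one_apply]
    module
  refine ⟨n, ?_⟩
  rw [e, neg_pow]
  rcases Nat.even_or_odd n with h | h <;> simp [h.neg_one_pow, hn]

/-- In a module with components of bounded dimension the central charge vanishes, the central
operator `1` is diagonalizable with eigenvalues in `{0, 1, -1}`, the operators `tᵏ f(D)` act
associatively on its eigenspace of eigenvalue `1`, and by zero on that of eigenvalue `0`. -/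
theorem structure_of_isBoundedGrading (hW : A.IsBoundedGrading 𝒲 K) {j : ℤ} {v : V}
    (hv : v ∈ 𝒲 j) :
    A.cen v = 0 ∧ A.act 0 1 (A.act 0 1 (A.act 0 1 v)) = A.act 0 1 v ∧
      (A.act 0 1 v = v → ∀ k l f g,
        A.act k f (A.act l g v) = A.act (k + l) (tau l f * g) v) ∧
      (A.act 0 1 v = 0 → ∀ k f, A.act k f v = 0) := by
  refine ⟨?_, ?_, fun h => ?_, fun h => ?_⟩
  rotate_left 2
  · exact (act_act_of_mem_maxGenEigenspace_one hW
      ⟨hv, (Module.End.mem_maxGenEigenspace _ _ _).mpr ⟨1, by simp [h]⟩⟩).1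
  · exact (act_eq_zero_of_mem_maxGenEigenspace_zero hW
      ⟨hv, (Module.End.mem_maxGenEigenspace _ _ _).mpr ⟨1, by simp [h]⟩⟩).1
  all_goals
    have := hW.finite j
    have hv' := le_iSup_inf_maxGenEigenspace (A.act 0 1) _ ((hW.zeroInvariant j).1 1) hv
    clear hv this
    induction hv' using Submodule.iSup_induction' with
    | zero => simp
    | add x y _ _ hx hy => simp only [map_add, hx, hy, add_zero]
    | mem χ v hv =>
      by_cases h0 : v = 0
      · simp [h0]
      have hχ : χ = 0 ∨ χ = 1 ∨ χ = -1 := by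
        obtain ⟨u, hu, wt, c, h⟩ := exists_weightVector hW inf_le_left
          ((hW.zeroInvariant j).inf_maxGenEigenspace 1 χ) (fun hb => h0 (by
            rw [hb] at hv; exact (Submodule.mem_bot ℂ).mp hv))
        rw [← eigenvalue_eq_of_mem_maxGenEigenspace hu.2 h.ne_zero (h.act_zero 1)]
        obtain ⟨-, rfl | ⟨b, rfl | rfl⟩⟩ := weight_eq hW h <;> simp
      rcases hχ with rfl | rfl | rfl
      · obtain ⟨h1, h2⟩ := act_eq_zero_of_mem_maxGenEigenspace_zero hW hv
        simp [h1, h2]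
      · obtain ⟨-, h1, h2⟩ := act_act_of_mem_maxGenEigenspace_one hW hv
        simp [h1, h2]
      · obtain ⟨-, h1, h2⟩ := act_act_of_mem_maxGenEigenspace_one hW.twist
          ⟨hv.1, by simpa using mem_maxGenEigenspace_twist hv.2⟩
        rw [twist_act, map_one, neg_eq_iff_eq_neg] at h2
        have h1 : A.cen v = 0 := h1
        simp [h1, h2]

end ScalarAction

/-! ### Elementary matrix differential operators -/

namespace DiffOp

variable {N : ℕ}

/-- The operator `tᵏ f(D) E_{p,q}`, as a linear function of `f`. -/
def elem (k : ℤ) (p q : Fin N) : ℂ[X] →ₗ[ℂ] DiffOp N :=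
  mono k ∘ₗ Matrix.singleLinearMap ℂ p q

lemma elem_apply (k : ℤ) (p q : Fin N) (f : ℂ[X]) :
    elem k p q f = mono k (Matrix.single p q f) := rfl

lemma shift_single (k : ℤ) (p q : Fin N) (f : ℂ[X]) :
    shift N k (Matrix.single p q f) = Matrix.single p q (tau k f) := by
  simp [shift, tau, Matrix.map_single]

lemma elem_mul_elem (k l : ℤ) (p q r s : Fin N) (f g : ℂ[X]) :
    elem k p q f * elem l r s g = if q = r then elem (k + l) p s (tau l f * g) else 0 := by
  rw [elem_apply, elem_apply, mono_mul_mono, shift_single]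
  split_ifs with h
  · rw [h, Matrix.single_mul_single_same, elem_apply]
  · rw [Matrix.single_mul_single_of_ne _ _ _ _ h, map_zero]

lemma mono_eq_sum (k : ℤ) (F : Coeff N) : mono k F = ∑ p, ∑ q, elem k p q (F p q) := by
  conv_lhs => rw [Matrix.matrix_eq_sum_single F]
  simp only [map_sum, elem_apply]

lemma one_eq_sum : (1 : DiffOp N) = ∑ p, elem 0 p p 1 := by
  rw [one_def, mono_eq_sum]
  refine Finset.sum_congr rfl fun p _ => ?_
  rw [Finset.sum_eq_single p (fun q _ h => by rw [Matrix.one_apply_ne h.symm, map_zero])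
    (fun h => absurd (Finset.mem_univ p) h), Matrix.one_apply_eq]

lemma elem_induction {P : DiffOp N → Prop} (a : DiffOp N) (hzero : P 0)
    (hadd : ∀ a b, P a → P b → P (a + b)) (helem : ∀ k p q f, P (elem k p q f)) : P a := by
  induction a using ind with
  | hadd a b ha hb => exact hadd a b ha hb
  | hmono i F =>
    rw [mono_eq_sum]
    exact Finset.sum_induction _ P hadd hzero fun p _ =>
      Finset.sum_induction _ P hadd hzero fun q _ => helem i p q _

lemma op_single (k : ℤ) (j : ℕ) (p q : Fin N) :
    op k j (Matrix.single p q 1) = elem k p q (X ^ j) := by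
  rw [op, elem_apply]
  congr 1
  ext1 r s
  by_cases h : p = r ∧ q = s
  · simp [h]
  · simp [h]

end DiffOp

/-! ### Unital graded modules over the associative algebra -/

section Associative

variable {N : ℕ} {V : Type*} [AddCommGroup V] [Module ℂ V]

/-- The principal gradation up to the sign `s`: the operator `tᵏ f(D) E_{p,q}` has degree
`k N + s (p - q)`. -/
def IsElemGraded (X : DiffOp N →ₗ[ℂ] Module.End ℂ V) (𝒱 : ℤ → Submodule ℂ V) (s : ℤ) : Prop :=
  ∀ (k : ℤ) (p q : Fin N) (f : ℂ[X]) (j : ℤ), ∀ v ∈ 𝒱 j,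
    X (DiffOp.elem k p q f) v ∈ 𝒱 (j + (k * N + s * ((p : ℤ) - (q : ℤ))))

lemma exists_elem_degree (hN : 1 ≤ N) {s : ℤ} (hs : s = 1 ∨ s = -1) (d : ℤ) (p : Fin N) :
    ∃ (k : ℤ) (q : Fin N), k * N + s * ((p : ℤ) - (q : ℤ)) = d := by
  have hN' : (0 : ℤ) < N := by exact_mod_cast hN
  set x : ℤ := (p : ℤ) - s * d with hx
  have h1 := Int.emod_nonneg x hN'.ne'
  have h2 := Int.emod_lt_of_pos x hN'
  have h3 := Int.emod_add_mul_ediv x N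
  refine ⟨-s * (x / N), ⟨(x % N).toNat, by omega⟩, ?_⟩
  have h4 : (((x % N).toNat : ℕ) : ℤ) = x % N := Int.toNat_of_nonneg h1
  simp only [h4]
  rcases hs with rfl | rfl <;> linarith

lemma elem_degree_injective {s : ℤ} (hs : s = 1 ∨ s = -1) (p : Fin N) :
    Function.Injective fun x : ℤ × Fin N => x.1 * N + s * ((p : ℤ) - (x.2 : ℤ)) := by
  rintro ⟨k, q⟩ ⟨k', q'⟩ h
  have hq := q.2
  have hq' := q'.2
  have hN : (0 : ℤ) < N := by omega
  have h1 : (k - k') * N = s * ((q : ℤ) - (q' : ℤ)) := by linear_combination h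
  have hk : k - k' = 0 := by
    have habs : |(k - k') * (N : ℤ)| < N := by
      rw [h1, abs_lt]
      rcases hs with rfl | rfl <;> constructor <;> omega
    rw [abs_mul, Nat.abs_cast] at habs
    exact Int.abs_lt_one_iff.mp (by nlinarith)
  rw [hk, zero_mul] at h1
  have hqq : (q : ℤ) - (q' : ℤ) = 0 := by
    rcases hs with rfl | rfl <;> linarith
  have : q = q' := Fin.ext (by omega)
  rw [Prod.mk.injEq]
  exact ⟨by omega, this⟩

variable (ρ : DiffOp N →ₐ[ℂ] Module.End ℂ V) {W : Type*} [AddCommGroup W] [Module ℂ W]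
  (α : Module.End ℂ W) (θ : W →ₗ[ℂ] V)

/-- The map `ℂ^N ⊗ W → V`, `e_p ⊗ w ↦ ∑_q E_{p,q} w`, for a map `θ : W → V`. -/
def vecMap : (Fin N → W) →ₗ[ℂ] V :=
  ∑ p, ∑ q, ρ (DiffOp.elem 0 p q 1) ∘ₗ θ ∘ₗ LinearMap.proj p

/-- The map `V(W, α) → V`, `(e_p ⊗ w)ₖ ↦ ∑_q tᵏ E_{p,q} w`, for a map `θ : W → V`. -/
def natModMap : NatMod N α →ₗ[ℂ] V :=
  Finsupp.lsum ℂ fun k => ρ (DiffOp.mono k 1) ∘ₗ vecMap ρ θ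

lemma vecMap_apply (w : Fin N → W) :
    vecMap ρ θ w = ∑ p, ∑ q, ρ (DiffOp.elem 0 p q 1) (θ (w p)) := by
  simp [vecMap]

lemma natModMap_vec (k : ℤ) (w : Fin N → W) :
    natModMap ρ α θ (NatMod.vec α k w) = ρ (DiffOp.mono k 1) (vecMap ρ θ w) :=
  Finsupp.lsum_single ℂ _ k w

lemma natModMap_vec' (k : ℤ) (w : Fin N → W) :
    natModMap ρ α θ (NatMod.vec α k w) = ∑ p, ∑ q, ρ (DiffOp.elem k p q 1) (θ (w p)) := by
  rw [natModMap_vec, vecMap_apply, map_sum]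
  refine Finset.sum_congr rfl fun p _ => ?_
  rw [map_sum]
  refine Finset.sum_congr rfl fun q _ => ?_
  rw [← Module.End.mul_apply, ← map_mul, DiffOp.elem_apply, DiffOp.mono_mul_mono, map_one, one_mul,
    add_zero, ← DiffOp.elem_apply]

variable {ρ α θ}

lemma map_aeval (hθ : ∀ w, θ (α w) = ρ (DiffOp.mono 0 (Matrix.scalar (Fin N) X)) (θ w))
    (h : ℂ[X]) (w : W) :
    θ (aeval α h w) = ρ (DiffOp.mono 0 (Matrix.scalar (Fin N) h)) (θ w) := by
  induction h using Polynomial.induction_on' generalizing w with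
  | add p q hp hq => simp only [map_add, LinearMap.add_apply, hp, hq]
  | monomial n c =>
    induction n generalizing w with
    | zero =>
      have e : DiffOp.mono 0 (Matrix.scalar (Fin N) (monomial 0 c)) = c • (1 : DiffOp N) := by
        rw [DiffOp.one_def, ← map_smul]
        congr 1
        ext1 p q
        by_cases h : p = q
        · simp [h, smul_eq_C_mul]
        · simp [h]
      rw [e, map_smul, map_one]
      simp
    | succ n ih =>
      have e : DiffOp.mono 0 (Matrix.scalar (Fin N) (monomial (n + 1) c)) =
          DiffOp.mono 0 (Matrix.scalar (Fin N) (monomial n c)) *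
            (DiffOp.mono 0 (Matrix.scalar (Fin N) X) : DiffOp N) := by
        rw [DiffOp.mono_mul_mono, shift_zero, ← map_mul, monomial_mul_X, add_zero]
      rw [← monomial_mul_X, map_mul, aeval_X, Module.End.mul_apply, ih, hθ, monomial_mul_X, e,
        map_mul, Module.End.mul_apply]

lemma vecMap_coeffAct (hθ : ∀ w, θ (α w) = ρ (DiffOp.mono 0 (Matrix.scalar (Fin N) X)) (θ w))
    (F : Coeff N) (w : Fin N → W) :
    ρ (DiffOp.mono 0 F) (vecMap ρ θ w) = vecMap ρ θ (coeffAct α 0 F w) := by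
  have hsc : ∀ (r q : Fin N) (f : ℂ[X]), (DiffOp.elem 0 r q 1 : DiffOp N) *
      DiffOp.mono 0 (Matrix.scalar (Fin N) f) = DiffOp.elem 0 r q f := by
    intro r q f
    rw [DiffOp.elem_apply, DiffOp.mono_mul_mono, shift_zero, add_zero, DiffOp.elem_apply]
    congr 1
    ext1 i j
    rw [Matrix.scalar_apply, Matrix.mul_diagonal]
    by_cases h : r = i ∧ q = j <;> simp [h]
  have hd : ∀ (r q : Fin N) (f : ℂ[X]) (u : W), ρ (DiffOp.elem 0 r q 1) (θ (aeval α f u)) =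
      ρ (DiffOp.elem 0 r q f) (θ u) := by
    intro r q f u
    rw [map_aeval hθ, ← Module.End.mul_apply, ← map_mul, hsc]
  have hv : ∀ (r q : Fin N) (f : ℂ[X]), ρ (DiffOp.elem 0 r q f) (vecMap ρ θ w) =
      ∑ i, ρ (DiffOp.elem 0 r i f) (θ (w q)) := by
    intro r q f
    rw [vecMap_apply, map_sum, Finset.sum_eq_single q]
    · rw [map_sum]
      refine Finset.sum_congr rfl fun i _ => ?_
      rw [← Module.End.mul_apply, ← map_mul, DiffOp.elem_mul_elem, if_pos rfl, tau_zero, mul_one,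
        add_zero]
    · intro p _ hp
      rw [map_sum]
      refine Finset.sum_eq_zero fun i _ => ?_
      rw [← Module.End.mul_apply, ← map_mul, DiffOp.elem_mul_elem, if_neg hp.symm, map_zero,
        LinearMap.zero_apply]
    · intro h
      exact absurd (Finset.mem_univ q) h
  rw [DiffOp.mono_eq_sum, vecMap_apply _ _ (coeffAct α 0 F w)]
  simp only [coeffAct_apply, Int.cast_zero, map_zero, zero_add, map_sum, hd, LinearMap.sum_apply,
    hv]
  exact Finset.sum_congr rfl fun p _ => Finset.sum_comm

lemma natModMap_act (hθ : ∀ w, θ (α w) = ρ (DiffOp.mono 0 (Matrix.scalar (Fin N) X)) (θ w))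
    (a : DiffOp N) (x : NatMod N α) :
    natModMap ρ α θ (NatMod.act α a x) = ρ a (natModMap ρ α θ x) := by
  induction x using NatMod.ind with
  | hadd v w h h' => simp only [map_add, h, h']
  | hvec k w =>
  induction a using DiffOp.ind with
  | hadd a b h h' => simp only [map_add, LinearMap.add_apply, h, h']
  | hmono i F =>
  have h := coeffAct_shift α 0 k F
  rw [add_zero] at h
  rw [NatMod.act_mono_vec, natModMap_vec, natModMap_vec, ← Module.End.mul_apply, ← map_mul,
    DiffOp.mono_mul_mono, mul_one, ← h, ← vecMap_coeffAct hθ, ← Module.End.mul_apply, ← map_mul,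
    DiffOp.mono_mul_mono, map_one, one_mul, add_zero]

variable {𝒱 : ℤ → Submodule ℂ V} {s : ℤ} {j₀ : ℤ}

/-- A unital graded module over the associative algebra of matrix differential operators is
isomorphic to `V(W, α)`, where `W` is any of its components and `α` is the action of `D` on it. -/
theorem natModMap_bijective (hN : 1 ≤ N) (hs : s = 1 ∨ s = -1)
    (h𝒱 : DirectSum.IsInternal 𝒱) (hgr : IsElemGraded ρ.toLinearMap 𝒱 s)
    (hθi : Function.Injective θ) (hθr : LinearMap.range θ = 𝒱 j₀) :
    Function.Bijective (natModMap ρ α θ) := by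
  have hgr' : ∀ (k : ℤ) (p q : Fin N) (f : ℂ[X]) (j : ℤ), ∀ v ∈ 𝒱 j,
      ρ (DiffOp.elem k p q f) v ∈ 𝒱 (j + (k * N + s * ((p : ℤ) - (q : ℤ)))) := hgr
  have hsum : ∀ u : V, ∑ p, ρ (DiffOp.elem 0 p p 1) u = u := by
    intro u
    rw [← LinearMap.sum_apply, ← map_sum, ← DiffOp.one_eq_sum, map_one, Module.End.one_apply]
  classical
  constructor
  · rw [← LinearMap.ker_eq_bot, LinearMap.ker_eq_bot']
    intro x hx
    obtain ⟨y, rfl⟩ : ∃ y : ℤ →₀ (Fin N → W), y.sum (fun k w => NatMod.vec α k w) = x :=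
      ⟨x, Finsupp.sum_single x⟩
    have hind := (iSupIndep_iff_finsetSum_eq_zero_imp_eq_zero 𝒱).mp h𝒱.submodule_iSupIndep
    have hθm : ∀ w, θ w ∈ 𝒱 j₀ := fun w => hθr ▸ LinearMap.mem_range_self θ w
    have key : ∀ r : Fin N, ∀ k ∈ y.support, ∀ q, ρ (DiffOp.elem k r q 1) (θ (y k r)) = 0 := by
      intro r k hk q
      obtain ⟨e, he⟩ : ∃ e : ℤ × Fin N ↪ ℤ,
          ∀ x, e x = j₀ + (x.1 * N + s * ((r : ℤ) - (x.2 : ℤ))) :=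
        ⟨⟨fun x => j₀ + (x.1 * N + s * ((r : ℤ) - (x.2 : ℤ))), fun x x' h =>
          elem_degree_injective (N := N) hs r (add_left_cancel h)⟩, fun _ => rfl⟩
      have h1 : ∑ x ∈ y.support ×ˢ (Finset.univ : Finset (Fin N)),
          ρ (DiffOp.elem x.1 r x.2 1) (θ (y x.1 r)) = 0 := by
        have h2 := congrArg (ρ (DiffOp.elem 0 r r 1)) hx
        rw [Finsupp.sum, map_sum, map_sum, map_zero] at h2
        rw [Finset.sum_product, ← h2]
        refine Finset.sum_congr rfl fun k _ => ?_
        rw [natModMap_vec', map_sum]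
        symm
        rw [Finset.sum_eq_single r]
        · rw [map_sum]
          refine Finset.sum_congr rfl fun q _ => ?_
          rw [← Module.End.mul_apply, ← map_mul, DiffOp.elem_mul_elem, if_pos rfl]
          simp
        · intro p _ hp
          rw [map_sum]
          refine Finset.sum_eq_zero fun q _ => ?_
          rw [← Module.End.mul_apply, ← map_mul, DiffOp.elem_mul_elem, if_neg hp.symm]
          simp
        · intro h
          exact absurd (Finset.mem_univ r) h
      set F : ℤ × Fin N → V := fun x => ρ (DiffOp.elem x.1 r x.2 1) (θ (y x.1 r)) with hF
      set S := y.support ×ˢ (Finset.univ : Finset (Fin N)) with hS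
      have hval : ∀ x, (if h : ∃ x', e x' = e x then F h.choose else 0) = F x := by
        intro x
        have h : ∃ x', e x' = e x := ⟨x, rfl⟩
        rw [dif_pos h, e.injective h.choose_spec]
      have h4 := hind (S.map e) (fun d => if h : ∃ x, e x = d then F h.choose else 0) (by
        intro d hd
        obtain ⟨x, hx, rfl⟩ := Finset.mem_map.mp hd
        simp only [hval]
        rw [he]
        exact hgr' _ _ _ _ _ _ (hθm _)) (by
        rw [Finset.sum_map]
        simp only [hval]
        exact h1) (e (k, q)) (Finset.mem_map.mpr ⟨(k, q), by simpa [hS] using hk, rfl⟩)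
      simp only [hval] at h4
      exact h4
    have hzero : y = 0 := by
      rw [← Finsupp.support_eq_empty, Finset.eq_empty_iff_forall_notMem]
      intro k hk
      refine (Finsupp.mem_support_iff.mp hk) (funext fun r => hθi ?_)
      rw [Pi.zero_apply, map_zero, ← hsum (θ (y k r))]
      refine Finset.sum_eq_zero fun q _ => ?_
      have h1 := congrArg (ρ (DiffOp.elem (-k) q r 1)) (key r k hk q)
      rw [← Module.End.mul_apply, ← map_mul, DiffOp.elem_mul_elem, if_pos rfl] at h1
      simpa using h1
    rw [hzero, Finsupp.sum_zero_index]
  · rw [← LinearMap.range_eq_top, eq_top_iff, ← h𝒱.submodule_iSup_eq_top]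
    refine iSup_le fun j u hu => ?_
    rw [← hsum u]
    refine Submodule.sum_mem _ fun p _ => ?_
    obtain ⟨k, q, hkq⟩ := exists_elem_degree hN hs (j - j₀) p
    have h1 := hgr' (-k) q p 1 j u hu
    rw [show j + (-k * N + s * ((q : ℤ) - (p : ℤ))) = j₀ by linear_combination -hkq, ← hθr] at h1
    obtain ⟨w, hw⟩ := h1
    refine ⟨NatMod.vec α k (Pi.single p w), ?_⟩
    rw [natModMap_vec', Finset.sum_eq_single p]
    · simp only [Pi.single_eq_same, hw, ← Module.End.mul_apply, ← map_mul, DiffOp.elem_mul_elem]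
      rw [Finset.sum_eq_single q]
      · simp
      · intro q' _ h
        rw [if_neg h]; simp
      · intro h; exact absurd (Finset.mem_univ q) h
    · intro p' _ h
      simp [Pi.single_eq_of_ne h]
    · intro h; exact absurd (Finset.mem_univ p) h

end Associative

/-! ### Corners of a module over the central extension -/

namespace DiffOp

variable {N : ℕ}

lemma evalAt_single (m : ℤ) (p q : Fin N) (f : ℂ[X]) :
    evalAt N m (Matrix.single p q f) = Matrix.single p q (f.eval (m : ℂ)) := by
  ext r s
  by_cases h : p = r ∧ q = s <;> simp [evalAt_apply, h]

lemma cocycle_elem_self (k : ℤ) (p : Fin N) (f g : ℂ[X]) :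
    cocycle (elem k p p f) (elem (-k) p p g) = intervalSum 0 k (tau (-k) f * g) := by
  have h := signedSum_shift (fun m => (tau (-k) f * g).eval (m : ℂ)) (-k) 0 k
  rw [neg_add_cancel] at h
  rw [intervalSum_apply, elem_apply, elem_apply, cocycle_mono, if_pos (add_neg_cancel k), ← h]
  congr 1
  funext m
  rw [evalAt_single, evalAt_single, Matrix.single_mul_single_same, Matrix.trace_single_eq_same,
    eval_mul, eval_tau]
  push_cast
  rw [add_neg_cancel_right]

lemma cocycle_elem_of_ne (k l : ℤ) {p q r s : Fin N} (h : q ≠ r) (f g : ℂ[X]) :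
    cocycle (elem k p q f) (elem l r s g) = 0 := by
  rw [elem_apply, elem_apply, cocycle_mono]
  simp [evalAt_single, h, signedSum]

lemma cocycle_elem_of_add_ne (k l : ℤ) (h : k + l ≠ 0) (p q r s : Fin N) (f g : ℂ[X]) :
    cocycle (elem k p q f) (elem l r s g) = 0 := by
  rw [elem_apply, elem_apply, cocycle_mono, if_neg h]

end DiffOp

section Graded

variable {N : ℕ} {V : Type*} [AddCommGroup V] [Module ℂ V] {𝒱 : ℤ → Submodule ℂ V}

/-- An identity of operators on a graded space may be checked on homogeneous vectors. -/
lemma eq_of_eq_on_components {V' : Type*} [AddCommGroup V'] [Module ℂ V']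
    (h𝒱 : DirectSum.IsInternal 𝒱) {φ ψ : V →ₗ[ℂ] V'}
    (h : ∀ j, ∀ v ∈ 𝒱 j, φ v = ψ v) : φ = ψ := by
  have : (⊤ : Submodule ℂ V) ≤ LinearMap.eqLocus φ ψ := by
    rw [← h𝒱.submodule_iSup_eq_top]
    exact iSup_le fun j v hv => h j v hv
  exact LinearMap.ext fun v => this (Submodule.mem_top : v ∈ ⊤)

/-- The properties of the action of one corner on a uniformly bounded module, without reference
to the gradation. -/
structure ScalarAction.IsTame (A : ScalarAction V) : Prop where
  cube : ∀ v, A.act 0 1 (A.act 0 1 (A.act 0 1 v)) = A.act 0 1 v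
  act_act : ∀ v, A.act 0 1 v = v → ∀ k l f g,
    A.act k f (A.act l g v) = A.act (k + l) (tau l f * g) v
  act_eq_zero : ∀ v, A.act 0 1 v = 0 → ∀ k f, A.act k f v = 0

lemma ScalarAction.isTame_of_isBoundedGrading (h𝒱 : DirectSum.IsInternal 𝒱) {K : ℕ}
    {A : ScalarAction V} (hA : ∀ j, A.IsBoundedGrading (fun i => 𝒱 (j + N * i)) K) : A.IsTame := by
  have H := fun j v (hv : v ∈ 𝒱 j) => structure_of_isBoundedGrading (hA j)
    (j := 0) (v := v) (by simpa using hv)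
  have hmem : ∀ j, ∀ v ∈ 𝒱 j, A.act 0 1 v ∈ 𝒱 j := fun j v hv => by
    simpa using (hA j).act_mem 0 0 1 v (by simpa using hv)
  have cube : ∀ v, A.act 0 1 (A.act 0 1 (A.act 0 1 v)) = A.act 0 1 v := by
    intro v
    have := eq_of_eq_on_components h𝒱 (φ := A.act 0 1 * A.act 0 1 * A.act 0 1) (ψ := A.act 0 1)
      (fun j v hv => (H j v hv).2.1)
    exact LinearMap.congr_fun this v
  refine ⟨cube, fun v hv k l f g => ?_, fun v hv k f => ?_⟩
  · have := eq_of_eq_on_components h𝒱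
      (φ := A.act k f * A.act l g * (A.act 0 1 * A.act 0 1 + A.act 0 1))
      (ψ := A.act (k + l) (tau l f * g) * (A.act 0 1 * A.act 0 1 + A.act 0 1)) (fun j v hv => by
        refine (H j _ (add_mem (hmem j _ (hmem j _ hv)) (hmem j _ hv))).2.2.1 ?_ k l f g
        rw [map_add, cube, add_comm])
    have := LinearMap.congr_fun this v
    simp only [Module.End.mul_apply, LinearMap.add_apply, hv, map_add] at this
    have h2 : (2 : ℂ) ≠ 0 := two_ne_zero
    refine smul_right_injective V h2 ?_
    simpa only [two_smul] using this
  · have := eq_of_eq_on_components h𝒱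
      (φ := A.act k f * (1 - A.act 0 1 * A.act 0 1)) (ψ := 0) (fun j v hv => by
        refine (H j _ (sub_mem hv (hmem j _ (hmem j _ hv)))).2.2.2 ?_ k f
        rw [map_sub, cube, sub_self])
    simpa [hv] using LinearMap.congr_fun this v

end Graded

lemma HatD.eq_ofOp_add {N : ℕ} (x : HatD N) : x = ofOp (toOp x) + coef x • central N := by
  ext1 <;> simp

lemma lie_central_comm {N : ℕ} {V : Type*} [AddCommGroup V] [LieRingModule (HatD N) V]
    (x : HatD N) (v : V) :
    ⁅HatD.central N, ⁅x, v⁆⁆ = ⁅x, ⁅HatD.central N, v⁆⁆ := by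
  have h : ⁅HatD.central N, x⁆ = 0 := by ext1 <;> simp
  rw [← sub_eq_zero, ← lie_lie, h, zero_lie]

section HatModule

variable {N : ℕ} {V : Type*} [AddCommGroup V] [Module ℂ V] [LieRingModule (HatD N) V]
  [LieModule ℂ (HatD N) V]

variable (N V) in
/-- The action of the matrix differential operators on a module over the central extension. -/
def opAct : DiffOp N →ₗ[ℂ] Module.End ℂ V :=
  LinearMap.mk₂ ℂ (fun a v => ⁅HatD.ofOp a, v⁆) (fun a b v => by rw [map_add, add_lie])
    (fun c a v => by rw [map_smul, smul_lie]) (fun a v w => lie_add _ v w)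
    (fun c a v => lie_smul c _ v)

lemma opAct_apply (a : DiffOp N) (v : V) : opAct N V a v = ⁅HatD.ofOp a, v⁆ := rfl

lemma opAct_comm (a b : DiffOp N) (v : V) :
    opAct N V a (opAct N V b v) - opAct N V b (opAct N V a v) =
      opAct N V (a * b - b * a) v + DiffOp.cocycle a b • ⁅HatD.central N, v⁆ := by
  simp only [opAct_apply]
  rw [← lie_lie, HatD.lie_def, add_lie, smul_lie, HatD.toOp_ofOp, HatD.toOp_ofOp]

lemma ofOp_elem_mem_deg (k : ℤ) (p q : Fin N) (f : ℂ[X]) :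
    HatD.ofOp (DiffOp.elem k p q f) ∈ HatD.deg N (k * N + (p : ℤ) - (q : ℤ)) := by
  induction f using Polynomial.induction_on' with
  | add f g hf hg => rw [map_add, map_add]; exact add_mem hf hg
  | monomial n c =>
    rw [← C_mul_X_pow_eq_monomial, ← smul_eq_C_mul, map_smul, map_smul, ← DiffOp.op_single]
    exact Submodule.smul_mem _ _ (Submodule.subset_span (Or.inl ⟨k, n, p, q, rfl, rfl⟩))

lemma central_mem_deg : HatD.central N ∈ HatD.deg N 0 :=
  Submodule.subset_span (Or.inr ⟨rfl, rfl⟩)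

variable {𝒱 : ℤ → Submodule ℂ V}

lemma IsQuasifinite.opAct_mem (h : IsQuasifinite N 𝒱) : IsElemGraded (opAct N V) 𝒱 1 := by
  intro k p q f j v hv
  have := h.lie_mem _ _ _ (ofOp_elem_mem_deg k p q f) _ hv
  rwa [show k * N + (p : ℤ) - (q : ℤ) + j = j + (k * N + 1 * ((p : ℤ) - (q : ℤ))) by ring] at this

variable (N V) in
/-- The action of the central element. -/
def cenAct : Module.End ℂ V where
  toFun v := ⁅HatD.central N, v⁆
  map_add' := lie_add _
  map_smul' c := lie_smul c _

variable (V) in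
/-- The scalar differential operators `tᵏ f(D) E_{p,p}` acting on a module over the central
extension. -/
def cornerAction (p : Fin N) : ScalarAction V where
  act k := opAct N V ∘ₗ DiffOp.elem k p p
  cen := cenAct N V
  s := 0
  cen_act k f v := lie_central_comm _ v
  lie_act k l f g v hkl := by
    have h := opAct_comm (DiffOp.elem k p p f) (DiffOp.elem l p p g) v
    rw [DiffOp.cocycle_elem_of_add_ne k l hkl, zero_smul, add_zero, DiffOp.elem_mul_elem,
      DiffOp.elem_mul_elem, if_pos rfl, if_pos rfl, add_comm l k, ← map_sub] at h
    exact h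
  lie_act_neg k f g v := by
    have h := opAct_comm (DiffOp.elem k p p f) (DiffOp.elem (-k) p p g) v
    rw [DiffOp.cocycle_elem_self, DiffOp.elem_mul_elem,
      DiffOp.elem_mul_elem, if_pos rfl, if_pos rfl, neg_add_cancel, add_neg_cancel, ← map_sub] at h
    exact h

lemma cornerAction_act (p : Fin N) (k : ℤ) (f : ℂ[X]) :
    (cornerAction V p).act k f = opAct N V (DiffOp.elem k p p f) := rfl

lemma cornerAction_cen (p : Fin N) (v : V) : (cornerAction V p).cen v = ⁅HatD.central N, v⁆ := rfl

lemma isBoundedGrading_cornerAction (h : IsQuasifinite N 𝒱) {K : ℕ}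
    (hK : ∀ j, Module.finrank ℂ (𝒱 j) ≤ K) (p : Fin N) (j : ℤ) :
    (cornerAction V p).IsBoundedGrading (fun i => 𝒱 (j + N * i)) K where
  act_mem k i f v hv := by
    have := h.opAct_mem k p p f _ v hv
    rwa [show j + N * i + (k * N + 1 * ((p : ℤ) - (p : ℤ))) = j + N * (k + i) by ring] at this
  cen_mem i v hv := by
    have := h.lie_mem 0 _ _ central_mem_deg _ hv
    rwa [zero_add] at this
  finite i := h.finite _
  finrank_le i := hK _

lemma IsUniformlyBounded.isTame_cornerAction (h : IsUniformlyBounded N 𝒱) (p : Fin N) :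
    (cornerAction V p).IsTame := by
  obtain ⟨K, _, hK⟩ := h.bounded
  exact ScalarAction.isTame_of_isBoundedGrading h.isInternal
    (isBoundedGrading_cornerAction h.toIsQuasifinite hK p)

lemma IsUniformlyBounded.isTame_twist_cornerAction (h : IsUniformlyBounded N 𝒱) (p : Fin N) :
    (cornerAction V p).twist.IsTame := by
  obtain ⟨K, _, hK⟩ := h.bounded
  exact ScalarAction.isTame_of_isBoundedGrading h.isInternal
    (fun j => (isBoundedGrading_cornerAction h.toIsQuasifinite hK p j).twist)

lemma IsUniformlyBounded.lie_central (h : IsUniformlyBounded N 𝒱) (hN : 1 ≤ N) (v : V) :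
    ⁅HatD.central N, v⁆ = 0 := by
  obtain ⟨K, _, hK⟩ := h.bounded
  have := eq_of_eq_on_components h.isInternal
    (φ := cenAct N V) (ψ := 0) (fun j v hv =>
      (ScalarAction.structure_of_isBoundedGrading
        (isBoundedGrading_cornerAction h.toIsQuasifinite hK ⟨0, hN⟩ j)
        (j := 0) (v := v) (by simpa using hv)).1)
  exact LinearMap.congr_fun this v

/-! ### Orthogonality of distinct corners -/

/-- On the eigenspaces of eigenvalue `±1` of `E_{p,p}` the operator `t E_{p,p}` is invertible. -/
lemma act_one_act_neg_one {A : ScalarAction V} (hA : A.IsTame) (hA' : A.twist.IsTame)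
    {ε : ℂ} (hε : ε = 1 ∨ ε = -1) {v : V} (hv : A.act 0 1 v = ε • v) (k : ℤ) :
    A.act k 1 (A.act (-k) 1 v) = v := by
  rcases hε with rfl | rfl
  · rw [one_smul] at hv
    rw [hA.act_act v hv]
    simp [hv]
  · have h : A.twist.act 0 1 v = v := by
      rw [ScalarAction.twist_act, map_one, hv, neg_one_smul, neg_neg]
    have h2 := hA'.act_act v h k (-k) 1 1
    simp only [map_one, mul_one, add_neg_cancel, h] at h2
    simpa [ScalarAction.twist_act] using h2

/-- The relation `D S - S D = S` with `S` invertible is impossible on a nonzero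
finite-dimensional space. -/
lemma finrank_eq_zero_of_comm {U : Type*} [AddCommGroup U] [Module ℂ U] [FiniteDimensional ℂ U]
    {D S S' : Module.End ℂ U} (h : D * S - S * D = S) (hS : S * S' = 1) :
    Module.finrank ℂ U = 0 := by
  have h1 : D * S * S' - S * D * S' = 1 := by rw [← sub_mul, h, hS]
  have h2 := congrArg (LinearMap.trace ℂ U) h1
  have hS' : S' * S = 1 := mul_eq_one_comm.mp hS
  rw [map_sub, mul_assoc, hS, mul_one, LinearMap.trace_mul_cycle, hS', one_mul, sub_self,
    LinearMap.trace_one] at h2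
  exact_mod_cast h2.symm

lemma opAct_comm_of_ne {p q : Fin N} (hpq : p ≠ q) (k l : ℤ) (f g : ℂ[X]) (v : V) :
    opAct N V (DiffOp.elem k p p f) (opAct N V (DiffOp.elem l q q g) v) =
      opAct N V (DiffOp.elem l q q g) (opAct N V (DiffOp.elem k p p f) v) := by
  have h := opAct_comm (DiffOp.elem k p p f) (DiffOp.elem l q q g) v
  rw [DiffOp.cocycle_elem_of_ne k l hpq, DiffOp.elem_mul_elem, DiffOp.elem_mul_elem, if_neg hpq,
    if_neg hpq.symm, sub_zero, map_zero, LinearMap.zero_apply, zero_smul, add_zero] at h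
  exact sub_eq_zero.mp h

lemma IsUniformlyBounded.eq_zero_of_corner_eigenvector (h : IsUniformlyBounded N 𝒱)
    {p q : Fin N} (hpq : p ≠ q) {ε ε' : ℂ} (hε : ε = 1 ∨ ε = -1) (hε' : ε' = 1 ∨ ε' = -1)
    {j : ℤ} {v : V} (hv : v ∈ 𝒱 j) (hp : opAct N V (DiffOp.elem 0 p p 1) v = ε • v)
    (hq : opAct N V (DiffOp.elem 0 q q 1) v = ε' • v) : v = 0 := by
  set P := cornerAction V p with hP
  set Q := cornerAction V q with hQ
  have hPQ : ∀ k l f g w, P.act k f (Q.act l g w) = Q.act l g (P.act k f w) :=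
    fun k l f g w => opAct_comm_of_ne hpq k l f g w
  let U : Submodule ℂ V := 𝒱 j ⊓ (LinearMap.ker (P.act 0 1 - ε • 1) ⊓
    LinearMap.ker (Q.act 0 1 - ε' • 1))
  have hU : ∀ w, w ∈ U ↔ w ∈ 𝒱 j ∧ P.act 0 1 w = ε • w ∧ Q.act 0 1 w = ε' • w := by
    intro w
    simp [U, sub_eq_zero]
  have hmem : ∀ k f g, ∀ w ∈ U, P.act k f (Q.act (-k) g w) ∈ U := by
    intro k f g w hw
    rw [hU] at hw ⊢
    refine ⟨?_, ?_, ?_⟩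
    · have h1 := h.toIsQuasifinite.opAct_mem (-k) q q g j w hw.1
      have h2 := h.toIsQuasifinite.opAct_mem k p p f _ _ h1
      rwa [show j + (-k * N + 1 * ((q : ℤ) - (q : ℤ))) + (k * N + 1 * ((p : ℤ) - (p : ℤ))) = j by
        ring] at h2
    · rw [P.act_zero_one_act, hPQ, hw.2.1, map_smul, map_smul]
    · rw [← hPQ, Q.act_zero_one_act, hw.2.2, map_smul, map_smul]
  have hDmem : ∀ w ∈ U, P.act 0 X w ∈ U := by
    intro w hw
    rw [hU] at hw ⊢
    refine ⟨?_, ?_, ?_⟩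
    · have h2 := h.toIsQuasifinite.opAct_mem 0 p p X _ _ hw.1
      rwa [show j + (0 * N + 1 * ((p : ℤ) - (p : ℤ))) = j by ring] at h2
    · rw [P.act_zero_one_act, hw.2.1, map_smul]
    · rw [← hPQ, hw.2.2, map_smul]
  let D : Module.End ℂ U := (P.act 0 X).restrict hDmem
  let S : ℤ → Module.End ℂ U := fun k => (P.act k 1 * Q.act (-k) 1).restrict (hmem k 1 1)
  have hfin : FiniteDimensional ℂ U := by
    have := h.finite j
    exact Submodule.finiteDimensional_of_le (inf_le_left : U ≤ 𝒱 j)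
  have hDS : D * S 1 - S 1 * D = S 1 := by
    ext w
    have h1 := P.act_zero_act 1 X 1 (Q.act (-1) 1 w)
    rw [tau_X, mul_one, Int.cast_one, add_sub_cancel_left, C_1, hPQ 0 (-1)] at h1
    simp only [D, S, LinearMap.sub_apply, Module.End.mul_apply, Submodule.coe_sub,
      LinearMap.coe_restrict_apply]
    rw [h1, add_sub_cancel_left]
  have hSS : S 1 * S (-1) = 1 := by
    ext w
    have hw := (hU w).mp w.2
    simp only [S, Module.End.mul_apply, LinearMap.coe_restrict_apply, Module.End.one_apply]
    rw [← hPQ (-1) (-1), act_one_act_neg_one (h.isTame_cornerAction p)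
      (h.isTame_twist_cornerAction p) hε]
    · exact act_one_act_neg_one (h.isTame_cornerAction q) (h.isTame_twist_cornerAction q) hε'
        hw.2.2 (-1)
    · rw [hPQ, hPQ, hw.2.1, map_smul, map_smul]
  have h0 := finrank_eq_zero_of_comm hDS hSS
  have hbot : U = ⊥ := Submodule.finrank_eq_zero.mp h0
  have hvU : v ∈ U := (hU v).mpr ⟨hv, hp, hq⟩
  rwa [hbot, Submodule.mem_bot] at hvU

lemma IsUniformlyBounded.corner_mul_corner (h : IsUniformlyBounded N 𝒱) {p q : Fin N}
    (hpq : p ≠ q) (v : V) :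
    opAct N V (DiffOp.elem 0 p p 1) (opAct N V (DiffOp.elem 0 q q 1) v) = 0 := by
  set P := opAct N V (DiffOp.elem 0 p p 1) with hP
  set Q := opAct N V (DiffOp.elem 0 q q 1) with hQ
  have hPQ : ∀ w, P (Q w) = Q (P w) := opAct_comm_of_ne hpq 0 0 1 1
  have hP3 : ∀ w, P (P (P w)) = P w := (h.isTame_cornerAction p).cube
  have hQ3 : ∀ w, Q (Q (Q w)) = Q w := (h.isTame_cornerAction q).cube
  have hm : ∀ (r : Fin N) j, ∀ w ∈ 𝒱 j, opAct N V (DiffOp.elem 0 r r 1) w ∈ 𝒱 j := by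
    intro r j w hw
    have h2 := h.toIsQuasifinite.opAct_mem 0 r r 1 _ _ hw
    rwa [show j + (0 * N + 1 * ((r : ℤ) - (r : ℤ))) = j by ring] at h2
  have key : P * Q = 0 := by
    refine eq_of_eq_on_components h.isInternal fun j w hw => ?_
    rw [LinearMap.zero_apply]
    -- `P Q w` is the sum of its projections to the four joint eigenspaces
    have hz : ∀ ε ε' : ℂ, (ε = 1 ∨ ε = -1) → (ε' = 1 ∨ ε' = -1) →
        P (P (Q (Q w) + ε' • Q w)) + ε • P (Q (Q w) + ε' • Q w) = 0 := by
      intro ε ε' hε hε'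
      have hm' : Q (Q w) + ε' • Q w ∈ 𝒱 j :=
        add_mem (hm q j _ (hm q j _ hw)) (Submodule.smul_mem _ _ (hm q j _ hw))
      have e1 : ε * ε = 1 := by rcases hε with rfl | rfl <;> norm_num
      have e2 : ε' * ε' = 1 := by rcases hε' with rfl | rfl <;> norm_num
      refine h.eq_zero_of_corner_eigenvector hpq hε hε' (j := j)
        (add_mem (hm p j _ (hm p j _ hm')) (Submodule.smul_mem _ _ (hm p j _ hm'))) ?_ ?_
      · rw [← hP, map_add, hP3, map_smul, smul_add, smul_smul, e1, one_smul, add_comm]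
      · rw [← hQ]
        have : Q (Q (Q w) + ε' • Q w) = ε' • (Q (Q w) + ε' • Q w) := by
          rw [map_add, hQ3, map_smul, smul_add, smul_smul, e2, one_smul, add_comm]
        rw [map_add, map_smul, ← hPQ, ← hPQ, this, map_smul, map_smul, smul_add, smul_comm ε ε']
    have z1 := hz 1 1 (Or.inl rfl) (Or.inl rfl)
    have z2 := hz 1 (-1) (Or.inl rfl) (Or.inr rfl)
    have z3 := hz (-1) 1 (Or.inr rfl) (Or.inl rfl)
    have z4 := hz (-1) (-1) (Or.inr rfl) (Or.inr rfl)
    simp only [map_add, map_smul] at z1 z2 z3 z4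
    have : (4 : ℂ) • P (Q w) = 0 := by
      linear_combination (norm := module) z1 - z2 - z3 + z4
    exact (smul_eq_zero.mp this).resolve_left (by norm_num)
  exact LinearMap.congr_fun key v

end HatModule

/-! ### The associative part of a bounded module -/

section Columns

variable {N : ℕ} {V : Type*} [AddCommGroup V] [Module ℂ V]

/-- A representation `Y` of the commutator Lie algebra of the matrix differential operators in
which the diagonal units `E_{p,p}` are orthogonal, have eigenvalues `0`, `1`, `-1`, and whose
corners are associative on the eigenspace `1` and trivial on the eigenspace `0`. -/
structure IsColumnLike (Y : DiffOp N →ₗ[ℂ] Module.End ℂ V) : Prop where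
  comm : ∀ a b v, Y a (Y b v) - Y b (Y a v) = Y (a * b - b * a) v
  cube : ∀ p v, Y (DiffOp.elem 0 p p 1) (Y (DiffOp.elem 0 p p 1) (Y (DiffOp.elem 0 p p 1) v)) =
    Y (DiffOp.elem 0 p p 1) v
  mul_eq_zero : ∀ p q, p ≠ q → ∀ v, Y (DiffOp.elem 0 p p 1) (Y (DiffOp.elem 0 q q 1) v) = 0
  act_act : ∀ p v, Y (DiffOp.elem 0 p p 1) v = v → ∀ k l f g,
    Y (DiffOp.elem k p p f) (Y (DiffOp.elem l p p g) v) =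
      Y (DiffOp.elem (k + l) p p (tau l f * g)) v
  act_eq_zero : ∀ p v, Y (DiffOp.elem 0 p p 1) v = 0 → ∀ k f, Y (DiffOp.elem k p p f) v = 0

namespace IsColumnLike

variable {Y : DiffOp N →ₗ[ℂ] Module.End ℂ V}

lemma unit_act (hY : IsColumnLike Y) (t r s : Fin N) (l : ℤ) (g : ℂ[X]) (v : V) :
    Y (DiffOp.elem 0 t t 1) (Y (DiffOp.elem l r s g) v) =
      Y (DiffOp.elem l r s g) (Y (DiffOp.elem 0 t t 1) v) +
        ((if t = r then 1 else 0) - (if t = s then 1 else 0) : ℂ) •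
          Y (DiffOp.elem l r s g) v := by
  have h := hY.comm (DiffOp.elem 0 t t 1) (DiffOp.elem l r s g) v
  rw [sub_eq_iff_eq_add'] at h
  rw [h, DiffOp.elem_mul_elem, DiffOp.elem_mul_elem]
  congr 1
  have hst : (s = t) = (t = s) := propext eq_comm
  simp only [hst]
  rcases eq_or_ne t r with rfl | h1 <;> rcases eq_or_ne t s with rfl | h2 <;> simp [*]

lemma one_apply (v : V) : Y 1 v = ∑ p, Y (DiffOp.elem 0 p p 1) v := by
  rw [DiffOp.one_eq_sum, map_sum, LinearMap.sum_apply]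

lemma unit_one (hY : IsColumnLike Y) (p : Fin N) (v : V) :
    Y (DiffOp.elem 0 p p 1) (Y 1 v) = Y (DiffOp.elem 0 p p 1) (Y (DiffOp.elem 0 p p 1) v) := by
  rw [one_apply, map_sum]
  exact Finset.sum_eq_single p (fun q _ h => hY.mul_eq_zero p q h.symm v)
    (fun h => absurd (Finset.mem_univ p) h)

/-- The identity operator acts diagonalizably with eigenvalues `0`, `1` and `-1`. -/
lemma one_cube (hY : IsColumnLike Y) (v : V) : Y 1 (Y 1 (Y 1 v)) = Y 1 v := by
  rw [one_apply (Y 1 (Y 1 v))]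
  conv_rhs => rw [one_apply v]
  refine Finset.sum_congr rfl fun p _ => ?_
  rw [hY.unit_one, hY.unit_one, hY.cube]

lemma one_comm (hY : IsColumnLike Y) (a : DiffOp N) (v : V) : Y 1 (Y a v) = Y a (Y 1 v) := by
  have h := hY.comm 1 a v
  rwa [one_mul, mul_one, sub_self, map_zero, LinearMap.zero_apply, sub_eq_zero] at h

/-- The vectors of the column `u`: eigenvectors of the diagonal units `E_{t,t}` of eigenvalue
`1` for `t = u` and `0` otherwise. -/
def IsColumn (Y : DiffOp N →ₗ[ℂ] Module.End ℂ V) (u : Fin N) (v : V) : Prop :=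
  ∀ t, Y (DiffOp.elem 0 t t 1) v = if t = u then v else 0

lemma isColumn_unit (hY : IsColumnLike Y) {v : V} (hv : Y 1 v = v) (u : Fin N) :
    IsColumn Y u (Y (DiffOp.elem 0 u u 1) v) := by
  intro t
  split_ifs with h
  · rw [h, ← hY.unit_one, hv]
  · exact hY.mul_eq_zero t u h v

lemma IsColumn.act_of_ne (hY : IsColumnLike Y) {u : Fin N} {v : V} (hv : IsColumn Y u v)
    (l : ℤ) (r : Fin N) {s : Fin N} (hus : u ≠ s) (g : ℂ[X]) : Y (DiffOp.elem l r s g) v = 0 := by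
  have hs : Y (DiffOp.elem 0 s s 1) v = 0 := by rw [hv s, if_neg hus.symm]
  rcases eq_or_ne r s with rfl | hrs
  · exact hY.act_eq_zero r v hs l g
  -- the vector `w` has eigenvalue `-1` under `E_{s,s}` and a nonzero one under `E_{u,u}`
  set w := Y (DiffOp.elem l r s g) v with hw
  have h1 : Y (DiffOp.elem 0 s s 1) w = -w := by
    rw [hw, hY.unit_act, hs, map_zero, zero_add, if_neg hrs.symm, if_pos rfl, zero_sub,
      neg_one_smul]
  have h2 : Y (DiffOp.elem 0 u u 1) w = (1 + if u = r then 1 else 0 : ℂ) • w := by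
    rw [hw, hY.unit_act, hv u, if_pos rfl, if_neg hus, sub_zero, add_smul, one_smul]
  have h3 := hY.mul_eq_zero s u hus.symm w
  rw [h2, map_smul, h1] at h3
  have h4 : (1 + if u = r then 1 else 0 : ℂ) ≠ 0 := by split_ifs <;> norm_num
  exact neg_eq_zero.mp ((smul_eq_zero.mp h3).resolve_left h4)

lemma IsColumn.act (hY : IsColumnLike Y) {s : Fin N} {v : V} (hv : IsColumn Y s v)
    (l : ℤ) (r : Fin N) (g : ℂ[X]) : IsColumn Y r (Y (DiffOp.elem l r s g) v) := by
  intro t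
  rw [hY.unit_act, hv t]
  rcases eq_or_ne t s with rfl | h1 <;> rcases eq_or_ne t r with rfl | h2 <;> simp [*]

/-- On the column `u` the difference `Y a (Y b v) - Y (a b) v` is symmetric in `a` and `b`, and
it vanishes for elementary operators `a`, `b` that are not both in the corner `u`. -/
lemma IsColumn.elem_elem (hY : IsColumnLike Y) {u : Fin N} {v : V} (hv : IsColumn Y u v)
    (k l : ℤ) (p q r s : Fin N) (f g : ℂ[X]) :
    Y (DiffOp.elem k p q f) (Y (DiffOp.elem l r s g) v) =
      Y (DiffOp.elem k p q f * DiffOp.elem l r s g) v := by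
  have key : ∀ (k l : ℤ) (p q r s : Fin N) (f g : ℂ[X]), ¬(q = r ∧ s = u) →
      Y (DiffOp.elem k p q f) (Y (DiffOp.elem l r s g) v) =
        Y (DiffOp.elem k p q f * DiffOp.elem l r s g) v := by
    intro k l p q r s f g h
    rw [DiffOp.elem_mul_elem]
    rcases eq_or_ne u s with rfl | hus
    · have hqr : q ≠ r := fun h' => h ⟨h', rfl⟩
      rw [if_neg hqr, map_zero, LinearMap.zero_apply]
      exact (hv.act hY l r g).act_of_ne hY k p hqr.symm f
    · rw [hv.act_of_ne hY l r hus, map_zero]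
      split_ifs
      · rw [hv.act_of_ne hY _ _ hus]
      · rw [map_zero, LinearMap.zero_apply]
  by_cases h1 : q = r ∧ s = u
  · by_cases h2 : s = p ∧ q = u
    · obtain ⟨rfl, rfl⟩ := h1
      obtain ⟨rfl, rfl⟩ := h2
      rw [hY.act_act _ v (by rw [hv, if_pos rfl]), DiffOp.elem_mul_elem, if_pos rfl]
    · have h3 := hY.comm (DiffOp.elem k p q f) (DiffOp.elem l r s g) v
      rw [key l k r s p q g f h2, map_sub, LinearMap.sub_apply] at h3
      exact sub_left_injective h3
  · exact key k l p q r s f g h1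

lemma act_act_of_one_eq (hY : IsColumnLike Y) {v : V} (hv : Y 1 v = v) (a b : DiffOp N) :
    Y a (Y b v) = Y (a * b) v := by
  induction a using DiffOp.elem_induction with
  | hzero => simp
  | hadd a a' h h' => simp only [map_add, LinearMap.add_apply, add_mul, h, h']
  | helem k p q f =>
  induction b using DiffOp.elem_induction with
  | hzero => simp
  | hadd b b' h h' => simp only [map_add, LinearMap.add_apply, mul_add, h, h']
  | helem l r s g =>
  rw [← hv, one_apply]
  simp only [map_sum]
  exact Finset.sum_congr rfl fun u _ => (hY.isColumn_unit hv u).elem_elem hY k l p q r s f g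

lemma act_eq_zero_of_one_eq_zero (hY : IsColumnLike Y) {v : V} (hv : Y 1 v = 0) (a : DiffOp N) :
    Y a v = 0 := by
  have h0 : ∀ p, Y (DiffOp.elem 0 p p 1) v = 0 := by
    intro p
    rw [← hY.cube, ← hY.unit_one p v, hv, map_zero, map_zero]
  induction a using DiffOp.elem_induction with
  | hzero => simp
  | hadd a a' h h' => rw [map_add, LinearMap.add_apply, h, h', add_zero]
  | helem l r s g =>
  rcases eq_or_ne r s with rfl | hrs
  · exact hY.act_eq_zero r v (h0 r) l g
  set w := Y (DiffOp.elem l r s g) v with hw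
  have h1 : Y (DiffOp.elem 0 s s 1) w = -w := by
    rw [hw, hY.unit_act, h0, map_zero, zero_add, if_neg hrs.symm, if_pos rfl, zero_sub,
      neg_one_smul]
  have h2 : Y (DiffOp.elem 0 r r 1) w = w := by
    rw [hw, hY.unit_act, h0, map_zero, zero_add, if_neg hrs, if_pos rfl, sub_zero, one_smul]
  have h3 := hY.mul_eq_zero s r hrs.symm w
  rwa [h2, h1, neg_eq_zero] at h3

/-- If all components have dimension at most one and `1` has a nonzero fixed vector, then `1` acts
by the identity. -/
lemma one_eq_one (hY : IsColumnLike Y) {𝒱 : ℤ → Submodule ℂ V} {s : ℤ} (hs : s = 1 ∨ s = -1)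
    (hN : 1 ≤ N) (h𝒱 : DirectSum.IsInternal 𝒱) (hgr : IsElemGraded Y 𝒱 s)
    (hfin : ∀ j, FiniteDimensional ℂ (𝒱 j)) (hone : ∀ j, Module.finrank ℂ (𝒱 j) ≤ 1)
    {j : ℤ} {v : V} (hvj : v ∈ 𝒱 j) (hv0 : v ≠ 0) (hv : Y 1 v = v) (x : V) : Y 1 x = x := by
  obtain ⟨p, hp⟩ : ∃ p, Y (DiffOp.elem 0 p p 1) v ≠ 0 := by
    by_contra! h
    exact hv0 (by rw [← hv, one_apply]; exact Finset.sum_eq_zero fun p _ => h p)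
  have key : Y 1 = 1 := by
    refine eq_of_eq_on_components h𝒱 fun d x hx => ?_
    obtain ⟨k, q, hkq⟩ := exists_elem_degree hN hs (j - d) p
    set w := Y (DiffOp.elem (-k) q p 1) v with hw
    have hwd : w ∈ 𝒱 d := by
      have := hgr (-k) q p 1 j v hvj
      rwa [show j + (-k * N + s * ((q : ℤ) - (p : ℤ))) = d by linear_combination -hkq] at this
    have hw0 : w ≠ 0 := by
      intro h
      apply hp
      have := hY.act_act_of_one_eq hv (DiffOp.elem k p q 1) (DiffOp.elem (-k) q p 1)
      rw [← hw, h, map_zero, DiffOp.elem_mul_elem, if_pos rfl, add_neg_cancel, map_one,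
        one_mul] at this
      exact this.symm
    have hw1 : Y 1 w = w := by rw [hw, hY.one_comm, hv]
    have := hfin d
    obtain ⟨c, hc⟩ := (finrank_le_one_iff.mp (hone d))
    obtain ⟨a, ha⟩ := hc ⟨w, hwd⟩
    obtain ⟨b, hb⟩ := hc ⟨x, hx⟩
    have ha' : a • (c : V) = w := congrArg Subtype.val ha
    have hb' : b • (c : V) = x := congrArg Subtype.val hb
    have ha0 : a ≠ 0 := by rintro rfl; exact hw0 (by rw [← ha', zero_smul])
    have hx' : x = (b / a) • w := by
      rw [← ha', ← hb', smul_smul, div_mul_cancel₀ _ ha0]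
    rw [hx', map_smul, hw1, Module.End.one_apply]
  rw [key, Module.End.one_apply]

/-- The algebra homomorphism given by a column-like representation in which `1` acts by the
identity. -/
def toAlgHom (hY : IsColumnLike Y) (h1 : ∀ v, Y 1 v = v) : DiffOp N →ₐ[ℂ] Module.End ℂ V :=
  AlgHom.ofLinearMap Y (LinearMap.ext h1) fun a b =>
    LinearMap.ext fun v => (hY.act_act_of_one_eq (h1 v) a b).symm

end IsColumnLike

/-! ### The twist by the automorphism `σ` -/

lemma reflect_reflect (i : ℤ) (F : Coeff N) : reflect N i (reflect N i F) = F := by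
  ext1 p q
  rw [reflect_apply, reflect_apply, comp_assoc]
  simp

lemma sigma_sigma (a : DiffOp N) : sigma N (sigma N a) = a := by
  induction a using DiffOp.ind with
  | hadd a b h h' => rw [map_add, map_add, h, h']
  | hmono i F => simp [sigma, reflect_reflect]

lemma sigma_elem (k : ℤ) (p q : Fin N) (f : ℂ[X]) :
    sigma N (DiffOp.elem k p q f) = -DiffOp.elem k q p (ScalarAction.flip k f) := by
  rw [DiffOp.elem_apply, sigma, DiffOp.lift_mono, LinearMap.neg_apply, LinearMap.comp_apply,
    DiffOp.elem_apply]
  congr 2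
  ext1 r s
  rw [reflect_apply, ScalarAction.flip_apply]
  by_cases h : p = s ∧ q = r
  · simp [h.1, h.2]
  · rw [Matrix.single_apply_of_ne _ _ _ _ _ h, Matrix.single_apply_of_ne _ _ _ _ _
      (fun h' => h h'.symm), zero_comp]

lemma sigma_one : sigma N 1 = -1 := by
  rw [DiffOp.one_eq_sum, map_sum, ← Finset.sum_neg_distrib]
  exact Finset.sum_congr rfl fun p _ => by rw [sigma_elem, map_one]

end Columns

section HatModule

variable {N : ℕ} {V : Type*} [AddCommGroup V] [Module ℂ V] [LieRingModule (HatD N) V]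
  [LieModule ℂ (HatD N) V] {𝒱 : ℤ → Submodule ℂ V}

lemma IsUniformlyBounded.isColumnLike (h : IsUniformlyBounded N 𝒱) (hN : 1 ≤ N) :
    IsColumnLike (opAct N V) where
  comm a b v := by rw [opAct_comm, h.lie_central hN, smul_zero, add_zero]
  cube p := (h.isTame_cornerAction p).cube
  mul_eq_zero p q hpq := h.corner_mul_corner hpq
  act_act p := (h.isTame_cornerAction p).act_act
  act_eq_zero p := (h.isTame_cornerAction p).act_eq_zero

lemma opAct_sigma_elem (k : ℤ) (p : Fin N) (f : ℂ[X]) :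
    (opAct N V ∘ₗ sigma N) (DiffOp.elem k p p f) = (cornerAction V p).twist.act k f := by
  rw [LinearMap.comp_apply, sigma_elem, map_neg]
  rfl

lemma IsUniformlyBounded.isColumnLike_sigma (h : IsUniformlyBounded N 𝒱) (hN : 1 ≤ N) :
    IsColumnLike (opAct N V ∘ₗ sigma N) where
  comm a b v := by
    rw [LinearMap.comp_apply, LinearMap.comp_apply, LinearMap.comp_apply,
      (h.isColumnLike hN).comm, map_sub (sigma N), sigma_mul, sigma_mul]
    congr 2
    abel
  cube p := by
    simp only [opAct_sigma_elem]
    exact (h.isTame_twist_cornerAction p).cube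
  mul_eq_zero p q hpq v := by
    simp only [LinearMap.comp_apply, sigma_elem, map_one, map_neg, LinearMap.neg_apply, neg_neg]
    exact h.corner_mul_corner hpq v
  act_act p := by
    simp only [opAct_sigma_elem]
    exact (h.isTame_twist_cornerAction p).act_act
  act_eq_zero p := by
    simp only [opAct_sigma_elem]
    exact (h.isTame_twist_cornerAction p).act_eq_zero

lemma IsQuasifinite.opAct_sigma_mem (h : IsQuasifinite N 𝒱) :
    IsElemGraded (opAct N V ∘ₗ sigma N) 𝒱 (-1) := by
  intro k p q f j v hv
  have := h.opAct_mem k q p (ScalarAction.flip k f) j v hv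
  rw [LinearMap.comp_apply, sigma_elem, map_neg, LinearMap.neg_apply]
  rw [show j + (k * N + -1 * ((p : ℤ) - (q : ℤ))) = j + (k * N + 1 * ((q : ℤ) - (p : ℤ))) by ring]
  exact neg_mem this

end HatModule

/-! ### Invariant subspaces of unital modules over the associative algebra -/

section Associative

variable {N : ℕ} {V : Type*} [AddCommGroup V] [Module ℂ V]
  {W : Type*} [AddCommGroup W] [Module ℂ W]

/-- For a subspace `p` of `W`, the vectors of `V(W, α)` with all coefficients in `ℂ^N ⊗ p`. -/
def NatMod.sub (N : ℕ) (α : Module.End ℂ W) (p : Submodule ℂ W) :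
    Submodule ℂ (NatMod N α) where
  carrier := {x | ∀ k i, (show ℤ →₀ (Fin N → W) from x) k i ∈ p}
  add_mem' ha hb k i := p.add_mem (ha k i) (hb k i)
  zero_mem' _ _ := p.zero_mem
  smul_mem' c _ ha k i := p.smul_mem c (ha k i)

lemma NatMod.mem_sub {α : Module.End ℂ W} {p : Submodule ℂ W} {x : NatMod N α} :
    x ∈ NatMod.sub N α p ↔ ∀ k i, (show ℤ →₀ (Fin N → W) from x) k i ∈ p := Iff.rfl

lemma NatMod.vec_mem_sub {α : Module.End ℂ W} {p : Submodule ℂ W} {k : ℤ} {w : Fin N → W} :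
    NatMod.vec α k w ∈ NatMod.sub N α p ↔ ∀ i, w i ∈ p := by
  rw [NatMod.mem_sub]
  have h : ∀ l, (show ℤ →₀ (Fin N → W) from NatMod.vec α k w) l = if k = l then w else 0 :=
    fun l => Finsupp.single_apply
  refine ⟨fun H i => ?_, fun H l i => ?_⟩
  · have := H k i
    rwa [h, if_pos rfl] at this
  · rw [h]
    split_ifs
    · exact H i
    · exact p.zero_mem

lemma NatMod.mem_of_vec_mem {α : Module.End ℂ W} {p : Submodule ℂ W} {x : NatMod N α}
    (hx : x ∈ NatMod.sub N α p) {P : Submodule ℂ (NatMod N α)}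
    (hP : ∀ k w, (∀ i, w i ∈ p) → NatMod.vec α k w ∈ P) : x ∈ P := by
  have h : (show ℤ →₀ (Fin N → W) from x).sum (fun k w => NatMod.vec α k w) = x :=
    Finsupp.sum_single (show ℤ →₀ (Fin N → W) from x)
  rw [← h]
  exact Submodule.sum_mem _ fun k _ => hP k _ (hx k)

lemma NatMod.act_mem_sub {α : Module.End ℂ W} {p : Submodule ℂ W} (hp : p ∈ α.invtSubmodule)
    (a : DiffOp N) {x : NatMod N α} (hx : x ∈ NatMod.sub N α p) :
    NatMod.act α a x ∈ NatMod.sub N α p := by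
  refine NatMod.mem_of_vec_mem hx (P := (NatMod.sub N α p).comap (NatMod.act α a)) fun k w hw => ?_
  rw [Submodule.mem_comap]
  induction a using DiffOp.ind with
  | hadd a b h h' => rw [map_add]; exact add_mem h h'
  | hmono i F =>
    rw [NatMod.act_mono_vec, NatMod.vec_mem_sub]
    intro r
    rw [coeffAct_apply]
    refine p.sum_mem fun q _ => ?_
    have hinv : ∀ u ∈ p, (algebraMap ℂ (Module.End ℂ W) k + α) u ∈ p := fun u hu =>
      add_mem (p.smul_mem _ hu) (hp hu)
    have hpol : ∀ (f : ℂ[X]), ∀ u ∈ p, aeval (algebraMap ℂ (Module.End ℂ W) k + α) f u ∈ p := by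
      intro f
      induction f using Polynomial.induction_on with
      | C c => intro u hu; rw [aeval_C]; exact p.smul_mem c hu
      | add f g hf hg => intro u hu; rw [map_add]; exact add_mem (hf u hu) (hg u hu)
      | monomial n c ih =>
        intro u hu
        rw [pow_succ, ← mul_assoc, map_mul, aeval_X, Module.End.mul_apply]
        exact ih _ (hinv u hu)
    exact hpol _ _ (hw q)

lemma NatMod.isCompl_sub {α : Module.End ℂ W} {p q : Submodule ℂ W} (h : IsCompl p q) :
    IsCompl (NatMod.sub N α p) (NatMod.sub N α q) := by
  constructor
  · rw [Submodule.disjoint_def]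
    intro x hx hy
    exact Finsupp.ext fun k => funext fun i =>
      Submodule.disjoint_def.mp h.disjoint _ (hx k i) (hy k i)
  · rw [codisjoint_iff, eq_top_iff]
    intro x _
    induction x using NatMod.ind with
    | hadd v w hv hw => exact add_mem (hv trivial) (hw trivial)
    | hvec k w =>
      choose a b ha hb hab using fun i =>
        Submodule.codisjoint_iff_exists_add_eq.mp h.codisjoint (w i)
      rw [← (funext hab : (fun i => a i + b i) = w),
        show (fun i => a i + b i) = a + b from rfl, map_add]
      exact Submodule.add_mem_sup (NatMod.vec_mem_sub.mpr ha) (NatMod.vec_mem_sub.mpr hb)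

variable {ρ : DiffOp N →ₐ[ℂ] Module.End ℂ V} {𝒱 : ℤ → Submodule ℂ V} {s : ℤ} {j₀ : ℤ}

lemma map_scalar_mem (hgr : IsElemGraded ρ.toLinearMap 𝒱 s) (f : ℂ[X]) {j : ℤ} {v : V}
    (hv : v ∈ 𝒱 j) : ρ (DiffOp.mono 0 (Matrix.scalar (Fin N) f)) v ∈ 𝒱 j := by
  rw [DiffOp.mono_eq_sum]
  simp only [map_sum, LinearMap.sum_apply]
  refine Submodule.sum_mem _ fun p _ => Submodule.sum_mem _ fun q _ => ?_
  rcases eq_or_ne p q with rfl | h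
  · have := hgr 0 p p (Matrix.scalar (Fin N) f p p) j v hv
    rwa [show j + (0 * N + s * ((p : ℤ) - (p : ℤ))) = j by ring] at this
  · rw [Matrix.scalar_apply, Matrix.diagonal_apply_ne _ h, map_zero, map_zero]
    exact zero_mem _

/-- A linear map preserving the range of an injective map `θ` induces an endomorphism of the
source of `θ`. -/
lemma exists_end_of_range {θ : W →ₗ[ℂ] V} (hθ : Function.Injective θ) (D : Module.End ℂ V)
    (hD : ∀ w, D (θ w) ∈ LinearMap.range θ) : ∃ α : Module.End ℂ W, ∀ w, θ (α w) = D (θ w) := by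
  let e := LinearEquiv.ofInjective θ hθ
  refine ⟨e.symm.toLinearMap ∘ₗ (D ∘ₗ θ).codRestrict _ hD, fun w => ?_⟩
  have h : e (e.symm ((D ∘ₗ θ).codRestrict _ hD w)) = (D ∘ₗ θ).codRestrict _ hD w :=
    e.apply_symm_apply _
  exact congrArg Subtype.val h

variable {θ : W →ₗ[ℂ] V} {α : Module.End ℂ W}

/-- A unital graded module over the associative algebra is isomorphic to some `V(W, α)`, for any
space `W` mapped isomorphically to one of its components. -/
lemma exists_natMod_equiv (hN : 1 ≤ N) (hs : s = 1 ∨ s = -1) (h𝒱 : DirectSum.IsInternal 𝒱)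
    (hgr : IsElemGraded ρ.toLinearMap 𝒱 s) (hθi : Function.Injective θ)
    (hθr : LinearMap.range θ = 𝒱 j₀) :
    ∃ (α : Module.End ℂ W) (Φ : NatMod N α ≃ₗ[ℂ] V), ∀ a x, Φ (NatMod.act α a x) = ρ a (Φ x) := by
  obtain ⟨α, hα⟩ := exists_end_of_range hθi (ρ (DiffOp.mono 0 (Matrix.scalar (Fin N) X)))
    fun w => by
      rw [hθr]
      exact map_scalar_mem hgr X (hθr ▸ LinearMap.mem_range_self θ w)
  exact ⟨α, LinearEquiv.ofBijective _ (natModMap_bijective (α := α) hN hs h𝒱 hgr hθi hθr),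
    fun a x => natModMap_act hα a x⟩

lemma natMod_subsingleton [Subsingleton W] : Subsingleton (NatMod N α) :=
  inferInstanceAs (Subsingleton (ℤ →₀ (Fin N → W)))

lemma map_sub_mem (Φ : NatMod N α ≃ₗ[ℂ] V) (hΦ : ∀ a x, Φ (NatMod.act α a x) = ρ a (Φ x))
    {p : Submodule ℂ W} (hp : p ∈ α.invtSubmodule) (a : DiffOp N) {v : V}
    (hv : v ∈ (NatMod.sub N α p).map Φ.toLinearMap) :
    ρ a v ∈ (NatMod.sub N α p).map Φ.toLinearMap := by
  obtain ⟨x, hx, rfl⟩ := hv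
  exact ⟨_, NatMod.act_mem_sub hp a hx, hΦ a x⟩

lemma eq_bot_of_map_sub (hN : 1 ≤ N) (Φ : NatMod N α ≃ₗ[ℂ] V) {p : Submodule ℂ W}
    (h : (NatMod.sub N α p).map Φ.toLinearMap = ⊥) : p = ⊥ := by
  rw [eq_bot_iff]
  intro w hw
  have h1 : Φ (NatMod.vec α 0 fun _ => w) ∈ (NatMod.sub N α p).map Φ.toLinearMap :=
    ⟨_, NatMod.vec_mem_sub.mpr fun _ => hw, rfl⟩
  rw [h, Submodule.mem_bot, map_eq_zero_iff Φ Φ.injective] at h1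
  have h2 : (fun _ => w : Fin N → W) = 0 := Finsupp.single_eq_zero.mp h1
  exact congrFun h2 ⟨0, hN⟩

lemma eq_top_of_map_sub (hN : 1 ≤ N) (Φ : NatMod N α ≃ₗ[ℂ] V) {p : Submodule ℂ W}
    (h : (NatMod.sub N α p).map Φ.toLinearMap = ⊤) : p = ⊤ := by
  rw [eq_top_iff]
  intro w _
  have h1 : Φ (NatMod.vec α 0 (fun _ => w)) ∈ (NatMod.sub N α p).map Φ.toLinearMap :=
    h ▸ Submodule.mem_top
  obtain ⟨x, hx, hxw⟩ := h1
  rw [Φ.injective hxw] at hx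
  exact NatMod.vec_mem_sub.mp hx ⟨0, hN⟩

/-- If `V(W, α)` is isomorphic to a module that is not a direct sum of two nonzero submodules, then
`α` is indecomposable. -/
lemma isIndecomposableEnd (hN : 1 ≤ N) [Nontrivial V] (Φ : NatMod N α ≃ₗ[ℂ] V)
    (hΦ : ∀ a x, Φ (NatMod.act α a x) = ρ a (Φ x))
    (hV : ∀ P Q : Submodule ℂ V, (∀ a, ∀ v ∈ P, ρ a v ∈ P) → (∀ a, ∀ v ∈ Q, ρ a v ∈ Q) →
      IsCompl P Q → P = ⊥ ∨ Q = ⊥) : IsIndecomposableEnd α := by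
  constructor
  · by_contra h
    rw [not_nontrivial_iff_subsingleton] at h
    have := natMod_subsingleton (N := N) (α := α)
    exact not_subsingleton V Φ.symm.injective.subsingleton
  · intro p q hp hq hpq
    have h1 : IsCompl ((NatMod.sub N α p).map Φ.toLinearMap)
        ((NatMod.sub N α q).map Φ.toLinearMap) :=
      (Submodule.orderIsoMapComap Φ).isCompl (NatMod.isCompl_sub hpq)
    exact (hV _ _ (fun a v hv => map_sub_mem Φ hΦ hp a hv) (fun a v hv => map_sub_mem Φ hΦ hq a hv)
      h1).imp (eq_bot_of_map_sub hN Φ) (eq_bot_of_map_sub hN Φ)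

/-- The components of an irreducible unital graded module have dimension at most one. -/
lemma finrank_le_one_of_irreducible (hN : 1 ≤ N) (hs : s = 1 ∨ s = -1)
    (h𝒱 : DirectSum.IsInternal 𝒱) (hgr : IsElemGraded ρ.toLinearMap 𝒱 s)
    (hfin : ∀ j, FiniteDimensional ℂ (𝒱 j))
    (hV : ∀ P : Submodule ℂ V, (∀ a, ∀ v ∈ P, ρ a v ∈ P) → P = ⊥ ∨ P = ⊤) (j : ℤ) :
    Module.finrank ℂ (𝒱 j) ≤ 1 := by
  obtain ⟨α, Φ, hΦ⟩ := exists_natMod_equiv (θ := (𝒱 j).subtype) hN hs h𝒱 hgr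
    (𝒱 j).injective_subtype (𝒱 j).range_subtype
  have := hfin j
  rcases subsingleton_or_nontrivial (𝒱 j) with h | h
  · rw [Module.finrank_zero_of_subsingleton]; exact zero_le_one
  obtain ⟨c, hc⟩ := Module.End.exists_eigenvalue α
  obtain ⟨w, hw⟩ := hc.exists_hasEigenvector
  have hinv : Submodule.span ℂ {w} ∈ α.invtSubmodule := by
    rw [Module.End.mem_invtSubmodule, Submodule.span_singleton_le_iff_mem, Submodule.mem_comap,
      hw.apply_eq_smul]
    exact Submodule.smul_mem _ _ (Submodule.mem_span_singleton_self w)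
  have h1 : Submodule.span ℂ {w} = ⊤ := by
    refine eq_top_of_map_sub hN Φ
      ((hV _ fun a v hv => map_sub_mem Φ hΦ hinv a hv).resolve_left fun h0 => hw.2 ?_)
    exact Submodule.span_singleton_eq_bot.mp (eq_bot_of_map_sub hN Φ h0)
  rw [← finrank_top, ← h1]
  exact (finrank_span_le_card {w}).trans (by simp)

end Associative

/-! ### Bounded modules over the central extension -/

section HatModule

variable {N : ℕ} {V : Type*} [AddCommGroup V] [Module ℂ V] [LieRingModule (HatD N) V]
  {𝒱 : ℤ → Submodule ℂ V}

variable (N) in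
/-- The action of the central extension on the graded space `V` comes from a unital action of the
associative algebra, either directly or after the twist by `σ`. -/
def IsAssociative (𝒱 : ℤ → Submodule ℂ V) : Prop :=
  ∃ ρ : DiffOp N →ₐ[ℂ] Module.End ℂ V,
    (IsElemGraded ρ.toLinearMap 𝒱 1 ∧ ∀ (x : HatD N) (v : V), ⁅x, v⁆ = ρ (HatD.toOp x) v) ∨
    (IsElemGraded ρ.toLinearMap 𝒱 (-1) ∧
      ∀ (x : HatD N) (v : V), ⁅x, v⁆ = ρ (sigma N (HatD.toOp x)) v)

/-- The kernel of an endomorphism commuting with the action, as a submodule. -/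
def kerLieSubmodule (φ : Module.End ℂ V) (hφ : ∀ (x : HatD N) v, φ ⁅x, v⁆ = ⁅x, φ v⁆) :
    LieSubmodule ℂ (HatD N) V where
  toSubmodule := LinearMap.ker φ
  lie_mem {x v} hv := by
    have hv' : φ v = 0 := hv
    change φ ⁅x, v⁆ = 0
    rw [hφ, hv', lie_zero]

/-- In an indecomposable module a central operator `S` with `S³ = S` is the identity or has no
nonzero fixed vector. -/
lemma IsIndecomposable.eq_one_or (hV : IsIndecomposable N V) (S : Module.End ℂ V)
    (hS : ∀ (x : HatD N) v, S ⁅x, v⁆ = ⁅x, S v⁆) (hS3 : ∀ v, S (S (S v)) = S v) :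
    (∀ v, S v = v) ∨ ∀ v, S v = v → v = 0 := by
  set P := kerLieSubmodule (S - 1) (fun x v => by
    rw [LinearMap.sub_apply, LinearMap.sub_apply, hS, lie_sub]; rfl) with hP
  set Q := kerLieSubmodule (N := N) (S * S + S) (fun x v => by
    simp only [LinearMap.add_apply, Module.End.mul_apply, hS, lie_add]) with hQ
  have hPm : ∀ v, v ∈ P.toSubmodule ↔ S v = v := fun v => by
    change (S - 1) v = 0 ↔ _
    rw [LinearMap.sub_apply, sub_eq_zero, Module.End.one_apply]
  have hQm : ∀ v, v ∈ Q.toSubmodule ↔ S (S v) + S v = 0 := fun v => Iff.rfl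
  have hPQ : IsCompl P Q := by
    rw [← LieSubmodule.isCompl_toSubmodule]
    constructor
    · rw [Submodule.disjoint_def]
      intro v hv hv'
      rw [hPm] at hv
      rw [hQm, hv, hv, ← two_smul ℂ] at hv'
      exact (smul_eq_zero.mp hv').resolve_left two_ne_zero
    · rw [Submodule.codisjoint_iff_exists_add_eq]
      intro v
      refine ⟨(1 / 2 : ℂ) • (S (S v) + S v), v - (1 / 2 : ℂ) • (S (S v) + S v), ?_, ?_,
        add_sub_cancel _ _⟩
      · rw [hPm, map_smul, map_add, hS3, add_comm]
      · rw [hQm]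
        simp only [map_sub, map_smul, map_add, hS3]
        module
  rcases hV.2 P Q hPQ with h | h
  · right
    intro v hv
    have : v ∈ P.toSubmodule := (hPm v).mpr hv
    rw [h] at this
    exact this
  · left
    intro v
    have : v ∈ P := by
      rw [h] at hPQ
      rw [eq_top_of_isCompl_bot hPQ]
      exact LieSubmodule.mem_top v
    exact (hPm v).mp this

lemma IsIntermediateSeries.isUniformlyBounded (h : IsIntermediateSeries N 𝒱) :
    IsUniformlyBounded N 𝒱 :=
  { h.toIsQuasifinite with bounded := ⟨1, one_pos, h.finrank_le_one⟩ }

lemma IsAssociative.exists_equiv (h : IsAssociative N 𝒱) (hN : 1 ≤ N)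
    (h𝒱 : DirectSum.IsInternal 𝒱) {W : Type*} [AddCommGroup W] [Module ℂ W] {θ : W →ₗ[ℂ] V}
    {j₀ : ℤ} (hθi : Function.Injective θ) (hθr : LinearMap.range θ = 𝒱 j₀) :
    ∃ α : Module.End ℂ W, (Nonempty (V ≃ₗ⁅ℂ, HatD N⁆ NatMod N α) ∨
      Nonempty (V ≃ₗ⁅ℂ, HatD N⁆ TwistMod N α)) ∧
        (IsIndecomposable N V → IsIndecomposableEnd α) := by
  obtain ⟨ρ, ⟨hgr, hρ⟩ | ⟨hgr, hρ⟩⟩ := h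
  · obtain ⟨α, Φ, hΦ⟩ := exists_natMod_equiv hN (Or.inl rfl) h𝒱 hgr hθi hθr
    let e : NatMod N α ≃ₗ⁅ℂ, HatD N⁆ V :=
      { Φ with map_lie' := fun {x w} => (hΦ (HatD.toOp x) w).trans (hρ x _).symm }
    refine ⟨α, Or.inl ⟨e.symm⟩, fun hV => ?_⟩
    have := hV.1
    refine isIndecomposableEnd hN Φ hΦ fun P Q hP hQ hPQ => ?_
    let P' : LieSubmodule ℂ (HatD N) V :=
      { P with lie_mem := fun {x v} hv => by rw [hρ]; exact hP _ v hv }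
    let Q' : LieSubmodule ℂ (HatD N) V :=
      { Q with lie_mem := fun {x v} hv => by rw [hρ]; exact hQ _ v hv }
    have hPQ' : IsCompl P' Q' := (LieSubmodule.isCompl_toSubmodule).mp hPQ
    exact (hV.2 P' Q' hPQ').imp (congrArg LieSubmodule.toSubmodule)
      (congrArg LieSubmodule.toSubmodule)
  · obtain ⟨α, Φ, hΦ⟩ := exists_natMod_equiv hN (Or.inr rfl) h𝒱 hgr hθi hθr
    let e : TwistMod N α ≃ₗ⁅ℂ, HatD N⁆ V :=
      { (TwistMod.of α).symm.trans Φ with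
        map_lie' := fun {x w} => (hΦ (sigma N (HatD.toOp x)) w).trans (hρ x _).symm }
    refine ⟨α, Or.inr ⟨e.symm⟩, fun hV => ?_⟩
    have := hV.1
    refine isIndecomposableEnd hN Φ hΦ fun P Q hP hQ hPQ => ?_
    let P' : LieSubmodule ℂ (HatD N) V :=
      { P with lie_mem := fun {x v} hv => by rw [hρ]; exact hP _ v hv }
    let Q' : LieSubmodule ℂ (HatD N) V :=
      { Q with lie_mem := fun {x v} hv => by rw [hρ]; exact hQ _ v hv }
    have hPQ' : IsCompl P' Q' := (LieSubmodule.isCompl_toSubmodule).mp hPQ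
    exact (hV.2 P' Q' hPQ').imp (congrArg LieSubmodule.toSubmodule)
      (congrArg LieSubmodule.toSubmodule)

variable [LieModule ℂ (HatD N) V]

lemma IsUniformlyBounded.lie_eq (h : IsUniformlyBounded N 𝒱) (hN : 1 ≤ N) (x : HatD N) (v : V) :
    ⁅x, v⁆ = opAct N V (HatD.toOp x) v := by
  conv_lhs => rw [HatD.eq_ofOp_add x]
  rw [add_lie, smul_lie, h.lie_central hN, smul_zero, add_zero, opAct_apply]

lemma IsUniformlyBounded.isAssociative_of_one (h : IsUniformlyBounded N 𝒱) (hN : 1 ≤ N)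
    (h1 : (∀ v, opAct N V 1 v = v) ∨ ∀ v, (opAct N V ∘ₗ sigma N) 1 v = v) :
    IsAssociative N 𝒱 := by
  rcases h1 with h1 | h1
  · exact ⟨(h.isColumnLike hN).toAlgHom h1, Or.inl ⟨h.toIsQuasifinite.opAct_mem,
      h.lie_eq hN⟩⟩
  · refine ⟨(h.isColumnLike_sigma hN).toAlgHom h1, Or.inr ⟨h.toIsQuasifinite.opAct_sigma_mem,
      fun x v => ?_⟩⟩
    rw [h.lie_eq hN]
    change _ = opAct N V (sigma N (sigma N (HatD.toOp x))) v
    rw [sigma_sigma]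

/-- If neither `1` nor `σ(1)` fixes a nonzero homogeneous vector, the action is trivial: the
operator `1` has no eigenvalues `1` and `-1`, and so it acts by zero. -/
lemma IsUniformlyBounded.isTrivial_of (h : IsUniformlyBounded N 𝒱) (hN : 1 ≤ N)
    (h1 : ∀ j, ∀ v ∈ 𝒱 j, opAct N V 1 v = v → v = 0)
    (h2 : ∀ j, ∀ v ∈ 𝒱 j, (opAct N V ∘ₗ sigma N) 1 v = v → v = 0) :
    LieModule.IsTrivial (HatD N) V := by
  have hX := h.isColumnLike hN
  have hmem : ∀ j, ∀ v ∈ 𝒱 j, opAct N V 1 v ∈ 𝒱 j := by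
    intro j v hv
    rw [DiffOp.one_eq_sum, map_sum, LinearMap.sum_apply]
    refine Submodule.sum_mem _ fun p _ => ?_
    have := h.toIsQuasifinite.opAct_mem 0 p p 1 j v hv
    rwa [show j + (0 * N + 1 * ((p : ℤ) - (p : ℤ))) = j by ring] at this
  have h0 : opAct N V 1 = 0 := by
    refine eq_of_eq_on_components h.isInternal fun j v hv => ?_
    have e1 := h1 j (opAct N V 1 (opAct N V 1 v) + opAct N V 1 v)
      (add_mem (hmem j _ (hmem j _ hv)) (hmem j _ hv)) (by
        rw [map_add, hX.one_cube, add_comm])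
    have e2 := h2 j (opAct N V 1 (opAct N V 1 v) - opAct N V 1 v)
      (sub_mem (hmem j _ (hmem j _ hv)) (hmem j _ hv)) (by
        rw [LinearMap.comp_apply, sigma_one, map_neg, LinearMap.neg_apply, map_sub, hX.one_cube,
          neg_sub])
    have e3 : (2 : ℂ) • opAct N V 1 v = 0 := by linear_combination (norm := module) e1 - e2
    exact (smul_eq_zero.mp e3).resolve_left two_ne_zero
  refine ⟨fun x v => ?_⟩
  rw [h.lie_eq hN]
  exact hX.act_eq_zero_of_one_eq_zero (by rw [h0, LinearMap.zero_apply]) _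

lemma IsUniformlyBounded.isAssociative_of_isIndecomposable (h : IsUniformlyBounded N 𝒱)
    (hN : 1 ≤ N) (hV : IsIndecomposable N V) (hnt : ¬LieModule.IsTrivial (HatD N) V) :
    IsAssociative N 𝒱 := by
  refine h.isAssociative_of_one hN ?_
  have hX := h.isColumnLike hN
  have hY := h.isColumnLike_sigma hN
  have e1 := hV.eq_one_or (opAct N V 1) (fun x v => by
    rw [h.lie_eq hN, h.lie_eq hN, hX.one_comm]) hX.one_cube
  have e2 := hV.eq_one_or ((opAct N V ∘ₗ sigma N) 1) (fun x v => by
    rw [h.lie_eq hN, h.lie_eq hN, LinearMap.comp_apply, sigma_one, map_neg, LinearMap.neg_apply,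
      LinearMap.neg_apply, map_neg, hX.one_comm]) hY.one_cube
  by_contra! hcon
  have e1' := e1.resolve_left fun H => hcon.1.elim fun v hv => hv (H v)
  have e2' := e2.resolve_left fun H => hcon.2.elim fun v hv => hv (H v)
  exact hnt (h.isTrivial_of hN (fun j v _ => e1' v) (fun j v _ => e2' v))

lemma IsIntermediateSeries.isAssociative (h : IsIntermediateSeries N 𝒱)
    (hN : 1 ≤ N) (hnt : ¬LieModule.IsTrivial (HatD N) V) : IsAssociative N 𝒱 := by
  have hb := h.isUniformlyBounded
  refine hb.isAssociative_of_one hN ?_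
  by_contra! hcon
  obtain ⟨⟨v, hv⟩, w, hw⟩ := hcon
  refine hnt (hb.isTrivial_of hN (fun j u hu hu1 => ?_) (fun j u hu hu1 => ?_))
  · by_contra hu0
    exact hv ((hb.isColumnLike hN).one_eq_one (Or.inl rfl) hN h.isInternal h.opAct_mem h.finite
      h.finrank_le_one hu hu0 hu1 v)
  · by_contra hu0
    exact hw ((hb.isColumnLike_sigma hN).one_eq_one (Or.inr rfl) hN h.isInternal
      h.opAct_sigma_mem h.finite h.finrank_le_one hu hu0 hu1 w)

end HatModule

/-! ### Polynomials annihilating a vector -/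

lemma mem_degreeLT_iff {n : ℕ} {f : ℂ[X]} : f ∈ degreeLT ℂ n ↔ ∀ m, n ≤ m → f.coeff m = 0 := by
  rw [mem_degreeLT, degree_lt_iff_coeff_zero]

lemma X_pow_mem_degreeLT {n i : ℕ} (h : i < n) : (X ^ i : ℂ[X]) ∈ degreeLT ℂ n := by
  rw [mem_degreeLT_iff]
  intro m hm
  rw [coeff_X_pow, if_neg (by omega)]

lemma degreeLT_succ_le {Z : Submodule ℂ ℂ[X]} {n : ℕ} (hZ : degreeLT ℂ n ≤ Z) {g : ℂ[X]}
    (hg : g ∈ Z) (hg0 : g.coeff n ≠ 0) (hgn : ∀ m, n < m → g.coeff m = 0) :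
    degreeLT ℂ (n + 1) ≤ Z := by
  intro f hf
  rw [mem_degreeLT_iff] at hf
  have h1 : f - (f.coeff n / g.coeff n) • g ∈ Z := by
    refine hZ (mem_degreeLT_iff.mpr fun m hm => ?_)
    rw [coeff_sub, coeff_smul, smul_eq_mul]
    rcases hm.eq_or_lt with rfl | hm
    · rw [div_mul_cancel₀ _ hg0, sub_self]
    · rw [hf m hm, hgn m hm, mul_zero, sub_zero]
  have h2 := Z.add_mem h1 (Z.smul_mem (f.coeff n / g.coeff n) hg)
  rwa [sub_add_cancel] at h2

lemma coeff_tau_X_pow_mul_X_pow (d : ℤ) (i j m : ℕ) :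
    (tau d (X ^ i) * X ^ j).coeff m =
      if j ≤ m then (d : ℂ) ^ (i - (m - j)) * (i.choose (m - j) : ℂ) else 0 := by
  rw [map_pow, tau_X, coeff_mul_X_pow', coeff_X_add_C_pow]

lemma coeff_tau_X_pow_top (d : ℤ) {i j n : ℕ} (h : i + j = n + 1) :
    (tau d (X ^ i) * X ^ j).coeff n = (i * d : ℂ) := by
  rw [coeff_tau_X_pow_mul_X_pow]
  rcases Nat.eq_zero_or_pos i with rfl | hi
  · rw [if_neg (by omega)]; simp
  · obtain ⟨i, rfl⟩ : ∃ i', i = i' + 1 := ⟨i - 1, by omega⟩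
    rw [if_pos (by omega), show n - j = i by omega, Nat.choose_succ_self_right]
    simp [mul_comm]

lemma coeff_tau_X_pow_of_lt (d : ℤ) {i j m : ℕ} (h : i + j ≤ m) :
    (tau d (X ^ i) * X ^ j).coeff m = if i + j = m then 1 else 0 := by
  rw [coeff_tau_X_pow_mul_X_pow, if_pos (by omega)]
  split_ifs with h1
  · rw [show m - j = i by omega]; simp
  · rw [Nat.choose_eq_zero_of_lt (by omega)]; simp

lemma mul_mem_degreeLT {n d : ℕ} {F G : ℂ[X]} (hF : F ∈ degreeLT ℂ n) (hG : G.natDegree ≤ d) :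
    F * G ∈ degreeLT ℂ (n + d) := by
  rw [mem_degreeLT_iff] at hF ⊢
  intro m hm
  rw [coeff_mul]
  refine Finset.sum_eq_zero fun x hx => ?_
  rw [Finset.HasAntidiagonal.mem_antidiagonal] at hx
  rcases le_or_gt n x.1 with h | h
  · rw [hF _ h, zero_mul]
  · rw [coeff_eq_zero_of_natDegree_lt (by omega : G.natDegree < x.2), mul_zero]

lemma tau_mem_degreeLT {n : ℕ} {F : ℂ[X]} (k : ℤ) (hF : F ∈ degreeLT ℂ n) :
    tau k F ∈ degreeLT ℂ n := by
  rw [mem_degreeLT] at hF ⊢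
  rwa [tau, taylorAlgHom_apply, degree_taylor]

lemma natDegree_tau (k : ℤ) (F : ℂ[X]) : (tau k F).natDegree = F.natDegree := by
  rw [tau, taylorAlgHom_apply, natDegree_taylor]

/-- All numbers `m ≥ a²` lie in the additive semigroup generated by `a` and `a + 1`. -/
lemma semigroup_cofinite {S : ℕ → Prop} (hS : ∀ b c, S b → S c → S (b + c)) {a : ℕ} (ha : 0 < a)
    (h0 : S a) (h1 : S (a + 1)) {m : ℕ} (hm : a * a ≤ m) : S m := by
  have hx : ∀ x, S ((x + 1) * a) := by
    intro x
    induction x with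
    | zero => simpa using h0
    | succ x ih => rw [add_mul, one_mul]; exact hS _ _ ih h0
  have hxy : ∀ y x, S ((x + 1) * a + y * (a + 1)) := by
    intro y x
    induction y with
    | zero => simpa using hx x
    | succ y ih => rw [add_mul y, one_mul, ← add_assoc]; exact hS _ _ ih h1
  have hr := Nat.mod_lt m ha
  have hq : a ≤ m / a := (Nat.le_div_iff_mul_le ha).mpr hm
  obtain ⟨x, hx'⟩ : ∃ x, m / a = x + 1 + m % a := ⟨m / a - 1 - m % a, by omega⟩
  have h := hxy (m % a) x
  have e := Nat.div_add_mod m a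
  have : (x + 1) * a + m % a * (a + 1) = m := by
    calc (x + 1) * a + m % a * (a + 1) = a * (x + 1 + m % a) + m % a := by ring
      _ = m := by rw [← hx', e]
  rwa [this] at h

section HatModule

variable {N : ℕ} {V : Type*} [AddCommGroup V] [Module ℂ V] [LieRingModule (HatD N) V]
  [LieModule ℂ (HatD N) V] {𝒱 : ℤ → Submodule ℂ V}

lemma opAct_elem_comm {k l : ℤ} (h : k + l ≠ 0 ∨ k = 0) (p q r s : Fin N) (f g : ℂ[X]) (v : V) :
    opAct N V (DiffOp.elem k p q f) (opAct N V (DiffOp.elem l r s g) v) =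
      opAct N V (DiffOp.elem l r s g) (opAct N V (DiffOp.elem k p q f) v) +
      (opAct N V (if q = r then DiffOp.elem (k + l) p s (tau l f * g) else 0) v -
        opAct N V (if s = p then DiffOp.elem (k + l) r q (tau k g * f) else 0) v) := by
  have h1 := opAct_comm (DiffOp.elem k p q f) (DiffOp.elem l r s g) v
  have h2 : DiffOp.cocycle (DiffOp.elem k p q f) (DiffOp.elem l r s g) = 0 := by
    rcases h with h | rfl
    · exact DiffOp.cocycle_elem_of_add_ne k l h p q r s f g
    · rw [DiffOp.elem_apply, DiffOp.elem_apply, DiffOp.cocycle_mono]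
      simp [DiffOp.signedSum]
  rw [h2, zero_smul, add_zero, DiffOp.elem_mul_elem, DiffOp.elem_mul_elem, map_sub,
    LinearMap.sub_apply, add_comm l k] at h1
  rw [← h1]; abel

variable (N) in
/-- The polynomials `f` such that all operators `tᵏ f(D) A` annihilate the vector `v`. -/
def annih (v : V) (k : ℤ) : Submodule ℂ ℂ[X] where
  carrier := {f | ∀ p q : Fin N, opAct N V (DiffOp.elem k p q f) v = 0}
  add_mem' hf hg p q := by rw [map_add, map_add, LinearMap.add_apply, hf, hg, add_zero]
  zero_mem' p q := by rw [map_zero, map_zero, LinearMap.zero_apply]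
  smul_mem' c f hf p q := by rw [map_smul, map_smul, LinearMap.smul_apply, hf, smul_zero]

lemma annih_bracket {v : V} {a b : ℤ} (hab : a + b ≠ 0) {f g : ℂ[X]} (hf : f ∈ annih N v a)
    (hg : g ∈ annih N v b) : tau b f * g - tau a g * f ∈ annih N v (a + b) := by
  intro p q
  have h : ∀ p' q' r s : Fin N,
      opAct N V (if q' = r then DiffOp.elem (a + b) p' s (tau b f * g) else 0) v =
        opAct N V (if s = p' then DiffOp.elem (a + b) r q' (tau a g * f) else 0) v := by
    intro p' q' r s
    have h1 := opAct_elem_comm (Or.inl hab) p' q' r s f g v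
    rw [hg, hf, map_zero, map_zero, zero_add] at h1
    exact (sub_eq_zero.mp h1.symm)
  rw [map_sub, map_sub, LinearMap.sub_apply, sub_eq_zero]
  rcases eq_or_ne p q with rfl | hpq
  · simpa using h p p p p
  · have h1 := h p p p q
    have h2 := h q q p q
    simp only [if_true, if_neg hpq.symm, map_zero, LinearMap.zero_apply] at h1 h2
    rw [h1, ← h2]

/-- The commutator of annihilating operators `tᶜ Dⁱ` and `tᵈ Dʲ` is an annihilating operator
`tᶜ⁺ᵈ f(D)`, where `f` has degree `i + j - 1` unless `i d = j c`. -/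
lemma annih_step {v : V} {c d : ℤ} (hcd : c + d ≠ 0) {i j n : ℕ} (hij : i + j = n + 1)
    (hi : X ^ i ∈ annih N v c) (hj : X ^ j ∈ annih N v d) (hne : (i * d - j * c : ℤ) ≠ 0)
    (hn : degreeLT ℂ n ≤ annih N v (c + d)) : degreeLT ℂ (n + 1) ≤ annih N v (c + d) := by
  refine degreeLT_succ_le hn (annih_bracket hcd hi hj) ?_ fun m hm => ?_
  · rw [coeff_sub, coeff_tau_X_pow_top d hij, coeff_tau_X_pow_top c ((add_comm j i).trans hij)]
    exact_mod_cast hne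
  · rw [coeff_sub, coeff_tau_X_pow_of_lt d (by omega), coeff_tau_X_pow_of_lt c (by omega),
      add_comm j i, sub_self]

lemma annih_three_add {v : V} {ε : ℤ} (hε : ε = 1 ∨ ε = -1) {b c : ℕ} (hb : 0 < b) (hc : 0 < c)
    (h1 : degreeLT ℂ 3 ≤ annih N v (ε * b)) (h2 : degreeLT ℂ 3 ≤ annih N v (ε * c)) :
    degreeLT ℂ 3 ≤ annih N v (ε * (b + c : ℕ)) := by
  have hbc : (ε * b : ℤ) + ε * c ≠ 0 := by rcases hε with rfl | rfl <;> omega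
  have e : (ε * (b + c : ℕ) : ℤ) = ε * b + ε * c := by push_cast; ring
  rw [e]
  have m1 : ∀ i, i < 3 → X ^ i ∈ annih N v (ε * b) := fun i hi => h1 (X_pow_mem_degreeLT hi)
  have m2 : ∀ i, i < 3 → X ^ i ∈ annih N v (ε * c) := fun i hi => h2 (X_pow_mem_degreeLT hi)
  have z0 : degreeLT ℂ 0 ≤ annih N v (ε * b + ε * c) := by
    intro f hf
    have : f = 0 := ext fun m => by rw [mem_degreeLT_iff.mp hf m (Nat.zero_le m), coeff_zero]
    rw [this]; exact zero_mem _
  have z1 := annih_step hbc (i := 1) (j := 0) rfl (m1 1 (by norm_num)) (m2 0 (by norm_num))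
    (by rcases hε with rfl | rfl <;> push_cast <;> omega) z0
  have z2 := annih_step hbc (i := 2) (j := 0) rfl (m1 2 (by norm_num)) (m2 0 (by norm_num))
    (by rcases hε with rfl | rfl <;> push_cast <;> omega) z1
  by_cases hcb : 2 * c = b
  · exact annih_step hbc (i := 1) (j := 2) rfl (m1 1 (by norm_num)) (m2 2 (by norm_num))
      (by rcases hε with rfl | rfl <;> push_cast <;> omega) z2
  · exact annih_step hbc (i := 2) (j := 1) rfl (m1 2 (by norm_num)) (m2 1 (by norm_num))
      (by rcases hε with rfl | rfl <;> push_cast <;> omega) z2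

/-- If the operators `tᵐ f(D) A` with `deg f ≤ 2` annihilate `v` for two consecutive values of
`m > 0`, then those with `deg f < n` annihilate `v` for all large `m`. -/
lemma exists_forall_degreeLT_le_annih {v : V} {ε : ℤ} (hε : ε = 1 ∨ ε = -1) {a : ℕ} (ha : 0 < a)
    (h0 : degreeLT ℂ 3 ≤ annih N v (ε * a)) (h1 : degreeLT ℂ 3 ≤ annih N v (ε * (a + 1 : ℕ)))
    (n : ℕ) : ∃ M : ℕ, ∀ m : ℕ, M ≤ m → degreeLT ℂ n ≤ annih N v (ε * m) := by
  have hmono : ∀ {i j : ℕ}, i ≤ j → degreeLT ℂ i ≤ degreeLT ℂ j := fun h => degreeLT_mono h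
  have h3 : ∃ M : ℕ, ∀ m : ℕ, M ≤ m → degreeLT ℂ 3 ≤ annih N v (ε * m) := by
    refine ⟨a * a, fun m hm => ?_⟩
    exact (semigroup_cofinite (S := fun m => 0 < m ∧ degreeLT ℂ 3 ≤ annih N v (ε * m))
      (fun b c hb hc => ⟨by omega, annih_three_add hε hb.1 hc.1 hb.2 hc.2⟩) ha ⟨ha, h0⟩
      ⟨by omega, h1⟩ hm).2
  rcases le_or_gt n 3 with hn | hn
  · obtain ⟨M, hM⟩ := h3
    exact ⟨M, fun m hm => (hmono hn).trans (hM m hm)⟩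
  induction n, hn.le using Nat.le_induction with
  | base => exact h3
  | succ n hn' ih =>
    obtain ⟨M, hM⟩ : ∃ M : ℕ, ∀ m : ℕ, M ≤ m → degreeLT ℂ n ≤ annih N v (ε * m) := by
      rcases hn'.eq_or_lt with rfl | h
      · exact h3
      · exact ih h
    refine ⟨2 * M + 1, fun m hm => ?_⟩
    obtain ⟨k, rfl⟩ : ∃ k, m = M + k := ⟨m - M, by omega⟩
    have e : (ε * (M + k : ℕ) : ℤ) = ε * M + ε * k := by push_cast; ring
    have hk : M < k := by omega
    have hz := hM (M + k) (by omega)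
    rw [e] at hz ⊢
    refine annih_step (i := n - 1) (j := 2) ?_ (by omega)
      (hM M le_rfl (X_pow_mem_degreeLT (by omega)))
      (hM k hk.le (X_pow_mem_degreeLT (by omega))) ?_ hz
    · rcases hε with rfl | rfl <;> omega
    · have h4 : (2 : ℤ) ≤ ((n - 1 : ℕ) : ℤ) := by omega
      have h5 : (M : ℤ) < k := by exact_mod_cast hk
      have h6 : (0 : ℤ) < ((n - 1 : ℕ) : ℤ) * k - (2 : ℕ) * M := by
        push_cast; nlinarith
      have h7 : (((n - 1 : ℕ) : ℤ) * (ε * k) - (2 : ℕ) * (ε * M) : ℤ) =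
          ε * (((n - 1 : ℕ) : ℤ) * k - (2 : ℕ) * M) := by ring
      rw [h7]
      exact mul_ne_zero (by rcases hε with rfl | rfl <;> norm_num) h6.ne'

/-! ### The tail submodule -/

variable (N) in
/-- The vector `v` is annihilated, for every `n`, by the operators `tᵋᵐ f(D) A` with `deg f < n`
and `m` large. -/
def IsTail (ε : ℤ) (v : V) : Prop :=
  ∀ n : ℕ, ∃ M : ℕ, ∀ m : ℕ, M ≤ m → degreeLT ℂ n ≤ annih N v (ε * m)

lemma IsTail.add {ε : ℤ} {v w : V} (hv : IsTail N ε v) (hw : IsTail N ε w) :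
    IsTail N ε (v + w) := by
  intro n
  obtain ⟨M, hM⟩ := hv n
  obtain ⟨M', hM'⟩ := hw n
  refine ⟨max M M', fun m hm f hf p q => ?_⟩
  rw [map_add, hM m ((le_max_left _ _).trans hm) hf, hM' m ((le_max_right _ _).trans hm) hf,
    add_zero]

lemma isTail_zero (ε : ℤ) : IsTail N ε (0 : V) :=
  fun _ => ⟨0, fun _ _ _ _ _ _ => map_zero _⟩

lemma IsTail.smul {ε : ℤ} {v : V} (hv : IsTail N ε v) (c : ℂ) : IsTail N ε (c • v) := by
  intro n
  obtain ⟨M, hM⟩ := hv n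
  refine ⟨M, fun m hm f hf p q => ?_⟩
  rw [map_smul, hM m hm hf, smul_zero]

lemma IsTail.elem {ε : ℤ} (hε : ε = 1 ∨ ε = -1) {v : V} (hv : IsTail N ε v) (l : ℤ) (r s : Fin N)
    (g : ℂ[X]) : IsTail N ε (opAct N V (DiffOp.elem l r s g) v) := by
  intro n
  obtain ⟨M, hM⟩ := hv n
  obtain ⟨M', hM'⟩ := hv (n + g.natDegree)
  refine ⟨max M (M' + l.natAbs + 1), fun m hm f hf p q => ?_⟩
  have hm1 : M ≤ m := (le_max_left _ _).trans hm
  have hm2 : M' + l.natAbs + 1 ≤ m := (le_max_right _ _).trans hm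
  obtain ⟨m', hm', hm''⟩ : ∃ m' : ℕ, M' ≤ m' ∧ ε * m + l = ε * m' := by
    clear hM hM' hv hf hm hm1
    rcases hε with rfl | rfl
    · exact ⟨(m + l).toNat, by omega, by omega⟩
    · exact ⟨(m - l).toNat, by omega, by omega⟩
  have hne : ε * m + l ≠ 0 := by
    clear hM hM' hv hf hm hm1 hm''
    rcases hε with rfl | rfl <;> omega
  have d1 : tau l f * g ∈ degreeLT ℂ (n + g.natDegree) :=
    mul_mem_degreeLT (tau_mem_degreeLT l hf) (le_refl g.natDegree)
  have d2 : f * tau (ε * m) g ∈ degreeLT ℂ (n + g.natDegree) :=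
    mul_mem_degreeLT hf (natDegree_tau (ε * m) g).le
  have h1 : tau l f * g ∈ annih N v (ε * m') := hM' m' hm' d1
  have h2 : tau (ε * m) g * f ∈ annih N v (ε * m') := by
    rw [mul_comm _ f]
    exact hM' m' hm' d2
  rw [opAct_elem_comm (Or.inl hne), hM m hm1 hf, map_zero, zero_add, hm'']
  have e1 : opAct N V (if q = r then DiffOp.elem (ε * m') p s (tau l f * g) else 0) v = 0 := by
    split_ifs
    · exact h1 p s
    · rw [map_zero, LinearMap.zero_apply]
  have e2 : opAct N V (if s = p then DiffOp.elem (ε * m') r q (tau (ε * m) g * f) else 0) v =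
      0 := by
    split_ifs
    · exact h2 r q
    · rw [map_zero, LinearMap.zero_apply]
  rw [e1, e2, sub_zero]

lemma IsTail.lie {ε : ℤ} (hε : ε = 1 ∨ ε = -1) {v : V} (hv : IsTail N ε v) (x : HatD N) :
    IsTail N ε ⁅x, v⁆ := by
  have h1 : ∀ a, IsTail N ε (opAct N V a v) := by
    intro a
    induction a using DiffOp.elem_induction with
    | hzero => rw [map_zero, LinearMap.zero_apply]; exact isTail_zero ε
    | hadd a b ha hb => rw [map_add, LinearMap.add_apply]; exact ha.add hb
    | helem l r s g => exact hv.elem hε l r s g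
  have h2 : IsTail N ε ⁅HatD.central N, v⁆ := by
    intro n
    obtain ⟨M, hM⟩ := hv n
    refine ⟨M, fun m hm f hf p q => ?_⟩
    rw [opAct_apply, ← lie_central_comm, ← opAct_apply, hM m hm hf, lie_zero]
  rw [HatD.eq_ofOp_add x, add_lie, smul_lie, ← opAct_apply]
  exact (h1 _).add (h2.smul _)

/-- The submodule of the vectors `v` with `IsTail N ε v`. -/
def tailSubmodule (N : ℕ) (V : Type*) [AddCommGroup V] [Module ℂ V] [LieRingModule (HatD N) V]
    [LieModule ℂ (HatD N) V] {ε : ℤ} (hε : ε = 1 ∨ ε = -1) : LieSubmodule ℂ (HatD N) V where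
  carrier := {v | IsTail N ε v}
  add_mem' hv hw := hv.add hw
  zero_mem' := isTail_zero ε
  smul_mem' c _ hv := hv.smul c
  lie_mem hv := hv.lie hε _

lemma mem_tailSubmodule {ε : ℤ} {hε : ε = 1 ∨ ε = -1} {v : V} :
    v ∈ tailSubmodule N V hε ↔ IsTail N ε v := Iff.rfl

lemma degreeLT_le_of_X_pow {Z : Submodule ℂ ℂ[X]} {n : ℕ} (h : ∀ i < n, X ^ i ∈ Z) :
    degreeLT ℂ n ≤ Z := by
  rw [degreeLT_eq_span_X_pow, Submodule.span_le]
  intro f hf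
  simp only [Finset.coe_image, Finset.coe_range, Set.mem_image, Set.mem_Iio] at hf
  obtain ⟨i, hi, rfl⟩ := hf
  exact h i hi

/-- If no nonzero vector lies in the tail submodule, then a component `𝒱 j` embeds into a fixed
number of copies of a fixed finite-dimensional space, by means of the operators `tᵋᵃ Dⁱ E_{p,q}`
and `tᵋ⁽ᵃ⁺¹⁾ Dⁱ E_{p,q}` with `i ≤ 2`. -/
lemma IsQuasifinite.finrank_le_of_tail (h : IsQuasifinite N 𝒱) {ε : ℤ} (hε : ε = 1 ∨ ε = -1)
    (hW : tailSubmodule N V hε = ⊥) {j : ℤ} {a : ℕ} (ha : 0 < a) (hj : |j + ε * a * N| ≤ N) :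
    Module.finrank ℂ (𝒱 j) ≤ Fintype.card (Fin 2 × Fin 3 × Fin N × Fin N) *
      Module.finrank ℂ ((Finset.Icc (-(3 * N : ℤ)) (3 * N)).sup 𝒱 : Submodule ℂ V) := by
  set U : Submodule ℂ V := (Finset.Icc (-(3 * N : ℤ)) (3 * N)).sup 𝒱 with hU
  have := h.finite
  have hfin : FiniteDimensional ℂ U := Submodule.finiteDimensional_finset_sup _ _
  have hmem : ∀ (x : Fin 2 × Fin 3 × Fin N × Fin N) (v : 𝒱 j),
      opAct N V (DiffOp.elem (ε * (a + (x.1 : ℕ) : ℕ)) x.2.2.1 x.2.2.2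
        (X ^ (x.2.1 : ℕ))) v ∈ U := by
    rintro ⟨b, i, p, q⟩ ⟨v, hv⟩
    have h1 := h.opAct_mem (ε * (a + (b : ℕ) : ℕ)) p q (X ^ (i : ℕ)) j v hv
    refine (Finset.le_sup (f := 𝒱) (Finset.mem_Icc.mpr ?_) : 𝒱 _ ≤ U) h1
    have hp := p.2
    have hq := q.2
    have hb := b.2
    have e : j + (ε * (a + (b : ℕ) : ℕ) * N + 1 * ((p : ℤ) - (q : ℤ))) =
        (j + ε * a * N) + ε * ((b : ℕ) * N) + ((p : ℤ) - q) := by push_cast; ring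
    have hbN : (b : ℕ) * (N : ℤ) ≤ N := by nlinarith
    have hbN' : 0 ≤ (b : ℕ) * (N : ℤ) := by positivity
    rw [abs_le] at hj
    rw [e]
    rcases hε with rfl | rfl <;> constructor <;> omega
  let T : 𝒱 j →ₗ[ℂ] (Fin 2 × Fin 3 × Fin N × Fin N → U) :=
    LinearMap.pi fun x => ((opAct N V (DiffOp.elem (ε * (a + (x.1 : ℕ) : ℕ)) x.2.2.1 x.2.2.2
      (X ^ (x.2.1 : ℕ)))).comp (𝒱 j).subtype).codRestrict U (hmem x)
  have hT : Function.Injective T := by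
    rw [← LinearMap.ker_eq_bot, LinearMap.ker_eq_bot']
    intro v hv
    have hz : ∀ b : Fin 2, degreeLT ℂ 3 ≤ annih N (v : V) (ε * (a + (b : ℕ) : ℕ)) := fun b =>
      degreeLT_le_of_X_pow fun i hi p q =>
        congrArg Subtype.val (congrFun hv (b, ⟨i, hi⟩, p, q))
    have hvW : (v : V) ∈ tailSubmodule N V hε :=
      fun n => exists_forall_degreeLT_le_annih hε ha (hz 0) (hz 1) n
    rw [hW, LieSubmodule.mem_bot] at hvW
    exact Subtype.ext hvW
  have h1 := LinearMap.finrank_le_finrank_of_injective hT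
  rwa [Module.finrank_pi_fintype, Finset.sum_const, Finset.card_univ, smul_eq_mul] at h1

lemma IsQuasifinite.isUniformlyBounded_of_tail (h : IsQuasifinite N 𝒱) (hN : 1 ≤ N)
    (h1 : tailSubmodule N V (ε := 1) (Or.inl rfl) = ⊥)
    (h2 : tailSubmodule N V (ε := -1) (Or.inr rfl) = ⊥) : IsUniformlyBounded N 𝒱 := by
  refine { h with bounded := ⟨Fintype.card (Fin 2 × Fin 3 × Fin N × Fin N) *
      Module.finrank ℂ ((Finset.Icc (-(3 * N : ℤ)) (3 * N)).sup 𝒱 : Submodule ℂ V) + 1,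
        Nat.succ_pos _, fun j => Nat.le_succ_of_le ?_⟩ }
  have hN' : (0 : ℤ) < N := by exact_mod_cast hN
  -- `a` is chosen such that `j ± a N` lies in a fixed window around zero
  have hdm : ∀ x : ℤ, 0 ≤ x → ∃ a : ℕ, 0 < a ∧ |x - a * N| ≤ N := by
    intro x hx
    have e1 := Int.emod_nonneg x hN'.ne'
    have e2 := Int.emod_lt_of_pos x hN'
    have e3 := Int.emod_add_mul_ediv x N
    have e4 : 0 ≤ x / N := Int.ediv_nonneg hx hN'.le
    refine ⟨(x / N).toNat + 1, Nat.succ_pos _, ?_⟩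
    push_cast
    rw [Int.toNat_of_nonneg e4, abs_le]
    constructor <;> linarith
  rcases le_or_gt 0 j with hj | hj
  · obtain ⟨a, ha, haj⟩ := hdm j hj
    refine h.finrank_le_of_tail (Or.inr rfl) h2 ha ?_
    rwa [show j + -1 * a * N = j - a * N by ring]
  · obtain ⟨a, ha, haj⟩ := hdm (-j) (by omega)
    refine h.finrank_le_of_tail (Or.inl rfl) h1 ha ?_
    rwa [show j + 1 * a * N = -(-j - a * N) by ring, abs_neg]

end HatModule

/-! ### Highest and lowest weight vectors -/

section HatModule

variable {N : ℕ} {V : Type*} [AddCommGroup V] [Module ℂ V] [LieRingModule (HatD N) V]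
  [LieModule ℂ (HatD N) V] {𝒱 : ℤ → Submodule ℂ V}

variable (N V) in
/-- The operators `f(D) E_{p,p}` and the central element, a commuting family. -/
def cartanAct : Option (Fin N × ℂ[X]) → Module.End ℂ V
  | none => cenAct N V
  | some x => opAct N V (DiffOp.elem 0 x.1 x.1 x.2)

lemma cartanAct_comm (i j : Option (Fin N × ℂ[X])) (v : V) :
    cartanAct N V i (cartanAct N V j v) = cartanAct N V j (cartanAct N V i v) := by
  rcases i with _ | ⟨p, f⟩ <;> rcases j with _ | ⟨q, g⟩
  · rfl
  · exact lie_central_comm _ v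
  · exact (lie_central_comm _ v).symm
  · have h := opAct_elem_comm (Or.inr rfl) (l := 0) p p q q f g v
    simp only [cartanAct]
    rw [h]
    rcases eq_or_ne p q with rfl | hpq
    · simp [mul_comm]
    · simp [hpq, hpq.symm]

lemma IsQuasifinite.cartanAct_mem (h : IsQuasifinite N 𝒱) (i : Option (Fin N × ℂ[X])) {j : ℤ}
    {v : V} (hv : v ∈ 𝒱 j) : cartanAct N V i v ∈ 𝒱 j := by
  rcases i with _ | ⟨p, f⟩
  · have := h.lie_mem 0 _ _ central_mem_deg _ hv
    rwa [zero_add] at this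
  · have := h.opAct_mem 0 p p f _ _ hv
    rwa [show j + (0 * N + 1 * ((p : ℤ) - (p : ℤ))) = j by ring] at this

variable (N V) in
/-- The operator `∑_p (N D + p) E_{p,p}`, whose commutator with `tᵏ f(D) E_{p,q}` is the multiple
of the latter by its degree. -/
def degreeAct : Module.End ℂ V :=
  ∑ r : Fin N, opAct N V (DiffOp.elem 0 r r (C (N : ℂ) * X + C ((r : ℕ) : ℂ)))

lemma degreeAct_elem (k : ℤ) (p q : Fin N) (f : ℂ[X]) (v : V) :
    degreeAct N V (opAct N V (DiffOp.elem k p q f) v) =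
      opAct N V (DiffOp.elem k p q f) (degreeAct N V v) +
        ((k * N + (p : ℤ) - (q : ℤ) : ℤ) : ℂ) • opAct N V (DiffOp.elem k p q f) v := by
  simp only [degreeAct, LinearMap.sum_apply, map_sum]
  simp only [opAct_elem_comm (Or.inr rfl), Finset.sum_add_distrib, Finset.sum_sub_distrib, zero_add,
    tau_zero]
  congr 1
  have e1 : ∀ u : Fin N → ℂ[X], ∑ r, opAct N V (if r = p then DiffOp.elem k r q
      (tau k (u r) * f) else 0) v = opAct N V (DiffOp.elem k p q (tau k (u p) * f)) v := by
    intro u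
    rw [Finset.sum_eq_single p (fun r _ h => by rw [if_neg h, map_zero, LinearMap.zero_apply])
      (fun h => absurd (Finset.mem_univ p) h), if_pos rfl]
  have e2 : ∀ u : Fin N → ℂ[X], ∑ r, opAct N V (if q = r then DiffOp.elem k p r
      (f * u r) else 0) v = opAct N V (DiffOp.elem k p q (f * u q)) v := by
    intro u
    rw [Finset.sum_eq_single q (fun r _ h => by rw [if_neg h.symm, map_zero, LinearMap.zero_apply])
      (fun h => absurd (Finset.mem_univ q) h), if_pos rfl]
  rw [e1, e2, ← LinearMap.sub_apply, ← map_sub, ← map_sub, ← LinearMap.smul_apply, ← map_smul,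
    ← map_smul]
  congr 3
  rw [smul_eq_C_mul, map_add, map_mul, tau_C, tau_C, tau_X]
  push_cast
  simp only [C_add, C_sub, C_mul]
  ring

/-- A joint eigenvector of the operators `g(D) E_{p,p}` annihilated by `tᵏ A` for all `A` is
annihilated by `tᵏ f(D) A` for all `f` and `A`. -/
lemma elem_eq_zero_of_cartan_eigenvector {v : V}
    (hv : ∀ (p : Fin N) (f : ℂ[X]), ∃ c : ℂ, opAct N V (DiffOp.elem 0 p p f) v = c • v) {k : ℤ}
    (hk : k ≠ 0) (h1 : ∀ p q, opAct N V (DiffOp.elem k p q 1) v = 0) (p q : Fin N) (f : ℂ[X]) :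
    opAct N V (DiffOp.elem k p q f) v = 0 := by
  have hc : ∀ g : ℂ[X],
      opAct N V (DiffOp.elem k p q 1) (opAct N V (DiffOp.elem 0 p p g) v) = 0 := by
    intro g
    obtain ⟨c, hc⟩ := hv p g
    rw [hc, map_smul, h1, smul_zero]
  have H : ∀ g : ℂ[X], opAct N V (DiffOp.elem k p q (tau k g)) v -
      opAct N V (if q = p then DiffOp.elem k p p g else 0) v = 0 := by
    intro g
    have h := opAct_elem_comm (Or.inr rfl) p p p q g 1 v (l := k)
    rw [h1, map_zero, hc, zero_add, if_pos rfl, zero_add, mul_one, tau_zero, one_mul] at h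
    exact h.symm
  rcases eq_or_ne p q with rfl | hpq
  · obtain ⟨g, hg⟩ := exists_sub_tau_eq hk f
    have := H g
    rw [if_pos rfl, ← LinearMap.sub_apply, ← map_sub, ← map_sub, ← neg_sub g, hg, map_neg, map_neg,
      LinearMap.neg_apply, neg_eq_zero] at this
    exact this
  · have := H (tau (-k) f)
    rwa [if_neg hpq.symm, map_zero, LinearMap.zero_apply, sub_zero, tau_tau, add_neg_cancel,
      tau_zero] at this

/-- The vectors of a finite-dimensional space contained in the tail submodule are annihilated by
`tᵋᵐ A` for all large `m`, uniformly. -/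
lemma exists_uniform_tail {ε : ℤ} (U : Submodule ℂ V) [FiniteDimensional ℂ U]
    (hU : ∀ u ∈ U, IsTail N ε u) : ∃ M : ℕ, ∀ m : ℕ, M ≤ m → ∀ u ∈ U, ∀ p q : Fin N,
      opAct N V (DiffOp.elem (ε * m) p q 1) u = 0 := by
  obtain ⟨S, hS⟩ := (Submodule.fg_iff_finiteDimensional U).mpr inferInstance
  choose M hM using fun u : V => fun hu : IsTail N ε u => hu 1
  have hSU : ∀ u ∈ S, u ∈ U := fun u hu => hS ▸ Submodule.subset_span hu
  refine ⟨S.attach.sup fun u => M u (hU u (hSU u u.2)), fun m hm u hu p q => ?_⟩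
  have : U ≤ LinearMap.ker (opAct N V (DiffOp.elem (ε * m) p q 1)) := by
    rw [← hS, Submodule.span_le]
    intro u hu
    have h1 : M u (hU u (hSU u hu)) ≤ m :=
      (Finset.le_sup (f := fun u : S => M u (hU u (hSU u u.2)))
        (Finset.mem_attach S ⟨u, hu⟩)).trans hm
    have h2 : (1 : ℂ[X]) ∈ degreeLT ℂ 1 := by
      have := X_pow_mem_degreeLT (n := 1) (i := 0) one_pos
      rwa [pow_zero] at this
    exact hM u (hU u (hSU u hu)) m h1 h2 p q
  exact this hu

/-- If every vector is annihilated by the operators `tᵋᵐ f(D) A` with `m` large, then there is a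
nonzero homogeneous joint eigenvector of the degree zero operators that is annihilated by all
operators whose degree has the sign `ε`. -/
lemma IsQuasifinite.exists_extremal_vector [Nontrivial V] (h : IsQuasifinite N 𝒱) (hN : 1 ≤ N)
    {ε : ℤ} (hε : ε = 1 ∨ ε = -1) (hW : ∀ v : V, IsTail N ε v) :
    ∃ (j : ℤ) (v : V), v ∈ 𝒱 j ∧ v ≠ 0 ∧ (∀ i, ∃ c : ℂ, cartanAct N V i v = c • v) ∧
      ∀ (k : ℤ) (p q : Fin N) (f : ℂ[X]), 0 < ε * (k * N + (p : ℤ) - (q : ℤ)) →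
        opAct N V (DiffOp.elem k p q f) v = 0 := by
  have hfin := h.finite
  have hN' : (0 : ℤ) < N := by exact_mod_cast hN
  have hεε : ε * ε = 1 := by rcases hε with rfl | rfl <;> rfl
  obtain ⟨d, hd⟩ : ∃ d, 𝒱 d ≠ ⊥ := by
    by_contra! H
    have h1 := h.isInternal.submodule_iSup_eq_top
    rw [show 𝒱 = fun _ => ⊥ from funext H, iSup_bot] at h1
    exact bot_ne_top h1
  obtain ⟨v₀, hv₀, hv₀0, hv₀c⟩ := exists_common_eigenvector (cartanAct N V) cartanAct_comm (𝒱 d) hd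
    (fun i v hv => h.cartanAct_mem i hv)
  obtain ⟨M, hM1, hM⟩ : ∃ M : ℕ, 0 < M ∧ ∀ m : ℕ, M ≤ m → ∀ p q f,
      opAct N V (DiffOp.elem (ε * m) p q f) v₀ = 0 := by
    obtain ⟨M, hM⟩ := exists_uniform_tail (N := N) (ε := ε) (𝒱 d) (fun u _ => hW u)
    refine ⟨M + 1, Nat.succ_pos _, fun m hm p q f => ?_⟩
    refine elem_eq_zero_of_cartan_eigenvector (fun p f => hv₀c (some (p, f))) ?_
      (fun p q => hM m (by omega) v₀ hv₀ p q) p q f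
    have : (m : ℤ) ≠ 0 := by omega
    rcases hε with rfl | rfl <;> omega
  obtain ⟨θ, hθ⟩ : ∃ θ : ℂ, degreeAct N V v₀ = θ • v₀ := by
    choose c hc using fun r : Fin N => hv₀c (some (r, C (N : ℂ) * X + C ((r : ℕ) : ℂ)))
    refine ⟨∑ r, c r, ?_⟩
    rw [degreeAct, LinearMap.sum_apply, Finset.sum_smul]
    exact Finset.sum_congr rfl fun r _ => hc r
  -- the spaces `K n` of vectors of degree `d + ε n` that behave like the images of `v₀`
  let K : ℕ → Submodule ℂ V := fun n =>
    { carrier := {w | w ∈ 𝒱 (d + ε * n) ∧ degreeAct N V w = (θ + ε * n) • w ∧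
        ∀ m : ℕ, M ≤ m → ∀ p q f, opAct N V (DiffOp.elem (ε * m) p q f) w = 0}
      add_mem' := fun {u w} hu hw => ⟨add_mem hu.1 hw.1, by rw [map_add, hu.2.1, hw.2.1, smul_add],
        fun m hm p q f => by rw [map_add, hu.2.2 m hm, hw.2.2 m hm, add_zero]⟩
      zero_mem' := ⟨zero_mem _, by rw [map_zero, smul_zero], fun m hm p q f => map_zero _⟩
      smul_mem' := fun c w hw => ⟨Submodule.smul_mem _ c hw.1,
        by rw [map_smul, hw.2.1, smul_comm],
        fun m hm p q f => by rw [map_smul, hw.2.2 m hm, smul_zero]⟩ }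
  have hK : ∀ n w, w ∈ K n ↔ w ∈ 𝒱 (d + ε * n) ∧ degreeAct N V w = (θ + ε * n) • w ∧
        ∀ m : ℕ, M ≤ m → ∀ p q f, opAct N V (DiffOp.elem (ε * m) p q f) w = 0 :=
    fun n w => Iff.rfl
  have hK0 : v₀ ∈ K 0 := by
    rw [hK]
    refine ⟨by simpa using hv₀, by simpa using hθ, hM⟩
  -- operators of degree `ε e` with `e ≥ 0` and `k` of the right sign map `K n` to `K (n + e)`
  have hKact : ∀ (n e k' : ℕ) (p q : Fin N) (f : ℂ[X]) (w : V), w ∈ K n →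
      ε * k' * N + (p : ℤ) - (q : ℤ) = ε * e →
      opAct N V (DiffOp.elem (ε * k') p q f) w ∈ K (n + e) := by
    intro n e k' p q f w hw he
    rw [hK] at hw ⊢
    refine ⟨?_, ?_, fun m hm p' q' f' => ?_⟩
    · have := h.opAct_mem (ε * k') p q f _ _ hw.1
      rwa [show d + ε * n + (ε * k' * N + 1 * ((p : ℤ) - (q : ℤ))) = d + ε * (n + e : ℕ) by
        push_cast; linear_combination he] at this
    · rw [degreeAct_elem, hw.2.1, he, map_smul, ← add_smul]
      congr 1; push_cast; ring
    · have hne : ε * (m : ℤ) + ε * k' ≠ 0 := by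
        clear hM hw
        rcases hε with rfl | rfl <;> omega
      have e1 : ε * (m : ℤ) + ε * k' = ε * (m + k' : ℕ) := by push_cast; ring
      rw [opAct_elem_comm (Or.inl hne), hw.2.2 m hm, map_zero, zero_add, e1]
      have hz := hw.2.2 (m + k') (by omega)
      have z1 : opAct N V (if q' = p then DiffOp.elem (ε * (m + k' : ℕ)) p' q
          (tau (ε * k') f' * f) else 0) w = 0 := by
        split_ifs
        · exact hz _ _ _
        · rw [map_zero, LinearMap.zero_apply]
      have z2 : opAct N V (if q = p' then DiffOp.elem (ε * (m + k' : ℕ)) p q'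
          (tau (ε * m) f * f') else 0) w = 0 := by
        split_ifs
        · exact hz _ _ _
        · rw [map_zero, LinearMap.zero_apply]
      rw [z1, z2, sub_zero]
  -- `K n` vanishes for large `n`
  obtain ⟨n₀, hn₀⟩ : ∃ n₀ : ℕ, ∀ n, n₀ ≤ n → K n = ⊥ := by
    set U : Submodule ℂ V := (Finset.Icc (d - N) (d + N)).sup 𝒱 with hU
    have hUfin : FiniteDimensional ℂ U := Submodule.finiteDimensional_finset_sup _ _
    obtain ⟨M', hM'⟩ := exists_uniform_tail (N := N) (ε := ε) U (fun u _ => hW u)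
    obtain ⟨b, hb⟩ := exists_nat_gt ‖θ‖
    refine ⟨N * (M + M' + 1) + b, fun n hn => ?_⟩
    rw [eq_bot_iff]
    intro w hw
    rw [hK] at hw
    obtain ⟨k, hk1, hk2, hk3⟩ : ∃ k : ℕ, M ≤ k ∧ M' ≤ k ∧ |(n : ℤ) - k * N| ≤ N := by
      have e1 := Nat.mod_lt n hN
      have e2 := Nat.div_add_mod n N
      have e3 : M + M' + 1 ≤ n / N :=
        (Nat.le_div_iff_mul_le hN).mpr (by linarith [mul_comm N (M + M' + 1)])
      refine ⟨n / N, by omega, by omega, ?_⟩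
      have e4 : (n : ℤ) - (n / N : ℕ) * N = (n % N : ℕ) := by
        have : (n : ℤ) = N * (n / N : ℕ) + (n % N : ℕ) := by exact_mod_cast e2.symm
        linear_combination this
      rw [e4, Nat.abs_cast]
      exact_mod_cast e1.le
    have hkne : ε * (k : ℤ) ≠ 0 := by
      have : (k : ℤ) ≠ 0 := by omega
      rcases hε with rfl | rfl <;> omega
    -- `[tᵋᵏ E_{p,p}, t⁻ᵋᵏ f(D) E_{p,p}]` annihilates `w`
    have key : ∀ (p : Fin N) (f : ℂ[X]), opAct N V (DiffOp.elem 0 p p (f - tau (ε * k) f)) w +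
        intervalSum 0 (ε * k) f • ⁅HatD.central N, w⁆ = 0 := by
      intro p f
      have h1 := (cornerAction V p).lie_act_neg (ε * k) 1 f w
      simp only [cornerAction_act, cornerAction_cen, map_one, one_mul, mul_one] at h1
      rw [hw.2.2 k hk1, map_zero, sub_zero] at h1
      have hu : opAct N V (DiffOp.elem (-(ε * k)) p p f) w ∈ U := by
        have h2 := h.opAct_mem (-(ε * k)) p p f _ _ hw.1
        refine (Finset.le_sup (f := 𝒱) (Finset.mem_Icc.mpr ?_) : 𝒱 _ ≤ U) h2
        have e5 : d + ε * n + (-(ε * k) * N + 1 * ((p : ℤ) - (p : ℤ))) =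
            d + ε * ((n : ℤ) - k * N) := by ring
        rw [e5]
        rw [abs_le] at hk3
        rcases hε with rfl | rfl <;> constructor <;> linarith [hk3.1, hk3.2]
      rw [hM' k hk2 _ hu] at h1
      exact h1.symm
    have hc : ⁅HatD.central N, w⁆ = 0 := by
      have h1 := key ⟨0, hN⟩ 1
      rw [map_one, sub_self, map_zero, map_zero, LinearMap.zero_apply, zero_add,
        intervalSum_one] at h1
      exact (smul_eq_zero.mp h1).resolve_left (by exact_mod_cast hkne)
    have hz : ∀ (p : Fin N) (f : ℂ[X]), opAct N V (DiffOp.elem 0 p p f) w = 0 := by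
      intro p f
      obtain ⟨g, hg⟩ := exists_sub_tau_eq hkne f
      have h1 := key p g
      rwa [hg, hc, smul_zero, add_zero] at h1
    have h0 : degreeAct N V w = 0 := by
      rw [degreeAct, LinearMap.sum_apply]
      exact Finset.sum_eq_zero fun r _ => hz r _
    rw [hw.2.1] at h0
    refine (smul_eq_zero.mp h0).resolve_left fun h1 => ?_
    have h2 : ‖θ‖ = n := by
      rw [eq_neg_of_add_eq_zero_left h1, norm_neg, norm_mul]
      rcases hε with rfl | rfl <;> simp
    have h3 : (b : ℝ) ≤ n := by exact_mod_cast (by omega : b ≤ n)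
    linarith
  classical
  -- the last nonzero `K n`
  obtain ⟨n, hn, hn'⟩ : ∃ n, K n ≠ ⊥ ∧ ∀ m, n < m → K m = ⊥ := by
    have hne : K 0 ≠ ⊥ := fun H => hv₀0 ((Submodule.mem_bot ℂ).mp (H ▸ hK0))
    refine ⟨Nat.findGreatest (fun n => K n ≠ ⊥) n₀,
      Nat.findGreatest_spec (P := fun n => K n ≠ ⊥) (Nat.zero_le n₀) hne, fun m hm => ?_⟩
    by_contra H
    rcases le_or_gt n₀ m with h1 | h1
    · exact H (hn₀ m h1)
    · exact absurd (Nat.le_findGreatest h1.le H) (not_le.mpr hm)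
  have hKfin : FiniteDimensional ℂ (K n) :=
    Submodule.finiteDimensional_of_le (fun w hw => hw.1 : K n ≤ 𝒱 (d + ε * n))
  obtain ⟨w, hwK, hw0, hwc⟩ := exists_common_eigenvector (cartanAct N V) cartanAct_comm (K n) hn
    (by
      rintro (_ | ⟨p, f⟩) w hw
      · rw [hK] at hw ⊢
        refine ⟨h.cartanAct_mem none hw.1, ?_, fun m hm p q f => ?_⟩
        · change degreeAct N V (cenAct N V w) = _ • cenAct N V w
          rw [← map_smul, ← hw.2.1, degreeAct, LinearMap.sum_apply, LinearMap.sum_apply, map_sum]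
          exact Finset.sum_congr rfl fun r _ => (lie_central_comm _ w).symm
        · exact (lie_central_comm _ w).symm.trans
            ((congrArg (fun u => ⁅HatD.central N, u⁆) (hw.2.2 m hm p q f)).trans (lie_zero _))
      · have := hKact n 0 0 p p f w hw (by simp)
        rw [Nat.cast_zero, mul_zero] at this
        exact this)
  refine ⟨d + ε * n, w, hwK.1, hw0, hwc, fun k p q f hk => ?_⟩
  have hp := p.2
  have hq := q.2
  have hεk : 0 ≤ ε * k := by
    by_contra! H
    have : ε * k * N ≤ -N := by nlinarith
    rcases hε with rfl | rfl <;> linarith [(by exact_mod_cast hp : (p : ℤ) < N),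
      (by exact_mod_cast hq : (q : ℤ) < N), (by positivity : (0 : ℤ) ≤ p),
      (by positivity : (0 : ℤ) ≤ q)]
  obtain ⟨k', hk'⟩ := Int.eq_ofNat_of_zero_le hεk
  obtain ⟨e, he⟩ := Int.eq_ofNat_of_zero_le hk.le
  have hkk : k = ε * k' := by rw [← hk', ← mul_assoc, hεε, one_mul]
  have h1 := hKact n e k' p q f w hwK (by
    rw [← hkk, ← he, ← mul_assoc, hεε, one_mul])
  rw [hn' (n + e) (by omega), Submodule.mem_bot] at h1
  rw [hkk]
  exact h1

lemma mem_span_of_deg_zero {v : V} (hv : ∀ i, ∃ c : ℂ, cartanAct N V i v = c • v) :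
    ∀ x ∈ HatD.deg N 0, ⁅x, v⁆ ∈ Submodule.span ℂ {v} := by
  intro x hx
  induction hx using Submodule.span_induction with
  | zero => rw [zero_lie]; exact zero_mem _
  | add x y _ _ hx hy => rw [add_lie]; exact add_mem hx hy
  | smul c x _ hx => rw [smul_lie]; exact Submodule.smul_mem _ c hx
  | mem x hx =>
    rcases hx with ⟨k, j, p, q, hk, rfl⟩ | ⟨_, rfl⟩
    · have h1 := elem_degree_injective (N := N) (Or.inl rfl) p (a₁ := (k, q)) (a₂ := (0, p))
        (by simp only; linarith)
      obtain ⟨rfl, rfl⟩ := Prod.mk.inj h1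
      obtain ⟨c, hc⟩ := hv (some (q, X ^ j))
      rw [DiffOp.op_single, ← opAct_apply]
      exact Submodule.mem_span_singleton.mpr ⟨c, hc.symm⟩
    · obtain ⟨c, hc⟩ := hv none
      exact Submodule.mem_span_singleton.mpr ⟨c, hc.symm⟩

lemma lie_eq_zero_of_deg {v : V} {d : ℤ} (hd : d ≠ 0)
    (hv : ∀ (k : ℤ) (p q : Fin N) (f : ℂ[X]), k * N + (p : ℤ) - (q : ℤ) = d →
      opAct N V (DiffOp.elem k p q f) v = 0) : ∀ x ∈ HatD.deg N d, ⁅x, v⁆ = 0 := by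
  intro x hx
  induction hx using Submodule.span_induction with
  | zero => rw [zero_lie]
  | add x y _ _ hx hy => rw [add_lie, hx, hy, add_zero]
  | smul c x _ hx => rw [smul_lie, hx, smul_zero]
  | mem x hx =>
    rcases hx with ⟨k, j, p, q, hk, rfl⟩ | ⟨h0, rfl⟩
    · rw [DiffOp.op_single, ← opAct_apply]
      exact hv k p q _ hk
    · exact absurd h0 hd

end HatModule

section HatModule

variable {N : ℕ} {V : Type*} [AddCommGroup V] [Module ℂ V] [LieRingModule (HatD N) V]
  {𝒱 : ℤ → Submodule ℂ V}

/-! ### Choice of a basis of a component -/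

lemma exists_range_eq_of_finrank {U : Submodule ℂ V} [FiniteDimensional ℂ U] {W : Type*}
    [AddCommGroup W] [Module ℂ W] [FiniteDimensional ℂ W]
    (h : Module.finrank ℂ W = Module.finrank ℂ U) :
    ∃ θ : W →ₗ[ℂ] V, Function.Injective θ ∧ LinearMap.range θ = U := by
  let e := LinearEquiv.ofFinrankEq W U h
  refine ⟨U.subtype ∘ₗ e.toLinearMap, U.injective_subtype.comp e.injective, ?_⟩
  rw [LinearMap.range_comp, LinearEquiv.range, Submodule.map_top, Submodule.range_subtype]

lemma IsAssociative.component_ne_zero [Nontrivial V] (h : IsAssociative N 𝒱) (hN : 1 ≤ N)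
    (hq : IsQuasifinite N 𝒱) (j : ℤ) : Module.finrank ℂ (𝒱 j) ≠ 0 := by
  intro h0
  have := hq.finite j
  obtain ⟨α, hα, -⟩ := h.exists_equiv hN hq.isInternal (𝒱 j).injective_subtype
    (𝒱 j).range_subtype
  have hs : Subsingleton (𝒱 j) := Module.finrank_zero_iff.mp h0
  have hs' := natMod_subsingleton (N := N) (α := α)
  rcases hα with ⟨⟨e⟩⟩ | ⟨⟨e⟩⟩
  · exact not_subsingleton V (e.toLinearEquiv.injective.subsingleton)
  · have : Subsingleton (TwistMod N α) := hs'
    exact not_subsingleton V (e.toLinearEquiv.injective.subsingleton)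

/-! ### Irreducible modules -/

lemma lieSpan_eq_top [LieModule.IsIrreducible ℂ (HatD N) V] {v : V} (hv : v ≠ 0) :
    LieSubmodule.lieSpan ℂ (HatD N) {v} = ⊤ := by
  refine (IsSimpleOrder.eq_bot_or_eq_top _).resolve_left fun h => hv ?_
  have := LieSubmodule.subset_lieSpan (R := ℂ) (L := HatD N) (Set.mem_singleton v)
  rw [h] at this
  exact this

lemma nontrivial_of_isIrreducible [LieModule.IsIrreducible ℂ (HatD N) V] : Nontrivial V :=
  (LieSubmodule.nontrivial_iff ℂ (HatD N) V).mp inferInstance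

lemma isIndecomposable_of_isIrreducible [LieModule.IsIrreducible ℂ (HatD N) V] :
    IsIndecomposable N V := by
  refine ⟨nontrivial_of_isIrreducible (N := N), fun W₁ W₂ h => ?_⟩
  rcases IsSimpleOrder.eq_bot_or_eq_top W₁ with h1 | h1
  · exact Or.inl h1
  · rw [h1] at h
    exact Or.inr (eq_bot_of_isCompl_top h.symm)

variable [LieModule ℂ (HatD N) V]

/-- An irreducible quasifinite module is a highest weight module, a lowest weight module, or
uniformly bounded. -/
lemma IsQuasifinite.trichotomy [LieModule.IsIrreducible ℂ (HatD N) V] (h : IsQuasifinite N 𝒱)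
    (hN : 1 ≤ N) : IsHighestWeightModule N 𝒱 ∨ IsLowestWeightModule N 𝒱 ∨
      IsUniformlyBounded N 𝒱 := by
  have := nontrivial_of_isIrreducible (N := N) (V := V)
  rcases IsSimpleOrder.eq_bot_or_eq_top (tailSubmodule N V (ε := 1) (Or.inl rfl)) with h1 | h1
  · rcases IsSimpleOrder.eq_bot_or_eq_top (tailSubmodule N V (ε := -1) (Or.inr rfl)) with h2 | h2
    · exact Or.inr (Or.inr (h.isUniformlyBounded_of_tail hN h1 h2))
    · obtain ⟨j, v, hvj, hv0, hvc, hv⟩ := h.exists_extremal_vector hN (Or.inr rfl)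
        fun v => mem_tailSubmodule.mp (h2 ▸ LieSubmodule.mem_top v)
      refine Or.inr (Or.inl ⟨v, ⟨hv0, ⟨j, hvj⟩, mem_span_of_deg_zero hvc, fun d hd =>
        lie_eq_zero_of_deg hd.ne fun k p q f hk => hv k p q f ?_⟩, lieSpan_eq_top hv0⟩)
      rw [hk]; linarith
  · obtain ⟨j, v, hvj, hv0, hvc, hv⟩ := h.exists_extremal_vector hN (Or.inl rfl)
      fun v => mem_tailSubmodule.mp (h1 ▸ LieSubmodule.mem_top v)
    refine Or.inl ⟨v, ⟨hv0, ⟨j, hvj⟩, mem_span_of_deg_zero hvc, fun d hd =>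
      lie_eq_zero_of_deg hd.ne' fun k p q f hk => hv k p q f ?_⟩, lieSpan_eq_top hv0⟩
    rw [hk]; linarith

/-- An irreducible uniformly bounded module is a module of the intermediate series. -/
lemma IsUniformlyBounded.isIntermediateSeries [LieModule.IsIrreducible ℂ (HatD N) V]
    (h : IsUniformlyBounded N 𝒱) (hN : 1 ≤ N) : IsIntermediateSeries N 𝒱 := by
  refine { h.toIsQuasifinite with finrank_le_one := fun j => ?_ }
  by_cases ht : LieModule.IsTrivial (HatD N) V
  · -- in a trivial irreducible module every line is the whole space
    have := nontrivial_of_isIrreducible (N := N) (V := V)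
    obtain ⟨v, hv⟩ := exists_ne (0 : V)
    let P : LieSubmodule ℂ (HatD N) V :=
      { Submodule.span ℂ {v} with
        lie_mem := fun {x w} _ => by
          rw [LieModule.IsTrivial.trivial]
          exact (Submodule.span ℂ {v}).zero_mem }
    have hP : P = ⊤ := (IsSimpleOrder.eq_bot_or_eq_top P).resolve_left fun h0 => hv (by
      have h1 : v ∈ P := Submodule.mem_span_singleton_self v
      rw [h0] at h1
      exact h1)
    have hs : Submodule.span ℂ {v} = ⊤ := congrArg LieSubmodule.toSubmodule hP
    have h1 : Module.finrank ℂ V = 1 := finrank_eq_one v hv fun w =>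
      Submodule.mem_span_singleton.mp (hs ▸ Submodule.mem_top)
    have := Module.finite_of_finrank_eq_succ h1
    exact h1 ▸ Submodule.finrank_le (𝒱 j)
  · obtain ⟨ρ, ⟨hgr, hρ⟩ | ⟨hgr, hρ⟩⟩ :=
      h.isAssociative_of_isIndecomposable hN isIndecomposable_of_isIrreducible ht
    · refine finrank_le_one_of_irreducible hN (Or.inl rfl) h.isInternal hgr h.finite
        (fun P hP => ?_) j
      let P' : LieSubmodule ℂ (HatD N) V :=
        { P with lie_mem := fun {x v} hv => by rw [hρ]; exact hP _ v hv }
      exact (IsSimpleOrder.eq_bot_or_eq_top P').imp (congrArg LieSubmodule.toSubmodule)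
        (congrArg LieSubmodule.toSubmodule)
    · refine finrank_le_one_of_irreducible hN (Or.inr rfl) h.isInternal hgr h.finite
        (fun P hP => ?_) j
      let P' : LieSubmodule ℂ (HatD N) V :=
        { P with lie_mem := fun {x v} hv => by rw [hρ]; exact hP _ v hv }
      exact (IsSimpleOrder.eq_bot_or_eq_top P').imp (congrArg LieSubmodule.toSubmodule)
        (congrArg LieSubmodule.toSubmodule)

end HatModule

end

end MatDiffOp

theorem theorem2p2 (N : ℕ) (hN : 1 ≤ N) (V : Type*) [AddCommGroup V] [Module ℂ V]
    [LieRingModule (MatDiffOp.HatD N) V] [LieModule ℂ (MatDiffOp.HatD N) V]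
    (𝒱 : ℤ → Submodule ℂ V) :
    (MatDiffOp.IsQuasifinite N 𝒱 → LieModule.IsIrreducible ℂ (MatDiffOp.HatD N) V →
      MatDiffOp.IsHighestWeightModule N 𝒱 ∨ MatDiffOp.IsLowestWeightModule N 𝒱 ∨
        MatDiffOp.IsIntermediateSeries N 𝒱) ∧
    (MatDiffOp.IsIntermediateSeries N 𝒱 → ¬ LieModule.IsTrivial (MatDiffOp.HatD N) V →
      ∃ α : ℂ,
        Nonempty (V ≃ₗ⁅ℂ, MatDiffOp.HatD N⁆
          MatDiffOp.NatMod N (algebraMap ℂ (Module.End ℂ ℂ) α)) ∨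
        Nonempty (V ≃ₗ⁅ℂ, MatDiffOp.HatD N⁆
          MatDiffOp.TwistMod N (algebraMap ℂ (Module.End ℂ ℂ) α))) ∧
    (MatDiffOp.IsUniformlyBounded N 𝒱 → MatDiffOp.IsIndecomposable N V →
      ¬ LieModule.IsTrivial (MatDiffOp.HatD N) V →
      ∃ (m : ℕ) (α : Module.End ℂ (Fin m → ℂ)), 0 < m ∧ MatDiffOp.IsIndecomposableEnd α ∧
        (Nonempty (V ≃ₗ⁅ℂ, MatDiffOp.HatD N⁆ MatDiffOp.NatMod N α) ∨
          Nonempty (V ≃ₗ⁅ℂ, MatDiffOp.HatD N⁆ MatDiffOp.TwistMod N α))) := by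
  refine ⟨fun h hirr => ?_, fun h ht => ?_, fun h hind ht => ?_⟩
  · exact (h.trichotomy hN).imp_right fun h1 => h1.imp_right fun h2 => h2.isIntermediateSeries hN
  · have hA := h.isAssociative hN ht
    have hV : Nontrivial V := by
      by_contra hV
      rw [not_nontrivial_iff_subsingleton] at hV
      exact ht ⟨fun x v => Subsingleton.elim _ _⟩
    have := h.finite 0
    have h1 : Module.finrank ℂ ℂ = Module.finrank ℂ (𝒱 0) := by
      have h0 := hA.component_ne_zero hN h.toIsQuasifinite 0
      have h2 := h.finrank_le_one 0
      rw [Module.finrank_self]; omega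
    obtain ⟨θ, hθi, hθr⟩ := MatDiffOp.exists_range_eq_of_finrank h1
    obtain ⟨α, hα, -⟩ := hA.exists_equiv hN h.isInternal hθi hθr
    have e : α = algebraMap ℂ (Module.End ℂ ℂ) (α 1) := by
      ext
      simp
    rw [e] at hα
    exact ⟨α 1, hα⟩
  · have hA := h.isAssociative_of_isIndecomposable hN hind ht
    have := h.finite 0
    have := hind.1
    obtain ⟨θ, hθi, hθr⟩ := MatDiffOp.exists_range_eq_of_finrank
      (W := Fin (Module.finrank ℂ (𝒱 0)) → ℂ) (Module.finrank_fin_fun ℂ)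
    obtain ⟨α, hα, hα'⟩ := hA.exists_equiv hN h.isInternal hθi hθr
    exact ⟨_, α, Nat.pos_of_ne_zero (hA.component_ne_zero hN h.toIsQuasifinite 0), hα' hind, hα⟩
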